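/- Let $(M^2,g)$ be a compact (boundaryless, Hausdorff) smooth Riemannian surface, let $(N^n,h)$ be a smooth Riemannian manifold, and let $\varphi:M\to N$ be a smooth Riemannian immersion, i.e. $\varphi^*h=g$. Let $\nabla$ be the Levi-Civita connection of $g$ and also the connection it and the one of $h$ induce on $\varphi^{-1}(TN)$ and on tensor fields, let $B=\nabla d\varphi$ be the second fundamental form, $\tau(\varphi)=\operatorname{trace}B$ the tension field, $H=\frac12\operatorname{trace}B$ the mean curvature vector field, $A_H$ the shape operator in the direction of $H$, i.e. $\langle A_H(X),Y\rangle=\langle B(X,Y),H\rangle$, and let $S_2$ be the stress-bienergy tensor, the tensor field of type $(1,1)$ given by $$\langle S_2(X),Y\rangle=\tfrac12|\tau(\varphi)|^2\langle X,Y\rangle+\langle d\varphi,\nabla\tau(\varphi)\rangle\langle X,Y\rangle-\langle d\varphi(X),\nabla_Y\tau(\varphi)\rangle-\langle d\varphi(Y),\nabla_X\tau(\varphi)\rangle .$$ Let $K$ be the Gaussian curvature of $(M,g)$ and $v_g$ its Riemannian volume measure. Assume that $\varphi$ is biconservative, i.e. $\operatorname{Div}S_2=0$. Then $$\int_M\Big(|\nabla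 S_2|^2+2K\Big(|S_2|^2-\frac{|\tau(\varphi)|^4}{2}\Big)\Big)\,v_g=\int_M\big|\operatorname{grad}\big(|\tau(\varphi)|^2\big)\big|^2\,v_g$$ and, equivalently, $$\int_M\Big(|\nabla A_H|^2+2K\big(|A_H|^2-2|H|^4\big)\Big)\,v_g=\frac52\int_M\big|\operatorname{grad}\big(|H|^2\big)\big|^2\,v_g ,$$ where all four integrands are integrable. -/

import Mathlib

open Bundle MeasureTheory
open scoped Manifold ContDiff

noncomputable section

namespace BiconservativeSurface

/-- A smooth Riemannian metric on a manifold `M` (without boundary) of dimension `m`. -/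
abbrev RiemMetric (m : ℕ) (M : Type*) [TopologicalSpace M]
    [ChartedSpace (EuclideanSpace ℝ (Fin m)) M] [IsManifold (𝓡 m) ∞ M] :=
  ContMDiffRiemannianMetric (𝓡 m) ∞ (EuclideanSpace ℝ (Fin m))
    (fun p : M => TangentSpace (𝓡 m) p)

section OneManifold

variable {m : ℕ} {M : Type*} [TopologicalSpace M]
  [ChartedSpace (EuclideanSpace ℝ (Fin m)) M] [IsManifold (𝓡 m) ∞ M]

/-- The tangent vector at `p` with components `c` in the preferred chart at `p`. -/
def ofComponents (p : M) (c : EuclideanSpace ℝ (Fin m)) : TangentSpace (𝓡 m) p := c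

/-- The components, in the preferred chart at `p`, of a vector tangent to `M` at a point `q` of
that chart. -/
def components (p q : M) (v : TangentSpace (𝓡 m) q) : EuclideanSpace ℝ (Fin m) :=
  (trivializationAt (EuclideanSpace ℝ (Fin m)) (fun x : M => TangentSpace (𝓡 m) x) p ⟨q, v⟩).2

/-- The `i`-th coordinate vector `∂ᵢ` at `p`, for the preferred chart at `p`. -/
def basisVec (p : M) (i : Fin m) : TangentSpace (𝓡 m) p :=
  ofComponents p (EuclideanSpace.single i (1 : ℝ))

/-- The local vector field with constant components, in the preferred chart at `p`, that extends
the tangent vector `v` at `p`. In particular `coordField (basisVec p i)` is the coordinate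
field `∂ᵢ` of that chart. -/
def coordField {p : M} (v : TangentSpace (𝓡 m) p) (q : M) : TangentSpace (𝓡 m) q :=
  FiberBundle.extend (EuclideanSpace ℝ (Fin m)) v q

/-- The Gram matrix of a family of tangent vectors at `q`. -/
def gram (g : RiemMetric m M) (q : M) (b : Fin m → TangentSpace (𝓡 m) q) : Matrix (Fin m) (Fin m) ℝ :=
  Matrix.of fun i j => g.inner q (b i) (b j)

/-- The metric trace `∑ gⁱʲ b(∂ᵢ, ∂ⱼ)` of a bilinear map `b` on the tangent space at `p`. -/
def trace (g : RiemMetric m M) (p : M) {V : Type*} [AddCommGroup V] [Module ℝ V]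
    (b : TangentSpace (𝓡 m) p → TangentSpace (𝓡 m) p → V) : V :=
  ∑ i, ∑ j, (gram g p (basisVec p))⁻¹ i j • b (basisVec p i) (basisVec p j)

/-- The vector `α♯ = ∑ gⁱʲ α(∂ᵢ) ∂ⱼ` metrically dual to a linear form `α` on the tangent space:
`⟨α♯, w⟩ = α(w)`. -/
def sharp (g : RiemMetric m M) (p : M) (α : TangentSpace (𝓡 m) p → ℝ) : TangentSpace (𝓡 m) p :=
  ∑ i, ∑ j, (gram g p (basisVec p))⁻¹ i j • (α (basisVec p i) • basisVec p j)

/-- The gradient of a function. -/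
def grad (g : RiemMetric m M) (f : M → ℝ) (p : M) : TangentSpace (𝓡 m) p :=
  sharp g p fun v => mvfderiv (𝓡 m) f p v

/-- The derivative at `p`, in the direction `u`, of the components of the metric in the preferred
chart at `p`: `u(g(V, W))`, where `V` and `W` extend `v` and `w` with constant components. -/
def dMetric (g : RiemMetric m M) (p : M) (u v w : TangentSpace (𝓡 m) p) : ℝ :=
  mvfderiv (𝓡 m) (fun q => g.inner q (coordField v q) (coordField w q)) p u

/-- The Christoffel symbols at `p` in the preferred chart at `p`, as a bilinear map
`(v, w) ↦ Γᵏᵢⱼ vⁱ wʲ ∂ₖ`. -/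
def christoffel (g : RiemMetric m M) (p : M) (v w : TangentSpace (𝓡 m) p) : TangentSpace (𝓡 m) p :=
  sharp g p fun z => (1 / 2 : ℝ) * (dMetric g p v w z + dMetric g p w v z - dMetric g p z v w)

/-- The Levi-Civita covariant derivative `∇ᵥY` at `p` of the vector field `Y`, computed in the
preferred chart at `p`: `v(Yᵏ) ∂ₖ + Γᵏᵢⱼ vⁱ Yʲ ∂ₖ`. -/
def leviCivita (g : RiemMetric m M) (Y : Π q : M, TangentSpace (𝓡 m) q) (p : M)
    (v : TangentSpace (𝓡 m) p) : TangentSpace (𝓡 m) p :=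
  ofComponents p (mvfderiv (𝓡 m) (fun q => components p q (Y q)) p v)
    + christoffel g p v (Y p)

/-- The curvature tensor `R(U,V)W = ∇_U ∇_V W - ∇_V ∇_U W - ∇_[U,V] W`. -/
def curvature (g : RiemMetric m M) (p : M) (u v w : TangentSpace (𝓡 m) p) : TangentSpace (𝓡 m) p :=
  leviCivita g (fun q => leviCivita g (coordField w) q (coordField v q)) p u
    - leviCivita g (fun q => leviCivita g (coordField w) q (coordField u q)) p v
    - leviCivita g (coordField w) p (VectorField.mlieBracket (𝓡 m) (coordField u) (coordField v) p)

/-- The covariant derivative `(∇ᵤT)(v)` of a tensor field `T` of type `(1,1)`: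
`(∇_U T)(V) = ∇_U (T V) - T (∇_U V)`. -/
def nablaTensor (g : RiemMetric m M) (T : Π q : M, TangentSpace (𝓡 m) q → TangentSpace (𝓡 m) q)
    (p : M) (u v : TangentSpace (𝓡 m) p) : TangentSpace (𝓡 m) p :=
  leviCivita g (fun q => T q (coordField v q)) p u - T p (leviCivita g (coordField v) p u)

/-- The divergence `Div T = trace ∇T` of a tensor field of type `(1,1)`. -/
def divTensor (g : RiemMetric m M) (T : Π q : M, TangentSpace (𝓡 m) q → TangentSpace (𝓡 m) q)
    (p : M) : TangentSpace (𝓡 m) p :=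
  trace g p fun u v => nablaTensor g T p u v

/-- The squared norm `|T|²` of a tensor field of type `(1,1)`. -/
def normSqTensor (g : RiemMetric m M) (T : Π q : M, TangentSpace (𝓡 m) q → TangentSpace (𝓡 m) q)
    (p : M) : ℝ :=
  trace g p fun v w => g.inner p (T p v) (T p w)

/-- The squared norm `|∇T|²` of the covariant derivative of a tensor field of type `(1,1)`. -/
def normSqNablaTensor (g : RiemMetric m M)
    (T : Π q : M, TangentSpace (𝓡 m) q → TangentSpace (𝓡 m) q) (p : M) : ℝ :=
  trace g p fun u u' => trace g p fun v v' =>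
    g.inner p (nablaTensor g T p u v) (nablaTensor g T p u' v')

/-- The Riemannian volume of the domain of the preferred chart at `x`: the push-forward of Lebesgue
measure by the inverse of the chart, with density `√det(gᵢⱼ)`. -/
def chartVolume [MeasurableSpace M] (g : RiemMetric m M) (x : M) : Measure M :=
  (((volume : Measure (EuclideanSpace ℝ (Fin m))).restrict
    (chartAt (EuclideanSpace ℝ (Fin m)) x).target).map
      (chartAt (EuclideanSpace ℝ (Fin m)) x).symm).withDensity
        fun q => ENNReal.ofReal (Real.sqrt (gram g q fun i => coordField (basisVec x i) q).det)

/-- The Riemannian volume measure `v_g`. The measures `chartVolume g x` agree on the overlaps of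
the charts; their supremum is the measure that restricts to each of them. -/
def riemannianVolume [MeasurableSpace M] (g : RiemMetric m M) : Measure M :=
  ⨆ x : M, chartVolume g x

end OneManifold

section Surface

variable {M : Type*} [TopologicalSpace M]
  [ChartedSpace (EuclideanSpace ℝ (Fin 2)) M] [IsManifold (𝓡 2) ∞ M]

/-- The Gaussian curvature of a surface: `⟨R(U,V)V, U⟩ / (|U|²|V|² - ⟨U,V⟩²)`. -/
def gaussCurvature (g : RiemMetric 2 M) (p : M) : ℝ :=
  g.inner p (curvature g p (basisVec p 0) (basisVec p 1) (basisVec p 1)) (basisVec p 0)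
    / (gram g p (basisVec p)).det

end Surface

section Maps

variable {m n : ℕ} {M N : Type*}
  [TopologicalSpace M] [ChartedSpace (EuclideanSpace ℝ (Fin m)) M] [IsManifold (𝓡 m) ∞ M]
  [TopologicalSpace N] [ChartedSpace (EuclideanSpace ℝ (Fin n)) N] [IsManifold (𝓡 n) ∞ N]

/-- `φ` is a smooth Riemannian (isometric) immersion of `(M, g)` into `(N, h)`. -/
def IsRiemannianImmersion (g : RiemMetric m M) (h : RiemMetric n N) (φ : M → N) : Prop :=
  ContMDiff (𝓡 m) (𝓡 n) ∞ φ ∧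
    ∀ (p : M) (v w : TangentSpace (𝓡 m) p),
      h.inner (φ p) (mfderiv (𝓡 m) (𝓡 n) φ p v) (mfderiv (𝓡 m) (𝓡 n) φ p w) = g.inner p v w

/-- The covariant derivative `∇ᵥW` at `p` of a section `W` of the pull-back bundle `φ⁻¹(TN)`, for
the connection induced by the Levi-Civita connection of `(N, h)`, computed in the preferred chart
at `φ p`: `v(Wᵏ) ∂ₖ + Γᵏᵢⱼ dφ(v)ⁱ Wʲ ∂ₖ`. -/
def nablaAlong (h : RiemMetric n N) (φ : M → N) (W : Π q : M, TangentSpace (𝓡 n) (φ q)) (p : M)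
    (v : TangentSpace (𝓡 m) p) : TangentSpace (𝓡 n) (φ p) :=
  ofComponents (φ p) (mvfderiv (𝓡 m) (fun q => components (φ p) (φ q) (W q)) p v)
    + christoffel h (φ p) (mfderiv (𝓡 m) (𝓡 n) φ p v) (W p)

/-- The second fundamental form `B = ∇dφ`: `B(v, W) = ∇ᵥ(dφ(W)) - dφ(∇ᵥW)`. For a Riemannian
immersion it takes its values in the normal bundle, by the Gauss formula. -/
def secondFundamentalForm (g : RiemMetric m M) (h : RiemMetric n N) (φ : M → N) (p : M)
    (v w : TangentSpace (𝓡 m) p) : TangentSpace (𝓡 n) (φ p) :=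
  nablaAlong h φ (fun q => mfderiv (𝓡 m) (𝓡 n) φ q (coordField w q)) p v
    - mfderiv (𝓡 m) (𝓡 n) φ p (leviCivita g (coordField w) p v)

/-- The tension field `τ(φ) = trace ∇dφ`. -/
def tension (g : RiemMetric m M) (h : RiemMetric n N) (φ : M → N) (p : M) : TangentSpace (𝓡 n) (φ p) :=
  trace g p fun v w => secondFundamentalForm g h φ p v w

/-- The squared norm `|τ(φ)|²`. -/
def normSqTension (g : RiemMetric m M) (h : RiemMetric n N) (φ : M → N) (p : M) : ℝ :=
  h.inner (φ p) (tension g h φ p) (tension g h φ p)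

/-- The mean curvature vector field `H = (1/m) trace B`. -/
def meanCurvature (g : RiemMetric m M) (h : RiemMetric n N) (φ : M → N) (p : M) :
    TangentSpace (𝓡 n) (φ p) :=
  (1 / m : ℝ) • trace g p fun v w => secondFundamentalForm g h φ p v w

/-- The squared norm `|H|²`. -/
def normSqMeanCurvature (g : RiemMetric m M) (h : RiemMetric n N) (φ : M → N) (p : M) : ℝ :=
  h.inner (φ p) (meanCurvature g h φ p) (meanCurvature g h φ p)

/-- The shape operator in the direction of `H`: `⟨A_H(v), w⟩ = ⟨B(v, w), H⟩`. -/
def shapeOperatorH (g : RiemMetric m M) (h : RiemMetric n N) (φ : M → N) (p : M)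
    (v : TangentSpace (𝓡 m) p) : TangentSpace (𝓡 m) p :=
  sharp g p fun w =>
    h.inner (φ p) (secondFundamentalForm g h φ p v w) (meanCurvature g h φ p)

/-- The stress-bienergy tensor `S₂`, as a tensor field of type `(1,1)`:
`⟨S₂(v), w⟩ = ½|τ|²⟨v,w⟩ + ⟨dφ, ∇τ⟩⟨v,w⟩ - ⟨dφ(v), ∇_w τ⟩ - ⟨dφ(w), ∇_v τ⟩`. -/
def stressBienergy (g : RiemMetric m M) (h : RiemMetric n N) (φ : M → N) (p : M)
    (v : TangentSpace (𝓡 m) p) : TangentSpace (𝓡 m) p :=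
  sharp g p fun w =>
    (1 / 2 : ℝ) * normSqTension g h φ p * g.inner p v w
      + (trace g p fun u u' => h.inner (φ p) (mfderiv (𝓡 m) (𝓡 n) φ p u)
          (nablaAlong h φ (tension g h φ) p u')) * g.inner p v w
      - h.inner (φ p) (mfderiv (𝓡 m) (𝓡 n) φ p v) (nablaAlong h φ (tension g h φ) p w)
      - h.inner (φ p) (mfderiv (𝓡 m) (𝓡 n) φ p w) (nablaAlong h φ (tension g h φ) p v)

/-- `φ` is biconservative: `Div S₂ = 0`. -/
def IsBiconservative (g : RiemMetric m M) (h : RiemMetric n N) (φ : M → N) : Prop :=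
  ∀ p : M, divTensor g (stressBienergy g h φ) p = 0

end Maps

end BiconservativeSurface

end

open BiconservativeSurface

section

open Bundle MeasureTheory Filter Set
open scoped Manifold ContDiff Topology

set_option maxSynthPendingDepth 3
set_option linter.unusedSectionVars false

noncomputable section

namespace BiconservativeSurface

/-! The first formula is a Weitzenböck formula for T = S₂. The tension field of an isometric
immersion is normal, so Weingarten's equation gives ⟨dφ(v), ∇_w τ⟩ = -⟨B(v, w), τ⟩, and S₂ becomes 2
A_τ - ½|τ|² Id, with A_τ the shape operator in the direction τ (`stressBienergy_eq`). Hence T is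
smooth and symmetric, its trace is t = |τ|² because dim M = 2, and Div T = 0 by hypothesis.

For every such T on a surface, the vector field X with ⟨X, w⟩ = Σ ⟨(∇_{e_k} T) w, T e_k⟩ has
divergence |∇T|² + 2K(|T|² - t²/2) - |grad t|². To see this, take a local orthonormal frame with
connection form ω = ⟨∇e₁, e₂⟩ and put α = (T₁₁ - T₂₂)/2, β = T₁₂. Contracting the area form with X
gives η = -2(α dβ - β dα + 2(α² + β²) ω) (`IsFrame.fluxForm_apply`,
`IsChartFrame.toCoord_fluxField`), and dη is computed in `IsFrame.fderiv_fluxForm`; the curvature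
term comes from dω = -K · area. Both steps use Div T = 0. The divergence theorem on the compact
surface (`integral_divergence_eq_zero`) then gives `integral_weitzenboeck`.

The second formula is the first one rewritten. Since A_H = ¼ S₂ + ⅛|τ|² Id and |H|² = ¼|τ|², its
left integrand is 1/16 of the first one plus 3/32 |grad t|², and 1/16 + 3/32 = 5/2 · 1/16
(`shapeOperatorH_integrand`).

The rest is chart independence. The invariants are defined at each point through the preferred chart
at that very point, a choice that need not vary continuously, so each of them is expressed in one
fixed chart before it is differentiated. This rests on `christ_pullback`: for transition maps it is
the transformation law of the Christoffel symbols, and for φ it is the normality of B. -/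

abbrev Euc (m : ℕ) := EuclideanSpace ℝ (Fin m)

/-! ### Tangent vectors in a fixed chart. -/

section ChartBasics

variable {m : ℕ} {M : Type*} [TopologicalSpace M]
  [ChartedSpace (EuclideanSpace ℝ (Fin m)) M] [IsManifold (𝓡 m) ∞ M]

/-- The coordinates of tangent vectors at `q` in the preferred chart at `x`. -/
def toCoord (x q : M) : TangentSpace (𝓡 m) q →L[ℝ] Euc m :=
  (trivializationAt (Euc m) (fun p : M => TangentSpace (𝓡 m) p) x).continuousLinearMapAt ℝ q

/-- The tangent vector at `q` with given coordinates in the preferred chart at `x`. -/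
def ofCoord (x q : M) : Euc m →L[ℝ] TangentSpace (𝓡 m) q :=
  (trivializationAt (Euc m) (fun p : M => TangentSpace (𝓡 m) p) x).symmL ℝ q

/-- The preferred chart at `x`. -/
abbrev chart (m : ℕ) {M : Type*} [TopologicalSpace M] [ChartedSpace (EuclideanSpace ℝ (Fin m)) M]
    (x : M) : OpenPartialHomeomorph M (Euc m) := chartAt (Euc m) x

theorem toCoord_ofCoord {x q : M} (hq : q ∈ (chart m x).source) (a : Euc m) :
    toCoord x q (ofCoord x q a) = a :=
  Trivialization.continuousLinearMapAt_symmL _ hq a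

theorem ofCoord_toCoord {x q : M} (hq : q ∈ (chart m x).source) (v : TangentSpace (𝓡 m) q) :
    ofCoord x q (toCoord x q v) = v :=
  Trivialization.symmL_continuousLinearMapAt _ hq v

theorem components_eq {x q : M} (hq : q ∈ (chart m x).source) (v : TangentSpace (𝓡 m) q) :
    components x q v = toCoord x q v := by
  unfold components toCoord
  rw [Trivialization.continuousLinearMapAt_apply, Trivialization.coe_linearMapAt_of_mem _ hq]

theorem coordField_eq {p q : M} (hq : q ∈ (chart m p).source) (v : TangentSpace (𝓡 m) p) :
    coordField v q = ofCoord p q (toCoord p p v) := by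
  rw [← components_eq (mem_chart_source _ p), ofCoord, Trivialization.symmL_apply _ hq]
  rfl

/-- The tangent space at `p` is the model space by way of the preferred chart at `p`, so the
trivialization of that chart is the identity over its own centre. -/
theorem toCoord_self (p : M) (v : TangentSpace (𝓡 m) p) :
    ofComponents p (toCoord p p v) = v := by
  rw [toCoord, TangentBundle.continuousLinearMapAt_trivializationAt_eq_core (mem_chart_source _ p)]
  exact (tangentBundleCore (𝓡 m) M).coordChange_self (achart _ p) p (mem_chart_source _ p) v

theorem ofComponents_eq (p : M) (a : Euc m) : ofComponents p a = ofCoord p p a := by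
  have h := toCoord_self p (ofCoord p p a)
  rwa [toCoord_ofCoord (mem_chart_source _ p)] at h

theorem contDiffAt_transition {x y q : M} (hx : q ∈ (chart m x).source) (hy : q ∈ (chart m y).source) :
    ContDiffAt ℝ ∞ (chart m y ∘ (chart m x).symm) (chart m x q) := by
  have h := contDiffWithinAt_ext_coord_change (I := 𝓡 m) (n := ∞) y x (y := chart m x q) (by
    simp [hx, hy])
  rw [← contDiffWithinAt_univ]
  simpa using h

/-- Both trivializations pass through the preferred chart at `q`; the cocycle condition of the
tangent bundle merges the two coordinate changes into one, the derivative of the transition map. -/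
theorem toCoord_ofCoord' {x y q : M} (hx : q ∈ (chart m x).source) (hy : q ∈ (chart m y).source)
    (a : Euc m) :
    toCoord y q (ofCoord x q a) = fderiv ℝ (chart m y ∘ (chart m x).symm) (chart m x q) a := by
  rw [toCoord, ofCoord, TangentBundle.continuousLinearMapAt_trivializationAt_eq_core hy,
    TangentBundle.symmL_trivializationAt_eq_core hx]
  refine ((tangentBundleCore (𝓡 m) M).coordChange_comp (achart _ x) (achart _ q) (achart _ y) q
    ⟨⟨hx, mem_chart_source _ q⟩, hy⟩ a).trans ?_
  rw [tangentBundleCore_coordChange_achart]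
  simp

theorem toCoord_eq_fderiv {x p : M} (hx : p ∈ (chart m x).source) (v : TangentSpace (𝓡 m) p) :
    toCoord x p v = fderiv ℝ (chart m x ∘ (chart m p).symm) (chart m p p) (toCoord p p v) := by
  conv_lhs => rw [← ofCoord_toCoord (mem_chart_source _ p) v]
  rw [toCoord_ofCoord' (mem_chart_source _ p) hx]

end ChartBasics

/-! ### Derivatives of functions and of maps in arbitrary charts. -/

section Maps

variable {m n : ℕ} {M N : Type*}
  [TopologicalSpace M] [ChartedSpace (EuclideanSpace ℝ (Fin m)) M] [IsManifold (𝓡 m) ∞ M]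
  [TopologicalSpace N] [ChartedSpace (EuclideanSpace ℝ (Fin n)) N] [IsManifold (𝓡 n) ∞ N]

omit [IsManifold (𝓡 m) ∞ M] in
theorem eventually_chart_symm {x p : M} (hx : p ∈ (chart m x).source) {P : M → Prop}
    (hP : ∀ᶠ q in 𝓝 p, P q) : ∀ᶠ z in 𝓝 (chart m x p), P ((chart m x).symm z) := by
  have h := (chart m x).continuousAt_symm ((chart m x).map_source hx)
  rw [ContinuousAt, (chart m x).left_inv hx] at h
  exact h.eventually hP

/-- The chain rule through the transition map from the chart at `p`. The gain is that `x` stays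
fixed while `p` moves, so the right side can be differentiated again. -/
theorem mvfderiv_eq_fderiv {V : Type*} [NormedAddCommGroup V] [NormedSpace ℝ V] {f : M → V}
    {x p : M} (hx : p ∈ (chart m x).source)
    (hf : DifferentiableAt ℝ (f ∘ (chart m x).symm) (chart m x p)) (v : TangentSpace (𝓡 m) p) :
    mvfderiv (𝓡 m) f p v = fderiv ℝ (f ∘ (chart m x).symm) (chart m x p) (toCoord x p v) := by
  have hp := mem_chart_source (Euc m) p
  have htr := contDiffAt_transition hp hx
  have htrd := htr.differentiableAt (by simp)
  have hpt : (chart m x ∘ (chart m p).symm) (chart m p p) = chart m x p := by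
    simp [(chart m p).left_inv hp]
  have hev : f ∘ (chart m p).symm =ᶠ[𝓝 (chart m p p)]
      (f ∘ (chart m x).symm) ∘ (chart m x ∘ (chart m p).symm) := by
    filter_upwards [eventually_chart_symm hp ((chart m x).open_source.mem_nhds hx)] with z hz
    simp [(chart m x).left_inv hz]
  have hfd : DifferentiableAt ℝ (f ∘ (chart m x).symm) ((chart m x ∘ (chart m p).symm) (chart m p p)) := by
    rwa [hpt]
  have hd : DifferentiableAt ℝ (f ∘ (chart m p).symm) (chart m p p) :=
    (hfd.comp _ htrd).congr_of_eventuallyEq hev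
  have hc : ContinuousAt f p := by
    have h1 : ContinuousAt ((f ∘ (chart m x).symm) ∘ chart m x) p :=
      hf.continuousAt.comp ((chart m x).continuousAt hx)
    refine h1.congr ?_
    filter_upwards [(chart m x).open_source.mem_nhds hx] with q hq
    simp [(chart m x).left_inv hq]
  have hw : writtenInExtChartAt (𝓡 m) 𝓘(ℝ, V) p f = f ∘ (chart m p).symm := rfl
  -- `mfderiv` is zero by convention when differentiability fails, so unfolding it needs this.
  have hmd : MDifferentiableAt (𝓡 m) 𝓘(ℝ, V) f p := by
    rw [mdifferentiableAt_iff]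
    refine ⟨hc, ?_⟩
    rw [hw]
    simpa using hd.differentiableWithinAt
  have h1 : mvfderiv (𝓡 m) f p v = fderiv ℝ (f ∘ (chart m p).symm) (chart m p p) (toCoord p p v) := by
    have h2 : mfderiv (𝓡 m) 𝓘(ℝ, V) f p =
        fderivWithin ℝ (writtenInExtChartAt (𝓡 m) 𝓘(ℝ, V) p f) (range (𝓡 m)) (extChartAt (𝓡 m) p p) :=
      if_pos hmd
    have h3 : mvfderiv (𝓡 m) f p v = fderivWithin ℝ (writtenInExtChartAt (𝓡 m) 𝓘(ℝ, V) p f)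
      (range (𝓡 m)) (extChartAt (𝓡 m) p p) (v : Euc m) := by
      rw [← h2]; rfl
    have h4 : (v : Euc m) = toCoord p p v := (toCoord_self p v).symm
    have h5 : fderivWithin ℝ (writtenInExtChartAt (𝓡 m) 𝓘(ℝ, V) p f) (range (𝓡 m))
        (extChartAt (𝓡 m) p p) = fderiv ℝ (f ∘ (chart m p).symm) (chart m p p) := by
      rw [hw]
      simp
    rw [h3, h5]
    exact congrArg _ h4
  rw [h1, hev.fderiv_eq, fderiv_comp _ hfd htrd, hpt, toCoord_eq_fderiv hx]
  rfl

/-- A map read in the preferred charts at `x` and `y`. -/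
def inCharts (φ : M → N) (x : M) (y : N) : Euc m → Euc n := chart n y ∘ φ ∘ (chart m x).symm

theorem contDiffAt_inCharts {φ : M → N} (hφ : ContMDiff (𝓡 m) (𝓡 n) ∞ φ) {x p : M} {y : N}
    (hx : p ∈ (chart m x).source) (hy : φ p ∈ (chart n y).source) :
    ContDiffAt ℝ ∞ (inCharts (m := m) (n := n) φ x y) (chart m x p) := by
  rw [← contDiffWithinAt_univ]
  have h := (contMDiffAt_iff_of_mem_source (I := 𝓡 m) (I' := 𝓡 n) hx hy).1 (hφ p)
  simpa [inCharts, Function.comp_def] using h.2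

theorem toCoord_mfderiv {φ : M → N} (hφ : ContMDiff (𝓡 m) (𝓡 n) ∞ φ) {x p : M} {y : N}
    (hx : p ∈ (chart m x).source) (hy : φ p ∈ (chart n y).source) (v : TangentSpace (𝓡 m) p) :
    toCoord y (φ p) (mfderiv (𝓡 m) (𝓡 n) φ p v) =
      fderiv ℝ (inCharts φ x y) (chart m x p) (toCoord x p v) := by
  have hp := mem_chart_source (Euc m) p
  have hφp := mem_chart_source (Euc n) (φ p)
  have hmd : MDifferentiableAt (𝓡 m) (𝓡 n) φ p := (hφ p).mdifferentiableAt (by simp)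
  have h1 : toCoord (φ p) (φ p) (mfderiv (𝓡 m) (𝓡 n) φ p v) =
      fderiv ℝ (inCharts φ p (φ p)) (chart m p p) (toCoord p p v) := by
    have h2 : mfderiv (𝓡 m) (𝓡 n) φ p =
        fderivWithin ℝ (writtenInExtChartAt (𝓡 m) (𝓡 n) p φ) (range (𝓡 m)) (extChartAt (𝓡 m) p p) :=
      if_pos hmd
    have h3 := toCoord_self (φ p) (mfderiv (𝓡 m) (𝓡 n) φ p v)
    refine Eq.trans (b := ofComponents (φ p) (toCoord (φ p) (φ p) (mfderiv (𝓡 m) (𝓡 n) φ p v))) rfl ?_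
    rw [h3]
    have h4 : (v : Euc m) = toCoord p p v := (toCoord_self p v).symm
    have h5 : (mfderiv (𝓡 m) (𝓡 n) φ p v : Euc n) = fderivWithin ℝ
      (writtenInExtChartAt (𝓡 m) (𝓡 n) p φ) (range (𝓡 m)) (extChartAt (𝓡 m) p p) (v : Euc m) := by
      rw [← h2]; rfl
    refine Eq.trans h5 ?_
    have h6 : fderivWithin ℝ (writtenInExtChartAt (𝓡 m) (𝓡 n) p φ) (range (𝓡 m))
        (extChartAt (𝓡 m) p p) = fderiv ℝ (inCharts φ p (φ p)) (chart m p p) := by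
      simp [writtenInExtChartAt, Function.comp_def, inCharts]
    rw [h6]
    exact congrArg _ h4
  have htr := (contDiffAt_transition hp hx).differentiableAt (by simp)
  have htr' := (contDiffAt_transition hφp hy).differentiableAt (by simp)
  have hd := (contDiffAt_inCharts hφ hx hφp).differentiableAt (by simp)
  have hd1 := (contDiffAt_inCharts hφ hx hy).differentiableAt (by simp)
  have hd2 := (contDiffAt_inCharts hφ hp hφp).differentiableAt (by simp)
  -- Both sides read `φ` from the chart at `p` to the chart at `y`; differentiating them changes the
  -- source and target charts together.
  have e1 : (chart n y ∘ (chart n (φ p)).symm) ∘ (inCharts φ p (φ p)) =ᶠ[𝓝 (chart m p p)]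
      inCharts φ x y ∘ (chart m x ∘ (chart m p).symm) := by
    have hc : ∀ᶠ q in 𝓝 p, φ q ∈ (chart n (φ p)).source :=
      hφ.continuous.continuousAt.eventually ((chart n (φ p)).open_source.mem_nhds hφp)
    filter_upwards [eventually_chart_symm hp hc,
      eventually_chart_symm hp ((chart m x).open_source.mem_nhds hx)] with z hz hz'
    simp only [inCharts, Function.comp_apply]
    rw [(chart n (φ p)).left_inv hz, (chart m x).left_inv hz']
  have hpt1 : inCharts φ p (φ p) (chart m p p) = chart n (φ p) (φ p) := by
    simp [inCharts]
  have hpt2 : (chart m x ∘ (chart m p).symm) (chart m p p) = chart m x p := by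
    simp [(chart m p).left_inv hp]
  have e2 := e1.fderiv_eq (𝕜 := ℝ)
  rw [fderiv_comp _ (by rwa [hpt1]) hd2, fderiv_comp _ (by rwa [hpt2]) htr, hpt1, hpt2] at e2
  rw [toCoord_eq_fderiv hy, h1, toCoord_eq_fderiv hx]
  exact congrArg (fun L => L (toCoord p p v)) e2

end Maps

theorem two_le_infty : (2 : WithTop ℕ∞) ≤ ∞ := by
  have h : ((2 : ℕ∞) : WithTop ℕ∞) ≤ ((⊤ : ℕ∞) : WithTop ℕ∞) := WithTop.coe_le_coe.2 le_top
  exact h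

/-! ### Metrics and Christoffel symbols on a vector space. -/

section FlatMetric

variable {E F : Type*} [NormedAddCommGroup E] [NormedSpace ℝ E]
  [NormedAddCommGroup F] [NormedSpace ℝ F]

/-- A symmetric positive definite bilinear form. -/
structure IsInner (B : E →L[ℝ] E →L[ℝ] ℝ) : Prop where
  symm : ∀ a b, B a b = B b a
  pos : ∀ a, a ≠ 0 → 0 < B a a

theorem IsInner.ext {B : E →L[ℝ] E →L[ℝ] ℝ} (hB : IsInner B) {a b : E}
    (h : ∀ c, B a c = B b c) : a = b := by
  by_contra hab
  have h1 := hB.pos (a - b) (sub_ne_zero.2 hab)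
  have h2 : B (a - b) (a - b) = B a (a - b) - B b (a - b) := by simp
  rw [h2, h (a - b), sub_self] at h1
  exact lt_irrefl _ h1

/-- The Christoffel symbols of the first kind of a metric on a vector space. -/
def koszul (G : E → E →L[ℝ] E →L[ℝ] ℝ) (z : E) : E →L[ℝ] E →L[ℝ] E →L[ℝ] ℝ :=
  (1 / 2 : ℝ) • (fderiv ℝ G z + (fderiv ℝ G z).flip -
    (ContinuousLinearMap.flipₗᵢ ℝ E E ℝ).toContinuousLinearEquiv.toContinuousLinearMap ∘L
      (fderiv ℝ G z).flip)

theorem koszul_apply (G : E → E →L[ℝ] E →L[ℝ] ℝ) (z a b c : E) :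
    koszul G z a b c =
      (1 / 2 : ℝ) * (fderiv ℝ G z a b c + fderiv ℝ G z b a c - fderiv ℝ G z c a b) := by
  simp [koszul]

/-- The Christoffel symbols of a metric on a vector space. -/
def christ (G : E → E →L[ℝ] E →L[ℝ] ℝ) (z : E) : E →L[ℝ] E →L[ℝ] E :=
  (ContinuousLinearMap.compL ℝ E (E →L[ℝ] ℝ) E (G z).inverse) ∘L koszul G z

variable [FiniteDimensional ℝ E]

/-- Definiteness gives injectivity, and dimensions agree. Without this, the `inverse` in `christ`
could be the default value for a non-invertible map. -/
theorem IsInner.exists_equiv {B : E →L[ℝ] E →L[ℝ] ℝ} (hB : IsInner B) :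
    ∃ e : E ≃L[ℝ] (E →L[ℝ] ℝ), (e : E →L[ℝ] E →L[ℝ] ℝ) = B := by
  have hinj : Function.Injective B.toLinearMap := fun a b hab =>
    hB.ext fun c => congrArg (fun L : E →L[ℝ] ℝ => L c) hab
  have hdim : Module.finrank ℝ E = Module.finrank ℝ (E →L[ℝ] ℝ) := by
    rw [← (LinearMap.toContinuousLinearMap (𝕜 := ℝ) (E := E) (F' := ℝ)).finrank_eq]
    exact (Subspace.dual_finrank_eq (K := ℝ) (V := E)).symm
  refine ⟨(LinearEquiv.ofInjectiveOfFinrankEq B.toLinearMap hinj hdim).toContinuousLinearEquiv, ?_⟩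
  ext a b
  rfl

theorem christ_spec {G : E → E →L[ℝ] E →L[ℝ] ℝ} {z : E} (hG : IsInner (G z)) (a b c : E) :
    G z (christ G z a b) c = koszul G z a b c := by
  obtain ⟨e, he⟩ := hG.exists_equiv
  simp only [christ, ContinuousLinearMap.comp_apply, ContinuousLinearMap.compL_apply]
  rw [← he]
  simp

theorem contDiffAt_christ {G : E → E →L[ℝ] E →L[ℝ] ℝ} {z : E} (hG : IsInner (G z))
    (hs : ContDiffAt ℝ ∞ G z) : ContDiffAt ℝ ∞ (christ G) z := by
  obtain ⟨e, he⟩ := hG.exists_equiv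
  have h1 : ContDiffAt ℝ ∞ (fun z => (G z).inverse) z := by
    refine ContDiffAt.comp (g := ContinuousLinearMap.inverse) z ?_ hs
    rw [← he]
    exact contDiffAt_map_inverse e
  have h2 : ContDiffAt ℝ ∞ (fderiv ℝ G) z := hs.fderiv_right (by simp)
  have h3 : ContDiffAt ℝ ∞ (fun z => (fderiv ℝ G z).flip) z :=
    ((ContinuousLinearMap.flipₗᵢ ℝ E E
      (E →L[ℝ] ℝ)).toContinuousLinearEquiv.contDiff.contDiffAt).comp z h2
  have h4 : ContDiffAt ℝ ∞ (koszul G) z := by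
    unfold koszul
    exact ((h2.add h3).sub (contDiffAt_const.clm_comp h3)).const_smul (1 / 2 : ℝ)
  have h5 : ContDiffAt ℝ ∞
      (fun z => ContinuousLinearMap.compL ℝ E (E →L[ℝ] ℝ) E (G z).inverse) z :=
    (ContinuousLinearMap.compL ℝ E (E →L[ℝ] ℝ) E).contDiff.contDiffAt.comp z h1
  exact h5.clm_comp h4

/-- `G` is a smooth metric near `z`. -/
structure IsMetricAt (G : E → E →L[ℝ] E →L[ℝ] ℝ) (z : E) : Prop where
  inner : ∀ᶠ w in 𝓝 z, IsInner (G w)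
  smooth : ContDiffAt ℝ ∞ G z

variable {G : E → E →L[ℝ] E →L[ℝ] ℝ} {z : E}

omit [FiniteDimensional ℝ E] in
theorem IsMetricAt.isInner (h : IsMetricAt G z) : IsInner (G z) := h.inner.self_of_nhds

omit [FiniteDimensional ℝ E] in
theorem IsMetricAt.differentiableAt (h : IsMetricAt G z) : DifferentiableAt ℝ G z :=
  h.smooth.differentiableAt (by simp)

omit [FiniteDimensional ℝ E] in
theorem IsMetricAt.fderiv_symm (h : IsMetricAt G z) (a b c : E) :
    fderiv ℝ G z a b c = fderiv ℝ G z a c b := by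
  have key : ∀ b c, fderiv ℝ (fun w => G w b c) z a = fderiv ℝ G z a b c := by
    intro b c
    have := ((h.differentiableAt.hasFDerivAt.clm_apply (hasFDerivAt_const b z)).clm_apply
      (hasFDerivAt_const c z)).fderiv
    rw [this]; simp
  rw [← key b c, ← key c b]
  have : (fun w => G w b c) =ᶠ[𝓝 z] fun w => G w c b := by
    filter_upwards [h.inner] with w hw using hw.symm b c
  rw [this.fderiv_eq]

theorem IsMetricAt.christ_symm (h : IsMetricAt G z) (a b : E) :
    christ G z a b = christ G z b a := by
  refine h.isInner.ext fun c => ?_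
  rw [christ_spec h.isInner, christ_spec h.isInner, koszul_apply, koszul_apply,
    h.fderiv_symm c a b]
  ring

/-- In the sum of the two Koszul expressions with `a` and `b` exchanged, everything but the
derivative in the direction `c` cancels: the connection is metric. -/
theorem IsMetricAt.compat (h : IsMetricAt G z) (c a b : E) :
    fderiv ℝ G z c a b = G z (christ G z c a) b + G z a (christ G z c b) := by
  rw [h.isInner.symm a, christ_spec h.isInner, christ_spec h.isInner, koszul_apply, koszul_apply,
    h.fderiv_symm c b a, h.fderiv_symm b c a, h.fderiv_symm a c b]
  ring

variable [FiniteDimensional ℝ F]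

/-- The transformation law of the Christoffel symbols under an isometric immersion. -/
theorem christ_pullback {H : F → F →L[ℝ] F →L[ℝ] ℝ} {f : E → F} (hG : IsMetricAt G z)
    (hH : IsMetricAt H (f z)) (hf : ContDiffAt ℝ ∞ f z)
    (hiso : ∀ᶠ w in 𝓝 z, ∀ a b, G w a b = H (f w) (fderiv ℝ f w a) (fderiv ℝ f w b))
    (a b c : E) :
    H (f z) (fderiv ℝ (fderiv ℝ f) z a b +
      christ H (f z) (fderiv ℝ f z a) (fderiv ℝ f z b)) (fderiv ℝ f z c) =
      G z (christ G z a b) c := by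
  have hfd : HasFDerivAt f (fderiv ℝ f z) z := (hf.differentiableAt (by simp)).hasFDerivAt
  have hf2 : HasFDerivAt (fderiv ℝ f) (fderiv ℝ (fderiv ℝ f) z) z :=
    ((hf.fderiv_right (m := ∞) (by simp)).differentiableAt (by simp)).hasFDerivAt
  have hHd := hH.differentiableAt.hasFDerivAt.comp z hfd
  -- The derivative of the isometry condition. In the Koszul combination of its three instances,
  -- symmetry of the second derivative of `f` cancels every second-derivative term except twice the
  -- one with arguments `a`, `b`.
  have key : ∀ u a b, fderiv ℝ G z u a b =
      fderiv ℝ H (f z) (fderiv ℝ f z u) (fderiv ℝ f z a) (fderiv ℝ f z b)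
      + H (f z) (fderiv ℝ (fderiv ℝ f) z u a) (fderiv ℝ f z b)
      + H (f z) (fderiv ℝ f z a) (fderiv ℝ (fderiv ℝ f) z u b) := by
    intro u a b
    have h1 := ((hG.differentiableAt.hasFDerivAt.clm_apply (hasFDerivAt_const a z)).clm_apply
      (hasFDerivAt_const b z)).fderiv
    have h2 := ((hHd.clm_apply (hf2.clm_apply (hasFDerivAt_const a z))).clm_apply
      (hf2.clm_apply (hasFDerivAt_const b z))).fderiv
    have h3 : (fun w => G w a b) =ᶠ[𝓝 z]
        fun w => (H ∘ f) w (fderiv ℝ f w a) (fderiv ℝ f w b) := by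
      filter_upwards [hiso] with w hw using hw a b
    have h4 := h3.fderiv_eq (𝕜 := ℝ)
    rw [h1, h2] at h4
    have h5 := congrArg (fun L : E →L[ℝ] ℝ => L u) h4
    simp at h5
    rw [h5]
    ring
  have hsymm : ∀ u v, fderiv ℝ (fderiv ℝ f) z u v = fderiv ℝ (fderiv ℝ f) z v u := fun u v =>
    (hf.isSymmSndFDerivAt (by simp only [minSmoothness_of_isRCLikeNormedField]; exact two_le_infty)).eq u v
  rw [christ_spec hG.isInner, map_add, add_apply, christ_spec hH.isInner,
    koszul_apply, koszul_apply, key, key, key, hsymm b a, hsymm c a, hsymm c b,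
    hH.isInner.symm (fderiv ℝ f z a), hH.isInner.symm (fderiv ℝ f z b)]
  ring

end FlatMetric

/-! ### The metric in a chart, and musical isomorphisms. -/

section CoordMetric

variable {m : ℕ} {M : Type*} [TopologicalSpace M]
  [ChartedSpace (EuclideanSpace ℝ (Fin m)) M] [IsManifold (𝓡 m) ∞ M]

/-- The metric in the preferred chart at `x`. -/
def coordMetric (g : RiemMetric m M) (x : M) (z : Euc m) : Euc m →L[ℝ] Euc m →L[ℝ] ℝ :=
  ContinuousLinearMap.precomp ℝ (ofCoord x ((chart m x).symm z)) ∘L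
    (g.inner ((chart m x).symm z) ∘L ofCoord x ((chart m x).symm z))

theorem coordMetric_apply (g : RiemMetric m M) (x : M) (z a b : Euc m) :
    coordMetric g x z a b = g.inner ((chart m x).symm z) (ofCoord x ((chart m x).symm z) a)
      (ofCoord x ((chart m x).symm z) b) := by
  simp [coordMetric]

theorem inner_eq_coordMetric (g : RiemMetric m M) {x q : M} (hq : q ∈ (chart m x).source)
    (v w : TangentSpace (𝓡 m) q) :
    g.inner q v w = coordMetric g x (chart m x q) (toCoord x q v) (toCoord x q w) := by
  rw [coordMetric_apply]
  have : ∀ q', q' = q → g.inner q v w =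
      g.inner q' (ofCoord x q' (toCoord x q v)) (ofCoord x q' (toCoord x q w)) := by
    rintro _ rfl
    rw [ofCoord_toCoord hq, ofCoord_toCoord hq]
  exact this _ ((chart m x).left_inv hq)

/-- Constant coordinates in the trivialization at `x` make `ofCoord x · a` a smooth section, to
which the smooth bundle metric can be applied. -/
theorem contMDiffOn_inner_ofCoord (g : RiemMetric m M) (x : M) (a b : Euc m) :
    ContMDiffOn (𝓡 m) 𝓘(ℝ, ℝ) ∞ (fun q => g.inner q (ofCoord x q a) (ofCoord x q b))
      (chart m x).source := by
  intro q hq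
  have hsec : ∀ a : Euc m, ContMDiffAt (𝓡 m) ((𝓡 m).prod 𝓘(ℝ, Euc m)) ∞
      (fun q => TotalSpace.mk' (Euc m) (E := fun p : M => TangentSpace (𝓡 m) p) q
        (ofCoord x q a)) q := by
    intro a
    rw [(trivializationAt (Euc m) (fun p : M => TangentSpace (𝓡 m) p) x).contMDiffAt_section_iff hq]
    refine (contMDiffAt_const (c := a)).congr_of_eventuallyEq ?_
    filter_upwards [(chart m x).open_source.mem_nhds hq] with q' hq'
    exact (components_eq hq' (ofCoord x q' a)).trans (toCoord_ofCoord hq' a)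
  have : ContMDiffAt (𝓡 m) ((𝓡 m).prod 𝓘(ℝ)) ∞
      (fun q => TotalSpace.mk' ℝ (E := Bundle.Trivial M ℝ) q
        (g.inner q (ofCoord x q a) (ofCoord x q b))) q := by
    apply ContMDiffAt.clm_bundle_apply₂ (F₁ := Euc m) (F₂ := Euc m)
    · exact g.contMDiff q
    · exact hsec a
    · exact hsec b
  simp only [contMDiffAt_totalSpace] at this
  exact this.2.contMDiffWithinAt

theorem isInner_coordMetric (g : RiemMetric m M) {x : M} {z : Euc m}
    (hz : z ∈ (chart m x).target) : IsInner (coordMetric g x z) where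
  symm a b := by rw [coordMetric_apply, coordMetric_apply, g.symm]
  pos a ha := by
    rw [coordMetric_apply]
    refine g.pos _ _ fun h => ha ?_
    rw [← toCoord_ofCoord ((chart m x).map_target hz) a, h, map_zero]

theorem contDiffOn_coordMetric (g : RiemMetric m M) (x : M) :
    ContDiffOn ℝ ∞ (coordMetric g x) (chart m x).target := by
  rw [contDiffOn_clm_apply]
  intro a
  rw [contDiffOn_clm_apply]
  intro b
  have h := (contMDiffOn_inner_ofCoord g x a b).comp
    (contMDiffOn_chart_symm (I := 𝓡 m) (x := x) (n := ∞)) (fun z hz => (chart m x).map_target hz)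
  rw [← contMDiffOn_iff_contDiffOn]
  refine h.congr fun z hz => ?_
  rw [coordMetric_apply]
  rfl

theorem isMetricAt_coordMetric (g : RiemMetric m M) {x : M} {z : Euc m}
    (hz : z ∈ (chart m x).target) : IsMetricAt (coordMetric g x) z where
  inner := by
    filter_upwards [(chart m x).open_target.mem_nhds hz] with w hw using isInner_coordMetric g hw
  smooth := (contDiffOn_coordMetric g x).contDiffAt ((chart m x).open_target.mem_nhds hz)

theorem inner_ext (g : RiemMetric m M) {p : M} {v w : TangentSpace (𝓡 m) p}
    (h : ∀ u, g.inner p v u = g.inner p w u) : v = w := by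
  by_contra hvw
  have h1 := g.pos p (v - w) (sub_ne_zero.2 hvw)
  have h2 : g.inner p (v - w) (v - w) = g.inner p v (v - w) - g.inner p w (v - w) := by
    have h3 : g.inner p (v - w) = g.inner p v - g.inner p w := map_sub _ _ _
    rw [h3]; rfl
  rw [h2, h, sub_self] at h1
  exact lt_irrefl _ h1

theorem basisVec_eq (p : M) (i : Fin m) :
    basisVec p i = ofCoord p p (EuclideanSpace.single i (1 : ℝ)) :=
  ofComponents_eq p _

theorem sum_basisVec (p : M) (v : TangentSpace (𝓡 m) p) :
    v = ∑ k, (toCoord p p v) k • basisVec p k := by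
  have h : toCoord p p v = ∑ k, (toCoord p p v) k • EuclideanSpace.single k (1 : ℝ) := by
    ext i
    simp [Finset.sum_apply, Pi.single_apply]
  conv_lhs => rw [← ofCoord_toCoord (mem_chart_source _ p) v, h, map_sum]
  refine Finset.sum_congr rfl fun k _ => ?_
  rw [map_smul, basisVec_eq]

theorem linearIndependent_basisVec (p : M) {c : Fin m → ℝ}
    (h : ∑ k, c k • basisVec p k = (0 : TangentSpace (𝓡 m) p)) : c = 0 := by
  have h1 := congrArg (toCoord p p) h
  rw [map_sum, map_zero] at h1
  ext i
  have h2 := congrArg (fun v : Euc m => v i) h1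
  simp only [map_smul, basisVec_eq, toCoord_ofCoord (mem_chart_source _ p)] at h2
  simpa [Finset.sum_apply, Pi.single_apply] using h2

theorem inner_sum_left (g : RiemMetric m M) (p : M) (c : Fin m → ℝ) (b : Fin m → TangentSpace (𝓡 m) p)
    (w : TangentSpace (𝓡 m) p) : g.inner p (∑ i, c i • b i) w = ∑ i, c i * g.inner p (b i) w := by
  rw [map_sum]
  simp [map_smul]

theorem inner_sum_right (g : RiemMetric m M) (p : M) (c : Fin m → ℝ)
    (b : Fin m → TangentSpace (𝓡 m) p) (w : TangentSpace (𝓡 m) p) :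
    g.inner p w (∑ i, c i • b i) = ∑ i, c i * g.inner p w (b i) := by
  rw [map_sum]
  simp [map_smul]

/-- A kernel vector of the Gram matrix would give a nonzero tangent vector orthogonal to the whole
basis, hence to itself. -/
theorem isUnit_det_gram (g : RiemMetric m M) (p : M) : IsUnit (gram g p (basisVec p)).det := by
  rw [isUnit_iff_ne_zero]
  intro h
  obtain ⟨c, hc, hc0⟩ := Matrix.exists_mulVec_eq_zero_iff.2 h
  apply hc
  apply linearIndependent_basisVec p
  by_contra hv
  have h1 := g.pos p _ hv
  rw [inner_sum_left] at h1
  have h2 : ∀ i, g.inner p (basisVec p i) (∑ k, c k • basisVec p k) = 0 := by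
    intro i
    rw [inner_sum_right]
    have h3 := congrFun hc0 i
    simpa [Matrix.mulVec, dotProduct, gram, mul_comm] using h3
  simp [h2] at h1

theorem inner_sharp (g : RiemMetric m M) (p : M) (α : TangentSpace (𝓡 m) p →L[ℝ] ℝ)
    (w : TangentSpace (𝓡 m) p) : g.inner p (sharp g p α) w = α w := by
  set A := gram g p (basisVec p) with hA
  have h1 : ∀ k, g.inner p (sharp g p α) (basisVec p k) = α (basisVec p k) := by
    intro k
    have h2 : g.inner p (sharp g p α) (basisVec p k) =
        ∑ i, (∑ j, A⁻¹ i j * A j k) * α (basisVec p i) := by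
      unfold sharp
      rw [map_sum]
      simp only [map_sum, map_smul, _root_.sum_apply, _root_.smul_apply, smul_eq_mul]
      refine Finset.sum_congr rfl fun i _ => ?_
      rw [Finset.sum_mul]
      refine Finset.sum_congr rfl fun j _ => ?_
      simp only [hA, gram, Matrix.of_apply]
      ring
    have h3 : ∀ i, ∑ j, A⁻¹ i j * A j k = (1 : Matrix (Fin m) (Fin m) ℝ) i k := by
      intro i
      rw [← Matrix.nonsing_inv_mul A (isUnit_det_gram g p), Matrix.mul_apply]
    rw [h2]
    simp [h3, Matrix.one_apply]
  conv_lhs => rw [sum_basisVec p w]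
  conv_rhs => rw [sum_basisVec p w]
  rw [inner_sum_right, map_sum]
  simp [h1]

end CoordMetric

/-! ### Christoffel symbols under change of chart. -/

section Connection

variable {m : ℕ} {M : Type*} [TopologicalSpace M]
  [ChartedSpace (EuclideanSpace ℝ (Fin m)) M] [IsManifold (𝓡 m) ∞ M]

theorem fderiv_clm_apply₂ {E F : Type*} [NormedAddCommGroup E] [NormedSpace ℝ E]
    [NormedAddCommGroup F] [NormedSpace ℝ F] {G : E → F →L[ℝ] F →L[ℝ] ℝ} {z : E}
    (hG : DifferentiableAt ℝ G z) (a b : F) (u : E) :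
    fderiv ℝ (fun w => G w a b) z u = fderiv ℝ G z u a b := by
  rw [((hG.hasFDerivAt.clm_apply (hasFDerivAt_const a z)).clm_apply (hasFDerivAt_const b z)).fderiv]
  simp

theorem dMetric_eq (g : RiemMetric m M) (p : M) (u v w : TangentSpace (𝓡 m) p) :
    dMetric g p u v w = fderiv ℝ (coordMetric g p) (chart m p p)
      (toCoord p p u) (toCoord p p v) (toCoord p p w) := by
  have hp := mem_chart_source (Euc m) p
  have hG := isMetricAt_coordMetric g ((chart m p).map_source hp)
  have hev : (fun q => g.inner q (coordField v q) (coordField w q)) ∘ (chart m p).symm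
      =ᶠ[𝓝 (chart m p p)] fun z => coordMetric g p z (toCoord p p v) (toCoord p p w) := by
    filter_upwards [(chart m p).open_target.mem_nhds ((chart m p).map_source hp)] with z hz
    have hz' := (chart m p).map_target hz
    rw [Function.comp_apply, coordField_eq hz', coordField_eq hz', coordMetric_apply]
  unfold dMetric
  rw [mvfderiv_eq_fderiv hp, hev.fderiv_eq, fderiv_clm_apply₂ hG.differentiableAt]
  refine DifferentiableAt.congr_of_eventuallyEq ?_ hev
  exact (hG.differentiableAt.clm_apply (differentiableAt_const _)).clm_apply (differentiableAt_const _)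

theorem toCoord_christoffel (g : RiemMetric m M) (p : M) (v w : TangentSpace (𝓡 m) p) :
    toCoord p p (christoffel g p v w) =
      christ (coordMetric g p) (chart m p p) (toCoord p p v) (toCoord p p w) := by
  have hp := mem_chart_source (Euc m) p
  have hG := isMetricAt_coordMetric g ((chart m p).map_source hp)
  have h1 : christoffel g p v w = sharp g p
      (koszul (coordMetric g p) (chart m p p) (toCoord p p v) (toCoord p p w) ∘L toCoord p p) := by
    unfold christoffel
    congr 1
    ext z
    simp only [ContinuousLinearMap.comp_apply, koszul_apply, dMetric_eq]
  refine hG.isInner.ext fun c => ?_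
  rw [christ_spec hG.isInner]
  conv_lhs => rw [← toCoord_ofCoord hp c]
  rw [← inner_eq_coordMetric g hp, h1, inner_sharp, ContinuousLinearMap.comp_apply,
    toCoord_ofCoord hp]

theorem coordMetric_transition (g : RiemMetric m M) {x y q : M} (hx : q ∈ (chart m x).source)
    (hy : q ∈ (chart m y).source) (a b : Euc m) :
    coordMetric g x (chart m x q) a b = coordMetric g y (chart m y q)
      (fderiv ℝ (chart m y ∘ (chart m x).symm) (chart m x q) a)
      (fderiv ℝ (chart m y ∘ (chart m x).symm) (chart m x q) b) := by
  rw [← toCoord_ofCoord' hx hy, ← toCoord_ofCoord' hx hy, ← inner_eq_coordMetric g hy,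
    inner_eq_coordMetric g hx, toCoord_ofCoord hx, toCoord_ofCoord hx]

/-- Points near a point of two charts, in coordinates. -/
theorem eventually_mem_source {x y q : M} (hx : q ∈ (chart m x).source)
    (hy : q ∈ (chart m y).source) :
    ∀ᶠ z in 𝓝 (chart m x q), z ∈ (chart m x).target ∧ (chart m x).symm z ∈ (chart m x).source ∧
      (chart m x).symm z ∈ (chart m y).source ∧ chart m x ((chart m x).symm z) = z := by
  filter_upwards [(chart m x).open_target.mem_nhds ((chart m x).map_source hx),
    eventually_chart_symm hx ((chart m y).open_source.mem_nhds hy)] with z hz hz'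
  exact ⟨hz, (chart m x).map_target hz, hz', (chart m x).right_inv hz⟩

/-- A transition map is an isometry of the two coordinate metrics, so `christ_pullback` applies. Its
differential is onto, so here the tangential component is the whole vector. -/
theorem christ_transition (g : RiemMetric m M) {x y q : M} (hx : q ∈ (chart m x).source)
    (hy : q ∈ (chart m y).source) (a b : Euc m) :
    fderiv ℝ (fderiv ℝ (chart m y ∘ (chart m x).symm)) (chart m x q) a b +
      christ (coordMetric g y) (chart m y q)
        (fderiv ℝ (chart m y ∘ (chart m x).symm) (chart m x q) a)
        (fderiv ℝ (chart m y ∘ (chart m x).symm) (chart m x q) b) =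
    fderiv ℝ (chart m y ∘ (chart m x).symm) (chart m x q)
      (christ (coordMetric g x) (chart m x q) a b) := by
  have hpt : (chart m y ∘ (chart m x).symm) (chart m x q) = chart m y q := by
    simp [(chart m x).left_inv hx]
  have hG := isMetricAt_coordMetric g ((chart m x).map_source hx)
  have hH := isMetricAt_coordMetric g ((chart m y).map_source hy)
  have key := christ_pullback hG (H := coordMetric g y) (f := chart m y ∘ (chart m x).symm)
    (by rwa [hpt]) (contDiffAt_transition hx hy) (by
      filter_upwards [eventually_mem_source hx hy] with z ⟨_, h1, h2, h3⟩ a b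
      have := coordMetric_transition g h1 h2 a b
      rw [h3] at this
      exact this) a b
  rw [hpt] at key
  refine hH.isInner.ext fun c => ?_
  have hc : c = fderiv ℝ (chart m y ∘ (chart m x).symm) (chart m x q) (toCoord x q (ofCoord y q c)) := by
    rw [← toCoord_ofCoord' hx hy, ofCoord_toCoord hx, toCoord_ofCoord hy]
  rw [hc, key, ← coordMetric_transition g hx hy]

end Connection

/-! ### The pull-back connection in arbitrary charts. -/

section Along

variable {m n : ℕ} {M N : Type*}
  [TopologicalSpace M] [ChartedSpace (EuclideanSpace ℝ (Fin m)) M] [IsManifold (𝓡 m) ∞ M]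
  [TopologicalSpace N] [ChartedSpace (EuclideanSpace ℝ (Fin n)) N] [IsManifold (𝓡 n) ∞ N]

/-- A vector field along a map, read in the preferred charts at `x` and `y`. -/
def alongCoord (φ : M → N) (x : M) (y : N) (W : Π q : M, TangentSpace (𝓡 n) (φ q)) (z : Euc m) :
    Euc n :=
  toCoord y (φ ((chart m x).symm z)) (W ((chart m x).symm z))

theorem alongCoord_chart (φ : M → N) {x p : M} (y : N) (hx : p ∈ (chart m x).source)
    (W : Π q : M, TangentSpace (𝓡 n) (φ q)) :
    alongCoord φ x y W (chart m x p) = toCoord y (φ p) (W p) := by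
  have : ∀ p', p' = p → toCoord y (φ p') (W p') = toCoord y (φ p) (W p) := by rintro _ rfl; rfl
  exact this _ ((chart m x).left_inv hx)

theorem eventually_map_mem_source {φ : M → N} (hφ : Continuous φ) {x p : M} {y : N}
    (hx : p ∈ (chart m x).source) (hy : φ p ∈ (chart n y).source) :
    ∀ᶠ z in 𝓝 (chart m x p), φ ((chart m x).symm z) ∈ (chart n y).source :=
  eventually_chart_symm hx (hφ.continuousAt.eventually ((chart n y).open_source.mem_nhds hy))

/-- The connection on the pull-back bundle in arbitrary charts. -/
theorem toCoord_nablaAlong (h : RiemMetric n N) {φ : M → N} (hφ : ContMDiff (𝓡 m) (𝓡 n) ∞ φ)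
    {x p : M} {y : N} (hx : p ∈ (chart m x).source) (hy : φ p ∈ (chart n y).source)
    {W : Π q : M, TangentSpace (𝓡 n) (φ q)}
    (hW : DifferentiableAt ℝ (alongCoord φ x y W) (chart m x p)) (v : TangentSpace (𝓡 m) p) :
    toCoord y (φ p) (nablaAlong h φ W p v) =
      fderiv ℝ (alongCoord φ x y W) (chart m x p) (toCoord x p v) +
        christ (coordMetric h y) (chart n y (φ p))
          (fderiv ℝ (inCharts φ x y) (chart m x p) (toCoord x p v)) (toCoord y (φ p) (W p)) := by
  have hy0 := mem_chart_source (Euc n) (φ p)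
  set f : Euc n → Euc n := chart n (φ p) ∘ (chart n y).symm with hf
  have hfs : ContDiffAt ℝ ∞ f (chart n y (φ p)) := contDiffAt_transition hy hy0
  have hf2 : HasFDerivAt (fderiv ℝ f) (fderiv ℝ (fderiv ℝ f) (chart n y (φ p)))
      (inCharts φ x y (chart m x p)) := by
    have : inCharts φ x y (chart m x p) = chart n y (φ p) := by
      simp [inCharts, (chart m x).left_inv hx]
    rw [this]
    exact ((hfs.fderiv_right (m := ∞) (by simp)).differentiableAt (by simp)).hasFDerivAt
  have hin : HasFDerivAt (inCharts φ x y) (fderiv ℝ (inCharts φ x y) (chart m x p)) (chart m x p) :=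
    ((contDiffAt_inCharts hφ hx hy).differentiableAt (by simp)).hasFDerivAt
  have hcomp := (hf2.comp _ hin).clm_apply hW.hasFDerivAt
  have hev : (fun q => components (φ p) (φ q) (W q)) ∘ (chart m x).symm =ᶠ[𝓝 (chart m x p)]
      fun z => ((fderiv ℝ f) ∘ inCharts φ x y) z (alongCoord φ x y W z) := by
    filter_upwards [eventually_map_mem_source hφ.continuous hx hy0,
      eventually_map_mem_source hφ.continuous hx hy] with z hz0 hz
    simp only [Function.comp_apply, alongCoord, inCharts]
    rw [components_eq hz0, ← toCoord_ofCoord' hz hz0, ofCoord_toCoord hz]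
  have hd := hcomp.congr_of_eventuallyEq hev
  have hpt : inCharts φ x y (chart m x p) = chart n y (φ p) := by
    simp [inCharts, (chart m x).left_inv hx]
  have htr : ∀ w : TangentSpace (𝓡 n) (φ p), toCoord (φ p) (φ p) w =
      fderiv ℝ f (chart n y (φ p)) (toCoord y (φ p) w) := by
    intro w
    rw [← toCoord_ofCoord' hy hy0, ofCoord_toCoord hy]
  -- Differentiating the components after the change of chart `f` produces a second derivative of
  -- `f`; it is exactly the inhomogeneous term of `christ_transition`.
  have key : toCoord (φ p) (φ p) (nablaAlong h φ W p v) = fderiv ℝ f (chart n y (φ p))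
      (fderiv ℝ (alongCoord φ x y W) (chart m x p) (toCoord x p v) +
        christ (coordMetric h y) (chart n y (φ p))
          (fderiv ℝ (inCharts φ x y) (chart m x p) (toCoord x p v)) (toCoord y (φ p) (W p))) := by
    unfold nablaAlong
    rw [ofComponents_eq, map_add, toCoord_ofCoord hy0, toCoord_christoffel,
      mvfderiv_eq_fderiv hx hd.differentiableAt, hd.fderiv, map_add,
      ← christ_transition h hy hy0, htr, htr, toCoord_mfderiv hφ hx hy]
    simp only [add_apply, ContinuousLinearMap.comp_apply, ContinuousLinearMap.flip_apply,
      Function.comp_apply, hpt, alongCoord_chart φ y hx]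
    abel
  rw [← toCoord_ofCoord hy (fderiv ℝ (alongCoord φ x y W) (chart m x p) (toCoord x p v) +
    christ _ _ _ _), ← ofCoord_toCoord hy0 (nablaAlong h φ W p v), key, ← toCoord_ofCoord' hy hy0,
    ofCoord_toCoord hy0]

end Along

/-! ### Levi-Civita connection, coordinate fields and curvature in a fixed chart. -/

section Fields

variable {m : ℕ} {M : Type*} [TopologicalSpace M]
  [ChartedSpace (EuclideanSpace ℝ (Fin m)) M] [IsManifold (𝓡 m) ∞ M]

/-- A vector field read in the preferred chart at `x`. -/
def fieldCoord (x : M) (Y : Π q : M, TangentSpace (𝓡 m) q) (z : Euc m) : Euc m :=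
  toCoord x ((chart m x).symm z) (Y ((chart m x).symm z))

theorem fieldCoord_chart {x p : M} (hx : p ∈ (chart m x).source)
    (Y : Π q : M, TangentSpace (𝓡 m) q) : fieldCoord x Y (chart m x p) = toCoord x p (Y p) :=
  alongCoord_chart (id : M → M) x hx Y

theorem eventually_target {x p : M} (hx : p ∈ (chart m x).source) :
    ∀ᶠ z in 𝓝 (chart m x p), z ∈ (chart m x).target :=
  (chart m x).open_target.mem_nhds ((chart m x).map_source hx)

/-- The case of the identity map in `toCoord_nablaAlong`. -/
theorem toCoord_leviCivita (g : RiemMetric m M) {x p : M} (hx : p ∈ (chart m x).source)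
    {Y : Π q : M, TangentSpace (𝓡 m) q}
    (hY : DifferentiableAt ℝ (fieldCoord x Y) (chart m x p)) (v : TangentSpace (𝓡 m) p) :
    toCoord x p (leviCivita g Y p v) =
      fderiv ℝ (fieldCoord x Y) (chart m x p) (toCoord x p v) +
        christ (coordMetric g x) (chart m x p) (toCoord x p v) (toCoord x p (Y p)) := by
  have h1 := toCoord_nablaAlong (φ := (id : M → M)) g contMDiff_id hx (y := x) hx (W := Y) hY v
  have h2 : nablaAlong g (id : M → M) Y p v = leviCivita g Y p v := by
    unfold nablaAlong
    rw [mfderiv_id]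
    rfl
  have h3 : inCharts (id : M → M) x x =ᶠ[𝓝 (chart m x p)] id := by
    filter_upwards [eventually_target hx] with z hz
    simp [inCharts, (chart m x).right_inv hz]
  rw [h2, h3.fderiv_eq, fderiv_id] at h1
  exact h1

theorem fieldCoord_coordField {x p : M} (hx : p ∈ (chart m x).source) (v : TangentSpace (𝓡 m) p) :
    fieldCoord x (coordField v) =ᶠ[𝓝 (chart m x p)] fun z =>
      fderiv ℝ (chart m x ∘ (chart m p).symm) ((chart m p ∘ (chart m x).symm) z)
        (toCoord p p v) := by
  filter_upwards [eventually_mem_source hx (mem_chart_source _ p)] with z ⟨_, h1, h2, _⟩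
  unfold fieldCoord
  rw [coordField_eq h2, toCoord_ofCoord' h2 h1]
  rfl

theorem contDiffAt_coordField {x p : M} (hx : p ∈ (chart m x).source) (v : TangentSpace (𝓡 m) p) :
    ContDiffAt ℝ ∞ (fieldCoord x (coordField v)) (chart m x p) := by
  have hp := mem_chart_source (Euc m) p
  refine ContDiffAt.congr_of_eventuallyEq ?_ (fieldCoord_coordField hx v)
  refine ContDiffAt.clm_apply ?_ contDiffAt_const
  refine ContDiffAt.comp (chart m x p) ?_ (contDiffAt_transition hx hp)
  have : (chart m p ∘ (chart m x).symm) (chart m x p) = chart m p p := by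
    simp [(chart m x).left_inv hx]
  rw [this]
  exact (contDiffAt_transition hp hx).fderiv_right (by simp)

/-- Read at `x`, a coordinate field of the chart at `p` is a first derivative of the transition map,
so its derivative is a symmetric second derivative. In this form the commutation of coordinate
fields enters the curvature. -/
theorem fderiv_coordField_symm {x p : M} (hx : p ∈ (chart m x).source)
    (u v : TangentSpace (𝓡 m) p) :
    fderiv ℝ (fieldCoord x (coordField v)) (chart m x p) (toCoord x p u) =
      fderiv ℝ (fieldCoord x (coordField u)) (chart m x p) (toCoord x p v) := by
  have hp := mem_chart_source (Euc m) p
  have hpt : (chart m p ∘ (chart m x).symm) (chart m x p) = chart m p p := by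
    simp [(chart m x).left_inv hx]
  have hF := contDiffAt_transition hp hx
  have hP : HasFDerivAt (chart m p ∘ (chart m x).symm) _ (chart m x p) :=
    ((contDiffAt_transition hx hp).differentiableAt (by simp)).hasFDerivAt
  have hF2 : HasFDerivAt (fderiv ℝ (chart m x ∘ (chart m p).symm))
      (fderiv ℝ (fderiv ℝ (chart m x ∘ (chart m p).symm)) (chart m p p))
      ((chart m p ∘ (chart m x).symm) (chart m x p)) := by
    rw [hpt]
    exact ((hF.fderiv_right (m := ∞) (by simp)).differentiableAt (by simp)).hasFDerivAt
  have key : ∀ u v : TangentSpace (𝓡 m) p,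
      fderiv ℝ (fieldCoord x (coordField v)) (chart m x p) (toCoord x p u) =
      fderiv ℝ (fderiv ℝ (chart m x ∘ (chart m p).symm)) (chart m p p)
        (toCoord p p u) (toCoord p p v) := by
    intro u v
    rw [(fieldCoord_coordField hx v).fderiv_eq]
    refine (congrArg (fun L : Euc m →L[ℝ] Euc m => L (toCoord x p u))
      ((hF2.comp _ hP).clm_apply (hasFDerivAt_const (toCoord p p v) _)).fderiv).trans ?_
    have : fderiv ℝ (chart m p ∘ (chart m x).symm) (chart m x p) (toCoord x p u) =
        toCoord p p u := by
      rw [← toCoord_ofCoord' hx hp, ofCoord_toCoord hx]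
    simp [this]
  rw [key, key]
  exact (hF.isSymmSndFDerivAt (by
    simp only [minSmoothness_of_isRCLikeNormedField]; exact two_le_infty)).eq _ _

/-- Pulled back by the chart at `p`, both fields are constant. -/
theorem mlieBracket_coordField (p : M) (u v : TangentSpace (𝓡 m) p) :
    VectorField.mlieBracket (𝓡 m) (coordField u) (coordField v) p = 0 := by
  have hp := mem_chart_source (Euc m) p
  have key : ∀ v : TangentSpace (𝓡 m) p,
      VectorField.mpullbackWithin 𝓘(ℝ, Euc m) (𝓡 m) (extChartAt (𝓡 m) p).symm (coordField v)
        (range (𝓡 m)) =ᶠ[𝓝 (chart m p p)] fun _ => toCoord p p v := by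
    intro v
    filter_upwards [eventually_target hp] with z hz
    have hq := (chart m p).map_target hz
    have h1 := TangentBundle.symmL_trivializationAt (I := 𝓡 m) hq
    have h2 : extChartAt (𝓡 m) p ((chart m p).symm z) = z := by
      simp [(chart m p).right_inv hz]
    rw [h2] at h1
    rw [VectorField.mpullbackWithin_apply, ← h1]
    refine Eq.trans (b := (ofCoord p ((chart m p).symm z)).inverse
      (coordField v ((chart m p).symm z))) rfl ?_
    rw [coordField_eq hq, ContinuousLinearMap.inverse_eq (g := toCoord p ((chart m p).symm z)),
      toCoord_ofCoord hq]
    · ext1 w; exact ofCoord_toCoord hq w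
    · ext1 w; exact toCoord_ofCoord hq w
  rw [← VectorField.mlieBracketWithin_univ, VectorField.mlieBracketWithin_apply]
  have h0 : extChartAt (𝓡 m) p p = chart m p p := by simp
  have : VectorField.lieBracketWithin ℝ
      (VectorField.mpullbackWithin 𝓘(ℝ, Euc m) (𝓡 m) (extChartAt (𝓡 m) p).symm (coordField u)
        (range (𝓡 m)))
      (VectorField.mpullbackWithin 𝓘(ℝ, Euc m) (𝓡 m) (extChartAt (𝓡 m) p).symm (coordField v)
        (range (𝓡 m)))
      ((extChartAt (𝓡 m) p).symm ⁻¹' univ ∩ range (𝓡 m)) (extChartAt (𝓡 m) p p) = 0 := by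
    rw [h0]
    refine (Filter.EventuallyEq.lieBracketWithin_vectorField_eq_nhds (key u) (key v)).trans ?_
    simp [VectorField.lieBracketWithin]
  rw [this]
  exact map_zero _

/-- The curvature tensor of a metric on a vector space. -/
def flatCurv {E : Type*} [NormedAddCommGroup E] [NormedSpace ℝ E]
    (G : E → E →L[ℝ] E →L[ℝ] ℝ) (z u v w : E) : E :=
  fderiv ℝ (christ G) z u v w - fderiv ℝ (christ G) z v u w
    + christ G z u (christ G z v w) - christ G z v (christ G z u w)

/-- In the expansion of ∇_u ∇_v w, all terms containing derivatives of the three extending fields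
are, taken together, symmetric in `u` and `v`. Antisymmetrizing leaves an expression in the
Christoffel symbols alone. -/
theorem toCoord_curvature (g : RiemMetric m M) {x p : M} (hx : p ∈ (chart m x).source)
    (u v w : TangentSpace (𝓡 m) p) :
    toCoord x p (curvature g p u v w) = flatCurv (coordMetric g x) (chart m x p)
      (toCoord x p u) (toCoord x p v) (toCoord x p w) := by
  set G := coordMetric g x with hG
  set z₀ := chart m x p with hz₀
  have hmet : IsMetricAt G z₀ := isMetricAt_coordMetric g ((chart m x).map_source hx)
  have hΓ : HasFDerivAt (christ G) (fderiv ℝ (christ G) z₀) z₀ :=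
    ((contDiffAt_christ hmet.isInner hmet.smooth).differentiableAt (by simp)).hasFDerivAt
  set W := fieldCoord x (coordField w) with hW
  have hWs : ContDiffAt ℝ ∞ W z₀ := contDiffAt_coordField hx w
  have hWd : HasFDerivAt W (fderiv ℝ W z₀) z₀ := (hWs.differentiableAt (by simp)).hasFDerivAt
  have hW2 : HasFDerivAt (fderiv ℝ W) (fderiv ℝ (fderiv ℝ W) z₀) z₀ :=
    ((hWs.fderiv_right (m := ∞) (by simp)).differentiableAt (by simp)).hasFDerivAt
  -- The inner covariant derivative is differentiated again, so its coordinate formula must hold at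
  -- all nearby points.
  have hWev : ∀ᶠ z in 𝓝 z₀, DifferentiableAt ℝ W z := by
    have h1 : ContDiffAt ℝ 1 W z₀ := hWs.of_le (by
      exact le_trans (by norm_num) two_le_infty)
    filter_upwards [h1.eventually (by simp)] with z hz using hz.differentiableAt (by simp)
  have hself : ∀ v : TangentSpace (𝓡 m) p, fieldCoord x (coordField v) z₀ = toCoord x p v := by
    intro v
    rw [hz₀, fieldCoord_chart hx, coordField, FiberBundle.extend_apply_self]
  have hW0 : W z₀ = toCoord x p w := hself w
  have step : ∀ v : TangentSpace (𝓡 m) p,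
      HasFDerivAt (fieldCoord x fun q => leviCivita g (coordField w) q (coordField v q))
        ((fderiv ℝ (fderiv ℝ W) z₀).flip (toCoord x p v) +
          fderiv ℝ W z₀ ∘L fderiv ℝ (fieldCoord x (coordField v)) z₀ +
          ((fderiv ℝ (christ G) z₀).flip (toCoord x p v)).flip (toCoord x p w) +
          (christ G z₀).flip (toCoord x p w) ∘L fderiv ℝ (fieldCoord x (coordField v)) z₀ +
          christ G z₀ (toCoord x p v) ∘L fderiv ℝ W z₀) z₀ ∧
      toCoord x p (leviCivita g (coordField w) p v) =
        fderiv ℝ W z₀ (toCoord x p v) + christ G z₀ (toCoord x p v) (toCoord x p w) := by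
    intro v
    constructor
    · have hV : HasFDerivAt (fieldCoord x (coordField v)) _ z₀ :=
        ((contDiffAt_coordField hx v).differentiableAt (by simp)).hasFDerivAt
      have h1 := (hW2.clm_apply hV).add ((hΓ.clm_apply hV).clm_apply hWd)
      refine HasFDerivAt.congr_of_eventuallyEq (h1.congr_fderiv ?_) ?_
      · ext1 a
        simp only [hself, hW0, add_apply, ContinuousLinearMap.comp_apply,
          ContinuousLinearMap.flip_apply]
        abel
      · filter_upwards [eventually_mem_source hx hx, hWev] with z ⟨hz, h1, _, h3⟩ hd
        rw [← h3] at hd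
        have h4 := toCoord_leviCivita g h1 hd (coordField v ((chart m x).symm z))
        rw [h3] at h4
        exact h4
    · have h4 := toCoord_leviCivita g hx (Y := coordField w) hWd.differentiableAt v
      rw [h4]
      simp only [coordField, FiberBundle.extend_apply_self]
      rfl
  have key : ∀ u v : TangentSpace (𝓡 m) p,
      toCoord x p (leviCivita g (fun q => leviCivita g (coordField w) q (coordField v q)) p u) =
      fderiv ℝ (fderiv ℝ W) z₀ (toCoord x p u) (toCoord x p v) +
        fderiv ℝ W z₀ (fderiv ℝ (fieldCoord x (coordField v)) z₀ (toCoord x p u)) +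
        fderiv ℝ (christ G) z₀ (toCoord x p u) (toCoord x p v) (toCoord x p w) +
        christ G z₀ (fderiv ℝ (fieldCoord x (coordField v)) z₀ (toCoord x p u)) (toCoord x p w) +
        christ G z₀ (toCoord x p v) (fderiv ℝ W z₀ (toCoord x p u)) +
        christ G z₀ (toCoord x p u)
          (fderiv ℝ W z₀ (toCoord x p v) + christ G z₀ (toCoord x p v) (toCoord x p w)) := by
    intro u v
    rw [toCoord_leviCivita g hx (step v).1.differentiableAt, (step v).1.fderiv,
      show coordField v p = v from FiberBundle.extend_apply_self _ v, (step v).2]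
    simp only [add_apply, ContinuousLinearMap.comp_apply, ContinuousLinearMap.flip_apply]
    rfl
  have hbr : toCoord x p (leviCivita g (coordField w) p
      (VectorField.mlieBracket (𝓡 m) (coordField u) (coordField v) p)) = 0 := by
    rw [mlieBracket_coordField, toCoord_leviCivita g hx hWd.differentiableAt]
    simp
  unfold curvature flatCurv
  rw [map_sub, map_sub, hbr, key, key, fderiv_coordField_symm hx u v, map_add, map_add,
    (hWs.isSymmSndFDerivAt (by
      simp only [minSmoothness_of_isRCLikeNormedField]; exact two_le_infty)).eq
      (toCoord x p u) (toCoord x p v)]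
  abel

end Fields

/-! ### Metric traces and covariant derivatives of tensor fields. -/

section Tensors

variable {m : ℕ} {M : Type*} [TopologicalSpace M]
  [ChartedSpace (EuclideanSpace ℝ (Fin m)) M] [IsManifold (𝓡 m) ∞ M]

/-- Bilinearity of a map of two variables. -/
structure IsBilin {U V : Type*} [AddCommGroup U] [Module ℝ U] [AddCommGroup V] [Module ℝ V]
    (b : U → U → V) : Prop where
  add_left : ∀ u u' v, b (u + u') v = b u v + b u' v
  smul_left : ∀ (r : ℝ) u v, b (r • u) v = r • b u v
  add_right : ∀ u v v', b u (v + v') = b u v + b u v'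
  smul_right : ∀ (r : ℝ) u v, b u (r • v) = r • b u v

theorem IsBilin.sum_sum {U V : Type*} [AddCommGroup U] [Module ℝ U] [AddCommGroup V] [Module ℝ V]
    {b : U → U → V} (hb : IsBilin b) {ι : Type*} (s : Finset ι) (c d : ι → ℝ) (e f : ι → U) :
    b (∑ i ∈ s, c i • e i) (∑ j ∈ s, d j • f j) = ∑ i ∈ s, ∑ j ∈ s, (c i * d j) • b (e i) (f j) := by
  let L : U →ₗ[ℝ] U →ₗ[ℝ] V := LinearMap.mk₂ ℝ b hb.add_left hb.smul_left hb.add_right hb.smul_right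
  have h : ∀ u v, b u v = L u v := fun u v => rfl
  simp only [h, map_sum, LinearMap.sum_apply, map_smul, LinearMap.smul_apply, Finset.smul_sum,
    smul_smul]
  rw [Finset.sum_comm]
  refine Finset.sum_congr rfl fun i _ => Finset.sum_congr rfl fun j _ => ?_
  rw [mul_comm]

/-- The metric trace in an orthonormal basis. -/
theorem trace_eq_sum (g : RiemMetric m M) (p : M) {V : Type*} [AddCommGroup V] [Module ℝ V]
    {b : TangentSpace (𝓡 m) p → TangentSpace (𝓡 m) p → V} (hb : IsBilin b)
    (e : Fin m → TangentSpace (𝓡 m) p)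
    (he : ∀ i j, g.inner p (e i) (e j) = if i = j then 1 else 0) :
    trace g p b = ∑ k, b (e k) (e k) := by
  set A := gram g p (basisVec p) with hA
  let Q : Matrix (Fin m) (Fin m) ℝ := Matrix.of fun k i => toCoord p p (e k) i
  have hQ : ∀ k, e k = ∑ i, Q k i • basisVec p i := fun k => sum_basisVec p (e k)
  -- This is orthonormality of the basis whose coordinates are the rows of `Q`. It forces A⁻¹ = Qᵀ
  -- Q, which turns the weights gⁱʲ into a diagonal sum.
  have h1 : Q * (A * Q.transpose) = 1 := by
    ext k l
    have h2 := he k l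
    rw [hQ k, hQ l, inner_sum_left] at h2
    simp only [inner_sum_right] at h2
    rw [Matrix.one_apply, ← h2]
    simp only [Matrix.mul_apply, Matrix.transpose_apply, hA, gram, Matrix.of_apply]
    refine Finset.sum_congr rfl fun i _ => ?_
    congr 1
    exact Finset.sum_congr rfl fun j _ => mul_comm _ _
  have h2 : A⁻¹ = Q.transpose * Q := by
    refine Matrix.inv_eq_right_inv ?_
    rw [← Matrix.mul_assoc]
    exact mul_eq_one_comm.1 h1
  unfold trace
  rw [← hA, h2]
  have h3 : ∀ k, b (e k) (e k) = ∑ i, ∑ j, (Q k i * Q k j) • b (basisVec p i) (basisVec p j) := by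
    intro k
    conv_lhs => rw [hQ k]
    exact hb.sum_sum _ _ _ _ _
  simp only [h3, Matrix.mul_apply, Matrix.transpose_apply, Finset.sum_smul]
  rw [Finset.sum_comm' (s := Finset.univ) (t := fun _ => Finset.univ) (t' := Finset.univ)
    (s' := fun _ => Finset.univ) (by simp)]
  conv_lhs =>
    enter [2, j]
    rw [Finset.sum_comm]
  rw [Finset.sum_comm]
  refine Finset.sum_congr rfl fun k _ => ?_
  rw [Finset.sum_comm]

/-- A tensor field of type `(1,1)` read in the preferred chart at `x`. -/
def tensorCoord (x : M) (T : Π q : M, TangentSpace (𝓡 m) q → TangentSpace (𝓡 m) q) (z : Euc m) :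
    Euc m →L[ℝ] Euc m :=
  ∑ i, (EuclideanSpace.proj i : Euc m →L[ℝ] ℝ).smulRight
    (toCoord x ((chart m x).symm z) (T ((chart m x).symm z)
      (ofCoord x ((chart m x).symm z) (EuclideanSpace.single i (1 : ℝ)))))

/-- A smooth tensor field of type `(1,1)`. -/
structure IsSmoothTensor (T : Π q : M, TangentSpace (𝓡 m) q → TangentSpace (𝓡 m) q) : Prop where
  linear : ∀ q, IsLinearMap ℝ (T q)
  smooth : ∀ x, ContDiffOn ℝ ∞ (tensorCoord x T) (chart m x).target

variable {T : Π q : M, TangentSpace (𝓡 m) q → TangentSpace (𝓡 m) q}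

theorem tensorCoord_apply (hT : ∀ q, IsLinearMap ℝ (T q)) (x : M) (z a : Euc m) :
    tensorCoord x T z a = toCoord x ((chart m x).symm z)
      (T ((chart m x).symm z) (ofCoord x ((chart m x).symm z) a)) := by
  set q := (chart m x).symm z with hq
  let L : TangentSpace (𝓡 m) q →ₗ[ℝ] TangentSpace (𝓡 m) q := (hT q).mk' (T q)
  have hL : ∀ v, T q v = L v := fun v => rfl
  have h : a = ∑ k, a k • EuclideanSpace.single k (1 : ℝ) := by
    ext i
    simp [Finset.sum_apply, Pi.single_apply]
  conv_rhs => rw [h]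
  simp only [tensorCoord, hL, map_sum, map_smul, _root_.sum_apply,
    ContinuousLinearMap.smulRight_apply, PiLp.proj_apply]
  rfl

theorem tensorCoord_toCoord (hT : ∀ q, IsLinearMap ℝ (T q)) {x p : M}
    (hx : p ∈ (chart m x).source) (v : TangentSpace (𝓡 m) p) :
    toCoord x p (T p v) = tensorCoord x T (chart m x p) (toCoord x p v) := by
  rw [tensorCoord_apply hT]
  have : ∀ p', p' = p → toCoord x p (T p v) =
      toCoord x p' (T p' (ofCoord x p' (toCoord x p v))) := by
    rintro _ rfl
    rw [ofCoord_toCoord hx]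
  exact this _ ((chart m x).left_inv hx)

/-- The covariant derivative of a `(1,1)`-tensor field on a vector space. -/
def flatNabla {E : Type*} [NormedAddCommGroup E] [NormedSpace ℝ E]
    (G : E → E →L[ℝ] E →L[ℝ] ℝ) (T : E → E →L[ℝ] E) (z u v : E) : E :=
  fderiv ℝ T z u v + christ G z u (T z v) - T z (christ G z u v)

/-- The derivative of the field extending `v` appears in both terms of `nablaTensor` and cancels, so
what remains is tensorial. -/
theorem toCoord_nablaTensor (g : RiemMetric m M) (hT : IsSmoothTensor T) {x p : M}
    (hx : p ∈ (chart m x).source) (u v : TangentSpace (𝓡 m) p) :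
    toCoord x p (nablaTensor g T p u v) = flatNabla (coordMetric g x) (tensorCoord x T)
      (chart m x p) (toCoord x p u) (toCoord x p v) := by
  have hTd : HasFDerivAt (tensorCoord x T) (fderiv ℝ (tensorCoord x T) (chart m x p))
      (chart m x p) :=
    (((hT.smooth x).contDiffAt (eventually_target hx)).differentiableAt (by simp)).hasFDerivAt
  have hV : HasFDerivAt (fieldCoord x (coordField v)) _ (chart m x p) :=
    ((contDiffAt_coordField hx v).differentiableAt (by simp)).hasFDerivAt
  have hev : fieldCoord x (fun q => T q (coordField v q)) =ᶠ[𝓝 (chart m x p)]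
      fun z => tensorCoord x T z (fieldCoord x (coordField v) z) := by
    filter_upwards [eventually_mem_source hx hx] with z ⟨_, h1, _, h3⟩
    unfold fieldCoord
    rw [tensorCoord_toCoord hT.linear h1, h3]
  have h1 := (hTd.clm_apply hV).congr_of_eventuallyEq hev
  have hself : coordField v p = v := FiberBundle.extend_apply_self _ v
  unfold nablaTensor flatNabla
  rw [map_sub, toCoord_leviCivita g hx h1.differentiableAt, h1.fderiv,
    tensorCoord_toCoord hT.linear hx (leviCivita _ _ _ _),
    toCoord_leviCivita g hx hV.differentiableAt,
    tensorCoord_toCoord hT.linear hx, fieldCoord_chart hx, hself, map_add]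
  simp only [add_apply, ContinuousLinearMap.comp_apply, ContinuousLinearMap.flip_apply]
  abel

theorem toCoord_injective {x p : M} (hx : p ∈ (chart m x).source) :
    Function.Injective (toCoord x p : TangentSpace (𝓡 m) p → Euc m) :=
  Function.LeftInverse.injective (g := ofCoord x p) fun v => ofCoord_toCoord hx v

theorem isBilin_nablaTensor (g : RiemMetric m M) (hT : IsSmoothTensor T) (p : M) :
    IsBilin (nablaTensor g T p) := by
  have hp := mem_chart_source (Euc m) p
  constructor <;> intros <;> refine toCoord_injective hp ?_ <;>
  simp only [toCoord_nablaTensor g hT hp, map_add, map_smul, flatNabla, add_apply, smul_apply,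
    smul_add, smul_sub] <;> abel

end Tensors

/-! ### Orthonormal frames and Cartan's structure equations on a surface. -/

section Frames

variable {E : Type*} [NormedAddCommGroup E] [NormedSpace ℝ E] [FiniteDimensional ℝ E]

/-- A smooth orthonormal frame of a surface, over an open subset of a coordinate plane. -/
structure IsFrame (G : E → E →L[ℝ] E →L[ℝ] ℝ) (U : Set E) (e₁ e₂ : E → E) : Prop where
  isOpen : IsOpen U
  metric : ∀ z ∈ U, IsMetricAt G z
  smooth₁ : ContDiffOn ℝ ∞ e₁ U
  smooth₂ : ContDiffOn ℝ ∞ e₂ U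
  norm₁ : ∀ z ∈ U, G z (e₁ z) (e₁ z) = 1
  norm₂ : ∀ z ∈ U, G z (e₂ z) (e₂ z) = 1
  orth : ∀ z ∈ U, G z (e₁ z) (e₂ z) = 0
  span : ∀ z ∈ U, ∀ v, v = G z v (e₁ z) • e₁ z + G z v (e₂ z) • e₂ z

theorem hasFDerivAt_metric {G : E → E →L[ℝ] E →L[ℝ] ℝ} {z : E} (hG : IsMetricAt G z)
    {X Y : E → E} (hX : DifferentiableAt ℝ X z) (hY : DifferentiableAt ℝ Y z) :
    ∃ L : E →L[ℝ] ℝ, HasFDerivAt (fun w => G w (X w) (Y w)) L z ∧ ∀ v, L v =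
      G z (fderiv ℝ X z v + christ G z v (X z)) (Y z) +
      G z (X z) (fderiv ℝ Y z v + christ G z v (Y z)) := by
  refine ⟨_, (hG.differentiableAt.hasFDerivAt.clm_apply hX.hasFDerivAt).clm_apply hY.hasFDerivAt,
    fun v => ?_⟩
  simp only [add_apply, ContinuousLinearMap.comp_apply, ContinuousLinearMap.flip_apply, map_add,
    hG.compat]
  ring

/-- The connection form `⟨∇e₁, e₂⟩` of a frame. -/
def connForm (G : E → E →L[ℝ] E →L[ℝ] ℝ) (e₁ e₂ : E → E) (z : E) : E →L[ℝ] ℝ :=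
  (G z).flip (e₂ z) ∘L (fderiv ℝ e₁ z + (christ G z).flip (e₁ z))

variable {G : E → E →L[ℝ] E →L[ℝ] ℝ} {U : Set E} {e₁ e₂ : E → E} {z : E}

namespace IsFrame

theorem mem_nhds (F : IsFrame G U e₁ e₂) (hz : z ∈ U) : U ∈ 𝓝 z := F.isOpen.mem_nhds hz

theorem hasFDerivAt₁ (F : IsFrame G U e₁ e₂) (hz : z ∈ U) : HasFDerivAt e₁ (fderiv ℝ e₁ z) z :=
  ((F.smooth₁.contDiffAt (F.mem_nhds hz)).differentiableAt (by simp)).hasFDerivAt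

theorem hasFDerivAt₂ (F : IsFrame G U e₁ e₂) (hz : z ∈ U) : HasFDerivAt e₂ (fderiv ℝ e₂ z) z :=
  ((F.smooth₂.contDiffAt (F.mem_nhds hz)).differentiableAt (by simp)).hasFDerivAt

theorem orth' (F : IsFrame G U e₁ e₂) (hz : z ∈ U) : G z (e₂ z) (e₁ z) = 0 := by
  rw [(F.metric z hz).isInner.symm, F.orth z hz]

theorem const_metric (F : IsFrame G U e₁ e₂) (hz : z ∈ U) {X Y : E → E}
    (hX : DifferentiableAt ℝ X z) (hY : DifferentiableAt ℝ Y z) {r : ℝ}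
    (h : ∀ w ∈ U, G w (X w) (Y w) = r) (v : E) :
    G z (fderiv ℝ X z v + christ G z v (X z)) (Y z) +
      G z (X z) (fderiv ℝ Y z v + christ G z v (Y z)) = 0 := by
  obtain ⟨L, hL, hLv⟩ := hasFDerivAt_metric (F.metric z hz) hX hY
  have h1 : (fun w => G w (X w) (Y w)) =ᶠ[𝓝 z] fun _ => r := by
    filter_upwards [F.mem_nhds hz] with w hw using h w hw
  have h2 : L = 0 := hL.unique ((hasFDerivAt_const r z).congr_of_eventuallyEq h1)
  rw [← hLv, h2]
  rfl

/-- The `e₁` component of ∇e₁ is half the derivative of the constant |e₁|²; the other component is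
the connection form by definition. -/
theorem nabla₁ (F : IsFrame G U e₁ e₂) (hz : z ∈ U) (v : E) :
    fderiv ℝ e₁ z v + christ G z v (e₁ z) = connForm G e₁ e₂ z v • e₂ z := by
  have h1 := F.const_metric hz (F.hasFDerivAt₁ hz).differentiableAt
    (F.hasFDerivAt₁ hz).differentiableAt F.norm₁ v
  rw [(F.metric z hz).isInner.symm (e₁ z)] at h1
  have h2 : G z (fderiv ℝ e₁ z v + christ G z v (e₁ z)) (e₁ z) = 0 := by linarith
  rw [F.span z hz (fderiv ℝ e₁ z v + christ G z v (e₁ z)), h2, zero_smul, zero_add]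
  rfl

theorem nabla₂ (F : IsFrame G U e₁ e₂) (hz : z ∈ U) (v : E) :
    fderiv ℝ e₂ z v + christ G z v (e₂ z) = -(connForm G e₁ e₂ z v • e₁ z) := by
  have h1 := F.const_metric hz (F.hasFDerivAt₂ hz).differentiableAt
    (F.hasFDerivAt₂ hz).differentiableAt F.norm₂ v
  rw [(F.metric z hz).isInner.symm (e₂ z)] at h1
  have h2 : G z (fderiv ℝ e₂ z v + christ G z v (e₂ z)) (e₂ z) = 0 := by linarith
  have h3 := F.const_metric hz (F.hasFDerivAt₁ hz).differentiableAt
    (F.hasFDerivAt₂ hz).differentiableAt F.orth v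
  rw [(F.metric z hz).isInner.symm (e₁ z), F.nabla₁ hz, map_smul, smul_apply, F.norm₂ z hz] at h3
  have h4 : G z (fderiv ℝ e₂ z v + christ G z v (e₂ z)) (e₁ z) = -connForm G e₁ e₂ z v := by
    simp only [smul_eq_mul] at h3
    linarith
  rw [F.span z hz (fderiv ℝ e₂ z v + christ G z v (e₂ z)), h2, h4]
  simp

theorem contDiffAt_christ (F : IsFrame G U e₁ e₂) (hz : z ∈ U) : ContDiffAt ℝ ∞ (christ G) z :=
  BiconservativeSurface.contDiffAt_christ (F.metric z hz).isInner (F.metric z hz).smooth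

theorem contDiffAt_connForm (F : IsFrame G U e₁ e₂) (hz : z ∈ U) :
    ContDiffAt ℝ ∞ (connForm G e₁ e₂) z := by
  have h1 := F.smooth₁.contDiffAt (F.mem_nhds hz)
  have h2 := F.smooth₂.contDiffAt (F.mem_nhds hz)
  have h3 : ContDiffAt ℝ ∞ (fun z => (christ G z).flip) z :=
    ((ContinuousLinearMap.flipₗᵢ ℝ E E E).toContinuousLinearEquiv.contDiff.contDiffAt).comp z
      (F.contDiffAt_christ hz)
  have h4 : ContDiffAt ℝ ∞ (fun z => (G z).flip) z :=
    ((ContinuousLinearMap.flipₗᵢ ℝ E E ℝ).toContinuousLinearEquiv.contDiff.contDiffAt).comp z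
      (F.metric z hz).smooth
  exact (h4.clm_apply h2).clm_comp ((h1.fderiv_right (by simp)).add (h3.clm_apply h1))

/-- The exterior derivative of the connection form. -/
def dConn (G : E → E →L[ℝ] E →L[ℝ] ℝ) (e₁ e₂ : E → E) (z u v : E) : ℝ :=
  fderiv ℝ (connForm G e₁ e₂) z u v - fderiv ℝ (connForm G e₁ e₂) z v u

theorem snd_fderiv {e f : E → E} {θ : E → E →L[ℝ] ℝ} (hΓ : DifferentiableAt ℝ (christ G) z)
    (he : ContDiffAt ℝ ∞ e z) (hf : DifferentiableAt ℝ f z) (hω : DifferentiableAt ℝ θ z)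
    (h : ∀ᶠ w in 𝓝 z, ∀ v, fderiv ℝ e w v + christ G w v (e w) = θ w v • f w) (u v : E) :
    fderiv ℝ (fderiv ℝ e) z u v + fderiv ℝ (christ G) z u v (e z) + christ G z v (fderiv ℝ e z u) =
      fderiv ℝ θ z u v • f z + θ z v • fderiv ℝ f z u := by
  have he1 : HasFDerivAt e (fderiv ℝ e z) z := (he.differentiableAt (by simp)).hasFDerivAt
  have he2 : HasFDerivAt (fderiv ℝ e) (fderiv ℝ (fderiv ℝ e) z) z :=
    ((he.fderiv_right (m := ∞) (by simp)).differentiableAt (by simp)).hasFDerivAt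
  have h1 := (he2.clm_apply (hasFDerivAt_const v z)).add
    ((hΓ.hasFDerivAt.clm_apply (hasFDerivAt_const v z)).clm_apply he1)
  have h2 := (hω.hasFDerivAt.clm_apply (hasFDerivAt_const v z)).smul hf.hasFDerivAt
  have h3 := h1.unique (h2.congr_of_eventuallyEq (by filter_upwards [h] with w hw using hw v))
  have h4 := congrArg (fun L : E →L[ℝ] E => L u) h3
  simp at h4
  rw [add_comm (fderiv ℝ θ z u v • f z), ← h4]
  abel

/-- Differentiate ∇e₁ = ω e₂ again and antisymmetrize. The second derivatives of `e₁` cancel, and so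
do the terms quadratic in ω, because ω(u) ω(v) is symmetric; only dω survives. -/
theorem flatCurv₁ (F : IsFrame G U e₁ e₂) (hz : z ∈ U) (u v : E) :
    flatCurv G z u v (e₁ z) = dConn G e₁ e₂ z u v • e₂ z := by
  have he := F.smooth₁.contDiffAt (F.mem_nhds hz)
  have hω := (F.contDiffAt_connForm hz).differentiableAt (by simp)
  have hΓ := (F.contDiffAt_christ hz).differentiableAt (by simp)
  have h := fun u v => snd_fderiv hΓ he (F.hasFDerivAt₂ hz).differentiableAt hω
    (by filter_upwards [F.mem_nhds hz] with w hw v using F.nabla₁ hw v) u v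
  have h1 := h u v
  have h2 := h v u
  have hs := (he.isSymmSndFDerivAt (by
    simp only [minSmoothness_of_isRCLikeNormedField]; exact two_le_infty)).eq u v
  rw [← hs] at h2
  have du : fderiv ℝ e₁ z u = connForm G e₁ e₂ z u • e₂ z - christ G z u (e₁ z) :=
    eq_sub_of_add_eq (F.nabla₁ hz u)
  have dv : fderiv ℝ e₁ z v = connForm G e₁ e₂ z v • e₂ z - christ G z v (e₁ z) :=
    eq_sub_of_add_eq (F.nabla₁ hz v)
  have du' : fderiv ℝ e₂ z u = -(connForm G e₁ e₂ z u • e₁ z) - christ G z u (e₂ z) :=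
    eq_sub_of_add_eq (F.nabla₂ hz u)
  have dv' : fderiv ℝ e₂ z v = -(connForm G e₁ e₂ z v • e₁ z) - christ G z v (e₂ z) :=
    eq_sub_of_add_eq (F.nabla₂ hz v)
  rw [du, du', map_sub, map_smul] at h1
  rw [dv, dv', map_sub, map_smul] at h2
  unfold flatCurv dConn
  linear_combination (norm := module) h1 - h2

theorem flatCurv₂ (F : IsFrame G U e₁ e₂) (hz : z ∈ U) (u v : E) :
    flatCurv G z u v (e₂ z) = -(dConn G e₁ e₂ z u v • e₁ z) := by
  have he := F.smooth₂.contDiffAt (F.mem_nhds hz)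
  have hω := (F.contDiffAt_connForm hz).differentiableAt (by simp)
  have hΓ := (F.contDiffAt_christ hz).differentiableAt (by simp)
  have h := fun u v => snd_fderiv hΓ he (F.hasFDerivAt₁ hz).differentiableAt hω.neg
    (by filter_upwards [F.mem_nhds hz] with w hw v
        simpa using F.nabla₂ hw v) u v
  have h1 := h u v
  have h2 := h v u
  have hs := (he.isSymmSndFDerivAt (by
    simp only [minSmoothness_of_isRCLikeNormedField]; exact two_le_infty)).eq u v
  rw [← hs] at h2
  have du : fderiv ℝ e₁ z u = connForm G e₁ e₂ z u • e₂ z - christ G z u (e₁ z) :=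
    eq_sub_of_add_eq (F.nabla₁ hz u)
  have dv : fderiv ℝ e₁ z v = connForm G e₁ e₂ z v • e₂ z - christ G z v (e₁ z) :=
    eq_sub_of_add_eq (F.nabla₁ hz v)
  have du' : fderiv ℝ e₂ z u = -(connForm G e₁ e₂ z u • e₁ z) - christ G z u (e₂ z) :=
    eq_sub_of_add_eq (F.nabla₂ hz u)
  have dv' : fderiv ℝ e₂ z v = -(connForm G e₁ e₂ z v • e₁ z) - christ G z v (e₂ z) :=
    eq_sub_of_add_eq (F.nabla₂ hz v)
  have hn : ∀ x y, fderiv ℝ (-connForm G e₁ e₂) z x y = -fderiv ℝ (connForm G e₁ e₂) z x y := by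
    intro x y
    rw [fderiv_neg]; rfl
  have hn' : ∀ x, (-connForm G e₁ e₂) z x = -connForm G e₁ e₂ z x := fun x => rfl
  rw [hn, hn', du, du', map_sub, map_neg, map_smul] at h1
  rw [hn, hn', dv, dv', map_sub, map_neg, map_smul] at h2
  unfold flatCurv dConn
  linear_combination (norm := module) h1 - h2

theorem flatCurv_add (u v w w' : E) :
    flatCurv G z u v (w + w') = flatCurv G z u v w + flatCurv G z u v w' := by
  simp only [flatCurv, map_add]; abel

theorem flatCurv_smul (r : ℝ) (u v w : E) :
    flatCurv G z u v (r • w) = r • flatCurv G z u v w := by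
  simp only [flatCurv, map_smul, smul_add, smul_sub]

/-- The signed area of a parallelogram, relative to a frame. -/
def area (G : E → E →L[ℝ] E →L[ℝ] ℝ) (e₁ e₂ : E → E) (z u v : E) : ℝ :=
  G z u (e₁ z) * G z v (e₂ z) - G z u (e₂ z) * G z v (e₁ z)

/-- In dimension two every alternating 2-form is a multiple of the area form. -/
theorem alternating_eq (F : IsFrame G U e₁ e₂) (hz : z ∈ U) (L : E →L[ℝ] E →L[ℝ] ℝ) (u v : E) :
    L u v - L v u = area G e₁ e₂ z u v * (L (e₁ z) (e₂ z) - L (e₂ z) (e₁ z)) := by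
  conv_lhs => rw [F.span z hz u, F.span z hz v]
  simp only [map_add, map_smul, add_apply, smul_apply, smul_eq_mul, area]
  ring

theorem dConn_eq (F : IsFrame G U e₁ e₂) (hz : z ∈ U) (u v : E) :
    dConn G e₁ e₂ z u v = area G e₁ e₂ z u v * dConn G e₁ e₂ z (e₁ z) (e₂ z) :=
  F.alternating_eq hz _ u v

theorem inner_eq (F : IsFrame G U e₁ e₂) (hz : z ∈ U) (u v : E) :
    G z u v = G z u (e₁ z) * G z v (e₁ z) + G z u (e₂ z) * G z v (e₂ z) := by
  conv_lhs => rw [F.span z hz v]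
  simp only [map_add, map_smul, smul_eq_mul]
  ring

theorem gram_det (F : IsFrame G U e₁ e₂) (hz : z ∈ U) (u v : E) :
    G z u u * G z v v - G z u v * G z v u = area G e₁ e₂ z u v ^ 2 := by
  rw [F.inner_eq hz u u, F.inner_eq hz v v, F.inner_eq hz u v, F.inner_eq hz v u]
  unfold area
  ring

/-- One factor `area` comes from dω(u, v), the other from pairing with `u`, and their product is the
Gram determinant. Hence K = -dω(e₁, e₂), whatever basis computes K. -/
theorem inner_flatCurv (F : IsFrame G U e₁ e₂) (hz : z ∈ U) (u v : E) :
    G z (flatCurv G z u v v) u =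
      -dConn G e₁ e₂ z (e₁ z) (e₂ z) * (G z u u * G z v v - G z u v * G z v u) := by
  rw [F.gram_det hz]
  have h : flatCurv G z u v v = G z v (e₁ z) • (dConn G e₁ e₂ z u v • e₂ z) +
      G z v (e₂ z) • (-(dConn G e₁ e₂ z u v • e₁ z)) := by
    conv_lhs => rw [F.span z hz v]
    rw [flatCurv_add, flatCurv_smul, flatCurv_smul, ← F.span z hz v, F.flatCurv₁ hz, F.flatCurv₂ hz]
  rw [h, F.dConn_eq hz u v]
  have hs := (F.metric z hz).isInner.symm
  simp only [map_add, map_smul, map_neg, add_apply, smul_apply, neg_apply, smul_eq_mul,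
    hs (e₁ z) u, hs (e₂ z) u]
  unfold area
  ring

end IsFrame
end Frames

/-! ### Symmetric tensors in a frame: the local Weitzenböck identity. -/

section FrameTensors

variable {E : Type*} [NormedAddCommGroup E] [NormedSpace ℝ E] [FiniteDimensional ℝ E]

variable {G : E → E →L[ℝ] E →L[ℝ] ℝ} {U : Set E} {e₁ e₂ : E → E} {z : E} {T : E → E →L[ℝ] E}

/-- The component `⟨T e, f⟩` of a tensor field. -/
def comp (G : E → E →L[ℝ] E →L[ℝ] ℝ) (T : E → E →L[ℝ] E) (e f : E → E) (z : E) : ℝ :=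
  G z (T z (e z)) (f z)

/-- The first diagonal component of the covariant derivative of a symmetric tensor field, in a
frame. -/
def nab₁₁ (G : E → E →L[ℝ] E →L[ℝ] ℝ) (T : E → E →L[ℝ] E) (e₁ e₂ : E → E) (z : E) : E →L[ℝ] ℝ :=
  fderiv ℝ (comp G T e₁ e₁) z - (2 * comp G T e₁ e₂ z) • connForm G e₁ e₂ z

/-- The off-diagonal component of the covariant derivative of a symmetric tensor field. -/
def nab₁₂ (G : E → E →L[ℝ] E →L[ℝ] ℝ) (T : E → E →L[ℝ] E) (e₁ e₂ : E → E) (z : E) : E →L[ℝ] ℝ :=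
  fderiv ℝ (comp G T e₁ e₂) z +
    (comp G T e₁ e₁ z - comp G T e₂ e₂ z) • connForm G e₁ e₂ z

/-- The second diagonal component of the covariant derivative of a symmetric tensor field. -/
def nab₂₂ (G : E → E →L[ℝ] E →L[ℝ] ℝ) (T : E → E →L[ℝ] E) (e₁ e₂ : E → E) (z : E) : E →L[ℝ] ℝ :=
  fderiv ℝ (comp G T e₂ e₂) z + (2 * comp G T e₁ e₂ z) • connForm G e₁ e₂ z

/-- A smooth symmetric tensor field over the domain of a frame. -/
structure IsSymmTensorOn (G : E → E →L[ℝ] E →L[ℝ] ℝ) (U : Set E) (T : E → E →L[ℝ] E) : Prop where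
  smooth : ContDiffOn ℝ ∞ T U
  symm : ∀ z ∈ U, ∀ u v, G z (T z u) v = G z (T z v) u

namespace IsFrame

theorem contDiffAt_comp (F : IsFrame G U e₁ e₂) (hT : ContDiffOn ℝ ∞ T U) (hz : z ∈ U)
    {e f : E → E} (he : ContDiffOn ℝ ∞ e U) (hf : ContDiffOn ℝ ∞ f U) :
    ContDiffAt ℝ ∞ (comp G T e f) z :=
  ((F.metric z hz).smooth.clm_apply ((hT.contDiffAt (F.mem_nhds hz)).clm_apply
    (he.contDiffAt (F.mem_nhds hz)))).clm_apply (hf.contDiffAt (F.mem_nhds hz))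

theorem apply₁ (F : IsFrame G U e₁ e₂) (hz : z ∈ U) :
    T z (e₁ z) = comp G T e₁ e₁ z • e₁ z + comp G T e₁ e₂ z • e₂ z :=
  F.span z hz _

theorem apply₂ (F : IsFrame G U e₁ e₂) (hT : IsSymmTensorOn G U T) (hz : z ∈ U) :
    T z (e₂ z) = comp G T e₁ e₂ z • e₁ z + comp G T e₂ e₂ z • e₂ z := by
  rw [F.span z hz (T z (e₂ z)), hT.symm z hz (e₂ z) (e₁ z)]
  rfl

/-- The product rule for T e = a e₁ + b e₂, with the structure equations substituted for the
derivatives of the frame. It serves both frame vectors. -/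
theorem flatNabla_aux (F : IsFrame G U e₁ e₂) (hT : IsSymmTensorOn G U T) (hz : z ∈ U)
    {e : E → E} {a b : E → ℝ} (he : DifferentiableAt ℝ e z) (ha : DifferentiableAt ℝ a z)
    (hb : DifferentiableAt ℝ b z) (h : ∀ w ∈ U, T w (e w) = a w • e₁ w + b w • e₂ w) (u : E) :
    flatNabla G T z u (e z) =
      fderiv ℝ a z u • e₁ z + a z • (connForm G e₁ e₂ z u • e₂ z) +
      (fderiv ℝ b z u • e₂ z - b z • (connForm G e₁ e₂ z u • e₁ z)) -
      T z (fderiv ℝ e z u + christ G z u (e z)) := by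
  have hTd : HasFDerivAt T (fderiv ℝ T z) z :=
    ((hT.smooth.contDiffAt (F.mem_nhds hz)).differentiableAt (by simp)).hasFDerivAt
  have h1 := hTd.clm_apply he.hasFDerivAt
  have h2 := (ha.hasFDerivAt.smul (F.hasFDerivAt₁ hz)).add (hb.hasFDerivAt.smul (F.hasFDerivAt₂ hz))
  have h3 := h1.unique (h2.congr_of_eventuallyEq
    (by filter_upwards [F.mem_nhds hz] with w hw using h w hw))
  have h4 := congrArg (fun L : E →L[ℝ] E => L u) h3
  simp at h4
  have h5 := F.nabla₁ hz u
  have h6 := F.nabla₂ hz u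
  unfold flatNabla
  rw [h z hz, map_add, map_add, map_smul, map_smul]
  linear_combination (norm := module) h4 + a z • h5 + b z • h6

theorem flatNabla₁ (F : IsFrame G U e₁ e₂) (hT : IsSymmTensorOn G U T) (hz : z ∈ U) (u : E) :
    flatNabla G T z u (e₁ z) = nab₁₁ G T e₁ e₂ z u • e₁ z + nab₁₂ G T e₁ e₂ z u • e₂ z := by
  rw [F.flatNabla_aux hT hz (F.hasFDerivAt₁ hz).differentiableAt
    ((F.contDiffAt_comp hT.smooth hz F.smooth₁ F.smooth₁).differentiableAt (by simp))
    ((F.contDiffAt_comp hT.smooth hz F.smooth₁ F.smooth₂).differentiableAt (by simp))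
    (fun w hw => F.apply₁ hw), F.nabla₁ hz, map_smul, F.apply₂ hT hz]
  simp only [nab₁₁, nab₁₂, sub_apply, add_apply, smul_apply, smul_eq_mul]
  module

theorem flatNabla₂ (F : IsFrame G U e₁ e₂) (hT : IsSymmTensorOn G U T) (hz : z ∈ U) (u : E) :
    flatNabla G T z u (e₂ z) = nab₁₂ G T e₁ e₂ z u • e₁ z + nab₂₂ G T e₁ e₂ z u • e₂ z := by
  rw [F.flatNabla_aux hT hz (F.hasFDerivAt₂ hz).differentiableAt
    ((F.contDiffAt_comp hT.smooth hz F.smooth₁ F.smooth₂).differentiableAt (by simp))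
    ((F.contDiffAt_comp hT.smooth hz F.smooth₂ F.smooth₂).differentiableAt (by simp))
    (fun w hw => F.apply₂ hT hw), F.nabla₂ hz, map_neg, map_smul, F.apply₁ hz]
  simp only [nab₁₂, nab₂₂, add_apply, smul_apply, smul_eq_mul]
  module

/-- The `1`-form `-2 (α dβ - β dα + 2 (α² + β²) ω)` of a symmetric tensor field whose trace-free
part has components `α, β`. -/
def fluxForm (G : E → E →L[ℝ] E →L[ℝ] ℝ) (T : E → E →L[ℝ] E) (e₁ e₂ : E → E) (z : E) : E →L[ℝ] ℝ :=
  (-(comp G T e₁ e₁ z - comp G T e₂ e₂ z)) • fderiv ℝ (comp G T e₁ e₂) z +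
    (comp G T e₁ e₂ z • (fderiv ℝ (comp G T e₁ e₁) z - fderiv ℝ (comp G T e₂ e₂) z) -
      ((comp G T e₁ e₁ z - comp G T e₂ e₂ z) ^ 2 + 4 * comp G T e₁ e₂ z ^ 2) • connForm G e₁ e₂ z)

/-- The squared norm of the covariant derivative of a tensor field, in a frame. -/
def frameNormSqNabla (G : E → E →L[ℝ] E →L[ℝ] ℝ) (T : E → E →L[ℝ] E) (e₁ e₂ : E → E) (z : E) : ℝ :=
  nab₁₁ G T e₁ e₂ z (e₁ z) ^ 2 + 2 * nab₁₂ G T e₁ e₂ z (e₁ z) ^ 2 + nab₂₂ G T e₁ e₂ z (e₁ z) ^ 2 +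
  (nab₁₁ G T e₁ e₂ z (e₂ z) ^ 2 + 2 * nab₁₂ G T e₁ e₂ z (e₂ z) ^ 2 +
    nab₂₂ G T e₁ e₂ z (e₂ z) ^ 2)

/-- The squared norm of a tensor field, in a frame. -/
def frameNormSq (G : E → E →L[ℝ] E →L[ℝ] ℝ) (T : E → E →L[ℝ] E) (e₁ e₂ : E → E) (z : E) : ℝ :=
  comp G T e₁ e₁ z ^ 2 + 2 * comp G T e₁ e₂ z ^ 2 + comp G T e₂ e₂ z ^ 2

theorem contDiffAt_fluxForm (F : IsFrame G U e₁ e₂) (hT : IsSymmTensorOn G U T) (hz : z ∈ U) :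
    ContDiffAt ℝ ∞ (fluxForm G T e₁ e₂) z := by
  have ha := F.contDiffAt_comp hT.smooth hz F.smooth₁ F.smooth₁
  have hb := F.contDiffAt_comp hT.smooth hz F.smooth₁ F.smooth₂
  have hc := F.contDiffAt_comp hT.smooth hz F.smooth₂ F.smooth₂
  have ha' : ContDiffAt ℝ ∞ _ z := ha.fderiv_right (by simp)
  have hb' : ContDiffAt ℝ ∞ _ z := hb.fderiv_right (by simp)
  have hc' : ContDiffAt ℝ ∞ _ z := hc.fderiv_right (by simp)
  exact ((ha.sub hc).neg.smul hb').add ((hb.smul (ha'.sub hc')).sub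
    ((((ha.sub hc).pow 2).add (contDiffAt_const.mul (hb.pow 2))).smul (F.contDiffAt_connForm hz)))

/-- The heart of the argument. By `alternating_eq` it is enough to evaluate on (e₁, e₂). The dω part
of dη is 4K(α² + β²), and 2(α² + β²) = |T|² - t²/2. The remaining part has no second derivatives,
and equals |∇T|² - |dt|² modulo the two divergence equations. -/
theorem fderiv_fluxForm (F : IsFrame G U e₁ e₂) (hT : IsSymmTensorOn G U T) (hz : z ∈ U)
    (hd₁ : nab₁₁ G T e₁ e₂ z (e₁ z) + nab₁₂ G T e₁ e₂ z (e₂ z) = 0)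
    (hd₂ : nab₁₂ G T e₁ e₂ z (e₁ z) + nab₂₂ G T e₁ e₂ z (e₂ z) = 0) (u v : E) :
    fderiv ℝ (fluxForm G T e₁ e₂) z u v - fderiv ℝ (fluxForm G T e₁ e₂) z v u =
      (frameNormSqNabla G T e₁ e₂ z +
        2 * (-dConn G e₁ e₂ z (e₁ z) (e₂ z)) * (frameNormSq G T e₁ e₂ z -
          (comp G T e₁ e₁ z + comp G T e₂ e₂ z) ^ 2 / 2) -
        ((fderiv ℝ (comp G T e₁ e₁) z (e₁ z) + fderiv ℝ (comp G T e₂ e₂) z (e₁ z)) ^ 2 +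
          (fderiv ℝ (comp G T e₁ e₁) z (e₂ z) + fderiv ℝ (comp G T e₂ e₂) z (e₂ z)) ^ 2)) *
      area G e₁ e₂ z u v := by
  have ha := F.contDiffAt_comp hT.smooth hz F.smooth₁ F.smooth₁
  have hb := F.contDiffAt_comp hT.smooth hz F.smooth₁ F.smooth₂
  have hc := F.contDiffAt_comp hT.smooth hz F.smooth₂ F.smooth₂
  have h1 : ∀ {f : E → ℝ}, ContDiffAt ℝ ∞ f z → HasFDerivAt f (fderiv ℝ f z) z := fun h =>
    (h.differentiableAt (by simp)).hasFDerivAt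
  have h2 : ∀ {f : E → ℝ}, ContDiffAt ℝ ∞ f z →
      HasFDerivAt (fderiv ℝ f) (fderiv ℝ (fderiv ℝ f) z) z := fun h =>
    ((h.fderiv_right (m := ∞) (by simp)).differentiableAt (by simp)).hasFDerivAt
  have hs : ∀ {f : E → ℝ}, ContDiffAt ℝ ∞ f z → ∀ u v,
      fderiv ℝ (fderiv ℝ f) z u v = fderiv ℝ (fderiv ℝ f) z v u := fun h =>
    (h.isSymmSndFDerivAt (by
      simp only [minSmoothness_of_isRCLikeNormedField]; exact two_le_infty)).eq
  have hω : HasFDerivAt (connForm G e₁ e₂) (fderiv ℝ (connForm G e₁ e₂) z) z :=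
    ((F.contDiffAt_connForm hz).differentiableAt (by simp)).hasFDerivAt
  have key : ∀ u v, fderiv ℝ (fluxForm G T e₁ e₂) z u v = _ := fun u v =>
    congrArg (fun L : E →L[ℝ] E →L[ℝ] ℝ => L u v)
      (((((h1 ha).sub (h1 hc)).neg).smul (h2 hb)).add (((h1 hb).smul ((h2 ha).sub (h2 hc))).sub
        (((((h1 ha).sub (h1 hc)).pow 2).add (((h1 hb).pow 2).const_mul 4)).smul hω))).fderiv
  rw [F.alternating_eq hz, mul_comm (area G e₁ e₂ z u v)]
  congr 1
  rw [key, key]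
  simp only [add_apply, sub_apply, neg_apply, smul_apply, ContinuousLinearMap.smulRight_apply,
    Pi.sub_apply, Pi.neg_apply, Pi.add_apply, smul_eq_mul, hs ha (e₂ z) (e₁ z),
    hs hb (e₂ z) (e₁ z), hs hc (e₂ z) (e₁ z)]
  simp only [nab₁₁, nab₁₂, nab₂₂, add_apply, sub_apply, smul_apply, smul_eq_mul] at hd₁ hd₂
  unfold frameNormSqNabla frameNormSq dConn
  simp only [nab₁₁, nab₁₂, nab₂₂, add_apply, sub_apply, smul_apply, smul_eq_mul]
  -- The multipliers are twice the Codazzi defects (∇₁T)₂₂ - (∇₂T)₁₂ and (∇₂T)₁₁ - (∇₁T)₁₂, written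
  -- out.
  linear_combination
    2 * ((fderiv ℝ (comp G T e₂ e₂) z (e₁ z) + 2 * comp G T e₁ e₂ z * connForm G e₁ e₂ z (e₁ z)) -
      (fderiv ℝ (comp G T e₁ e₂) z (e₂ z) + (comp G T e₁ e₁ z - comp G T e₂ e₂ z) * connForm G e₁ e₂ z (e₂ z))) * hd₁ +
    2 * ((fderiv ℝ (comp G T e₁ e₁) z (e₂ z) - 2 * comp G T e₁ e₂ z * connForm G e₁ e₂ z (e₂ z)) -
      (fderiv ℝ (comp G T e₁ e₂) z (e₁ z) + (comp G T e₁ e₁ z - comp G T e₂ e₂ z) * connForm G e₁ e₂ z (e₁ z))) * hd₂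

/-- The contraction of ∇T with T differs from η only by components of T times components of Div T.
This identifies the frame expression η with an invariantly defined vector field. -/
theorem fluxForm_apply
    (hd₁ : nab₁₁ G T e₁ e₂ z (e₁ z) + nab₁₂ G T e₁ e₂ z (e₂ z) = 0)
    (hd₂ : nab₁₂ G T e₁ e₂ z (e₁ z) + nab₂₂ G T e₁ e₂ z (e₂ z) = 0) :
    fluxForm G T e₁ e₂ z (e₂ z) =
      (nab₁₁ G T e₁ e₂ z (e₁ z) * comp G T e₁ e₁ z + nab₁₂ G T e₁ e₂ z (e₁ z) * comp G T e₁ e₂ z) +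
      (nab₁₁ G T e₁ e₂ z (e₂ z) * comp G T e₁ e₂ z + nab₁₂ G T e₁ e₂ z (e₂ z) * comp G T e₂ e₂ z) ∧
    -fluxForm G T e₁ e₂ z (e₁ z) =
      (nab₁₂ G T e₁ e₂ z (e₁ z) * comp G T e₁ e₁ z + nab₂₂ G T e₁ e₂ z (e₁ z) * comp G T e₁ e₂ z) +
      (nab₁₂ G T e₁ e₂ z (e₂ z) * comp G T e₁ e₂ z +
        nab₂₂ G T e₁ e₂ z (e₂ z) * comp G T e₂ e₂ z) := by
  simp only [nab₁₁, nab₁₂, nab₂₂, fluxForm, add_apply, sub_apply, smul_apply, smul_eq_mul]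
    at hd₁ hd₂ ⊢
  constructor
  · linear_combination (-comp G T e₁ e₁ z) * hd₁ - comp G T e₁ e₂ z * hd₂
  · linear_combination (-comp G T e₁ e₂ z) * hd₁ - comp G T e₂ e₂ z * hd₂

end IsFrame
end FrameTensors

/-! ### Existence of frames over a whole chart. -/

section GramSchmidt

variable {E : Type*} [NormedAddCommGroup E] [NormedSpace ℝ E] [FiniteDimensional ℝ E]

/-- Gram–Schmidt on two constant fields: their independence at every point makes the frame smooth on
all of `U`, and the process preserves orientation, so the area is the positive root of the Gram
determinant. -/
theorem exists_isFrame {G : E → E →L[ℝ] E →L[ℝ] ℝ} {U : Set E} (hU : IsOpen U)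
    (hG : ∀ z ∈ U, IsMetricAt G z) {b₁ b₂ : E} (hb₁ : b₁ ≠ 0) (hb : ∀ r : ℝ, b₂ - r • b₁ ≠ 0)
    (hspan : ∀ v : E, ∃ x y : ℝ, v = x • b₁ + y • b₂) :
    ∃ e₁ e₂ : E → E, IsFrame G U e₁ e₂ ∧ ∀ z ∈ U,
      IsFrame.area G e₁ e₂ z b₁ b₂ = √(G z b₁ b₁ * G z b₂ b₂ - G z b₁ b₂ * G z b₂ b₁) ∧
      0 < IsFrame.area G e₁ e₂ z b₁ b₂ := by
  set s : E → ℝ := fun z => √(G z b₁ b₁) with hs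
  set r : E → ℝ := fun z => G z b₂ b₁ / G z b₁ b₁ with hr
  set w : E → E := fun z => b₂ - r z • b₁ with hw
  set t : E → ℝ := fun z => √(G z (w z) (w z)) with ht
  have p₁ : ∀ z ∈ U, 0 < G z b₁ b₁ := fun z hz => (hG z hz).isInner.pos _ hb₁
  have p₂ : ∀ z ∈ U, 0 < G z (w z) (w z) := fun z hz => (hG z hz).isInner.pos _ (hb _)
  have hs0 : ∀ z ∈ U, 0 < s z := fun z hz => Real.sqrt_pos.2 (p₁ z hz)
  have ht0 : ∀ z ∈ U, 0 < t z := fun z hz => Real.sqrt_pos.2 (p₂ z hz)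
  have hss : ∀ z ∈ U, s z * s z = G z b₁ b₁ := fun z hz => Real.mul_self_sqrt (p₁ z hz).le
  have htt : ∀ z ∈ U, t z * t z = G z (w z) (w z) := fun z hz => Real.mul_self_sqrt (p₂ z hz).le
  have hw₁ : ∀ z ∈ U, G z (w z) b₁ = 0 := fun z hz => by
    simp only [hw, hr, map_sub, map_smul, sub_apply, smul_apply, smul_eq_mul]
    rw [div_mul_cancel₀ _ (p₁ z hz).ne', sub_self]
  have hGs : ∀ z ∈ U, ContDiffAt ℝ ∞ G z := fun z hz => (hG z hz).smooth
  have h11 : ∀ z ∈ U, ContDiffAt ℝ ∞ (fun z => G z b₁ b₁) z := fun z hz =>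
    ((hGs z hz).clm_apply contDiffAt_const).clm_apply contDiffAt_const
  have hws : ∀ z ∈ U, ContDiffAt ℝ ∞ w z := fun z hz =>
    contDiffAt_const.sub (((((hGs z hz).clm_apply contDiffAt_const).clm_apply
      contDiffAt_const).div (h11 z hz) (p₁ z hz).ne').smul contDiffAt_const)
  have hww : ∀ z ∈ U, ContDiffAt ℝ ∞ (fun z => G z (w z) (w z)) z := fun z hz =>
    ((hGs z hz).clm_apply (hws z hz)).clm_apply (hws z hz)
  have F : IsFrame G U (fun z => (s z)⁻¹ • b₁) (fun z => (t z)⁻¹ • w z) := by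
    have n₁ : ∀ z ∈ U, G z ((s z)⁻¹ • b₁) ((s z)⁻¹ • b₁) = 1 := fun z hz => by
      have := (hs0 z hz).ne'
      simp only [map_smul, smul_apply, smul_eq_mul, ← hss z hz]
      field_simp
    have n₂ : ∀ z ∈ U, G z ((t z)⁻¹ • w z) ((t z)⁻¹ • w z) = 1 := fun z hz => by
      have := (ht0 z hz).ne'
      simp only [map_smul, smul_apply, smul_eq_mul, ← htt z hz]
      field_simp
    have o : ∀ z ∈ U, G z ((s z)⁻¹ • b₁) ((t z)⁻¹ • w z) = 0 := fun z hz => by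
      rw [(hG z hz).isInner.symm]
      simp only [map_smul, smul_apply, smul_eq_mul, hw₁ z hz, mul_zero]
    refine ⟨hU, hG, fun z hz => ?_, fun z hz => ?_, n₁, n₂, o, fun z hz v => ?_⟩
    · exact ((((h11 z hz).sqrt (p₁ z hz).ne').inv (hs0 z hz).ne').smul
        contDiffAt_const).contDiffWithinAt
    · exact ((((hww z hz).sqrt (p₂ z hz).ne').inv (ht0 z hz).ne').smul
        (hws z hz)).contDiffWithinAt
    · obtain ⟨x, y, rfl⟩ := hspan v
      have o' := o z hz
      rw [(hG z hz).isInner.symm] at o'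
      have key : ∃ p q : ℝ, x • b₁ + y • b₂ = p • ((s z)⁻¹ • b₁) + q • ((t z)⁻¹ • w z) := by
        refine ⟨(x + y * r z) * s z, y * t z, ?_⟩
        rw [smul_smul, smul_smul, mul_assoc, mul_inv_cancel₀ (hs0 z hz).ne', mul_assoc,
          mul_inv_cancel₀ (ht0 z hz).ne', hw]
        module
      obtain ⟨p, q, hpq⟩ := key
      have m₁ := n₁ z hz
      have m₂ := n₂ z hz
      have m₃ := o z hz
      rw [hpq]
      generalize (s z)⁻¹ • b₁ = X at *
      generalize (t z)⁻¹ • w z = Y at *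
      simp [m₁, m₂, m₃, o']
  refine ⟨_, _, F, fun z hz => ?_⟩
  have pos : 0 < IsFrame.area G (fun z => (s z)⁻¹ • b₁) (fun z => (t z)⁻¹ • w z) z b₁ b₂ := by
    have h1 : G z b₁ (w z) = 0 := by rw [(hG z hz).isInner.symm, hw₁ z hz]
    have h2 : G z b₂ (w z) = t z * t z := by
      have : b₂ = w z + r z • b₁ := by simp [hw]
      conv_lhs => rw [this]
      rw [map_add, map_smul, add_apply, smul_apply, h1, htt z hz, smul_zero, add_zero]
    have := hs0 z hz
    have := ht0 z hz
    simp only [IsFrame.area, map_smul, smul_eq_mul, h1, h2, ← hss z hz, mul_zero, zero_mul, sub_zero]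
    positivity
  exact ⟨by rw [F.gram_det hz, Real.sqrt_sq pos.le], pos⟩

end GramSchmidt

/-! ### The Riemannian volume measure in charts. -/

section Volume

variable {m : ℕ} {M : Type*} [TopologicalSpace M]
  [ChartedSpace (EuclideanSpace ℝ (Fin m)) M] [IsManifold (𝓡 m) ∞ M]

/-- The Gram matrix of the coordinate fields of a chart. -/
def coordGram (g : RiemMetric m M) (x : M) (z : Euc m) : Matrix (Fin m) (Fin m) ℝ :=
  Matrix.of fun i j =>
    coordMetric g x z (EuclideanSpace.single i (1 : ℝ)) (EuclideanSpace.single j (1 : ℝ))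

/-- The Riemannian volume density of a chart. -/
def density (g : RiemMetric m M) (x : M) (z : Euc m) : ℝ := √(coordGram g x z).det

theorem gram_coordField (g : RiemMetric m M) {x q : M} (hq : q ∈ (chart m x).source) :
    (gram g q fun i => coordField (basisVec x i) q) = coordGram g x (chart m x q) := by
  ext i j
  simp only [gram, coordGram, Matrix.of_apply]
  rw [coordField_eq hq, coordField_eq hq, inner_eq_coordMetric g hq, toCoord_ofCoord hq,
    toCoord_ofCoord hq, basisVec_eq, basisVec_eq, toCoord_ofCoord (mem_chart_source _ x),
    toCoord_ofCoord (mem_chart_source _ x)]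

theorem continuousOn_coordMetric (g : RiemMetric m M) (x : M) :
    ContinuousOn (coordMetric g x) (chart m x).target :=
  (contDiffOn_coordMetric g x).continuousOn

theorem continuousOn_density (g : RiemMetric m M) (x : M) :
    ContinuousOn (density g x) (chart m x).target := by
  refine Real.continuous_sqrt.comp_continuousOn ?_
  refine (continuous_id.matrix_det).comp_continuousOn ?_
  refine continuousOn_pi.2 fun i => continuousOn_pi.2 fun j => ?_
  exact ((continuousOn_coordMetric g x).clm_apply continuousOn_const).clm_apply continuousOn_const

/-- The two Gram matrices are congruent through the Jacobian matrix. -/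
theorem density_transition (g : RiemMetric m M) {x y q : M} (hx : q ∈ (chart m x).source)
    (hy : q ∈ (chart m y).source) :
    density g x (chart m x q) =
      |(fderiv ℝ (chart m y ∘ (chart m x).symm) (chart m x q)).det| *
        density g y (chart m y q) := by
  set L := fderiv ℝ (chart m y ∘ (chart m x).symm) (chart m x q) with hL
  set A : Matrix (Fin m) (Fin m) ℝ := Matrix.of fun i j => L (EuclideanSpace.single j (1 : ℝ)) i
    with hA
  have hdet : L.det = A.det := by
    rw [ContinuousLinearMap.det, ← LinearMap.det_toMatrix (EuclideanSpace.basisFun (Fin m) ℝ).toBasis]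
    congr 1
  have hsum : ∀ v : Euc m, v = ∑ k, v k • EuclideanSpace.single k (1 : ℝ) := fun v => by
    ext i
    simp [Finset.sum_apply, Pi.single_apply]
  have hG : coordGram g x (chart m x q) = A.transpose * coordGram g y (chart m y q) * A := by
    ext i j
    simp only [coordGram, Matrix.of_apply, Matrix.mul_apply, Matrix.transpose_apply]
    rw [coordMetric_transition g hx hy]
    conv_lhs => rw [← hL, hsum (L (EuclideanSpace.single i 1)), hsum (L (EuclideanSpace.single j 1))]
    simp only [map_sum, map_smul, sum_apply, smul_apply, smul_eq_mul, hA, Matrix.of_apply]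
    refine Finset.sum_congr rfl fun k _ => ?_
    rw [mul_comm]
  rw [density, density, hG, Matrix.det_mul, Matrix.det_mul, Matrix.det_transpose, hdet, mul_right_comm,
    ← sq, Real.sqrt_mul (sq_nonneg _), Real.sqrt_sq_eq_abs]

variable [MeasurableSpace M] [BorelSpace M]

theorem measurableSet_source (x : M) : MeasurableSet (chart m x).source :=
  (chart m x).open_source.measurableSet

theorem measurableSet_target (x : M) : MeasurableSet (chart m x).target :=
  (chart m x).open_target.measurableSet

theorem aemeasurable_symm (x : M) :
    AEMeasurable (chart m x).symm ((volume : Measure (Euc m)).restrict (chart m x).target) :=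
  (chart m x).continuousOn_symm.aemeasurable (measurableSet_target x)

/-- The push-forward is carried by the domain of the chart. The density is controlled only there, so
its measurability is needed only there. -/
theorem map_symm_restrict (x : M) :
    (((volume : Measure (Euc m)).restrict (chart m x).target).map (chart m x).symm).restrict
      (chart m x).source = ((volume : Measure (Euc m)).restrict (chart m x).target).map
        (chart m x).symm := by
  refine Measure.restrict_eq_self_of_ae_mem ?_
  refine (ae_map_iff (aemeasurable_symm x) (measurableSet_source x)).2 ?_
  filter_upwards [ae_restrict_mem (measurableSet_target x)] with z hz using (chart m x).map_target hz

theorem aemeasurable_gram (g : RiemMetric m M) (x : M) :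
    AEMeasurable (fun q => ENNReal.ofReal √(gram g q fun i => coordField (basisVec x i) q).det)
      (((volume : Measure (Euc m)).restrict (chart m x).target).map (chart m x).symm) := by
  rw [← map_symm_restrict]
  refine ENNReal.measurable_ofReal.comp_aemeasurable (ContinuousOn.aemeasurable ?_
    (measurableSet_source x))
  refine ((continuousOn_density g x).comp (chart m x).continuousOn
    fun q hq => (chart m x).map_source hq).congr fun q hq => ?_
  rw [gram_coordField g hq]
  rfl

theorem measurableSet_target_inter_preimage (x : M) {A : Set M} (hA : MeasurableSet A) :
    MeasurableSet ((chart m x).target ∩ (chart m x).symm ⁻¹' A) := by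
  have h := (continuousOn_iff_continuous_domRestrict.1
    (chart m x).continuousOn_symm).measurable hA
  have h1 := (MeasurableEmbedding.subtype_coe (measurableSet_target x)).measurableSet_image.2 h
  convert h1 using 1
  ext z
  simp [Set.domRestrict]
  tauto

theorem chartVolume_apply (g : RiemMetric m M) (x : M) {A : Set M} (hA : MeasurableSet A) :
    chartVolume g x A = ∫⁻ z in (chart m x).target ∩ (chart m x).symm ⁻¹' A,
      ENNReal.ofReal (density g x z) := by
  rw [chartVolume, withDensity_apply _ hA, ← lintegral_indicator hA,
    lintegral_map' ((aemeasurable_gram g x).indicator hA) (aemeasurable_symm x)]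
  have hm := measurableSet_target_inter_preimage (m := m) x hA
  rw [← lintegral_indicator hm, ← lintegral_indicator (measurableSet_target x)]
  refine lintegral_congr fun z => ?_
  by_cases hz : z ∈ (chart m x).target
  · by_cases hz' : (chart m x).symm z ∈ A
    · have h : z ∈ (chart m x).target ∩ (chart m x).symm ⁻¹' A := ⟨hz, hz'⟩
      rw [indicator_of_mem hz, indicator_of_mem hz', indicator_of_mem h,
        gram_coordField g ((chart m x).map_target hz), (chart m x).right_inv hz]
      rfl
    · have h : z ∉ (chart m x).target ∩ (chart m x).symm ⁻¹' A := fun h => hz' h.2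
      rw [indicator_of_mem hz, indicator_of_notMem hz', indicator_of_notMem h]
  · have h : z ∉ (chart m x).target ∩ (chart m x).symm ⁻¹' A := fun h => hz h.1
    rw [indicator_of_notMem hz, indicator_of_notMem h]

theorem chartVolume_inter_source (g : RiemMetric m M) (x : M) {A : Set M} (hA : MeasurableSet A) :
    chartVolume g x (A ∩ (chart m x).source) = chartVolume g x A := by
  rw [chartVolume_apply g x hA, chartVolume_apply g x (hA.inter (measurableSet_source x))]
  congr 2
  ext z
  constructor
  · exact fun h => ⟨h.1, h.2.1⟩
  · exact fun h => ⟨h.1, h.2, (chart m x).map_target h.1⟩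

/-- Change of variables along the transition map, whose Jacobian is absorbed by
`density_transition`. -/
theorem chartVolume_overlap (g : RiemMetric m M) {x y : M} {A : Set M} (hA : MeasurableSet A)
    (hx : A ⊆ (chart m x).source) (hy : A ⊆ (chart m y).source) :
    chartVolume g x A = chartVolume g y A := by
  rw [chartVolume_apply g x hA, chartVolume_apply g y hA]
  have him : (chart m y).target ∩ (chart m y).symm ⁻¹' A =
      (chart m y ∘ (chart m x).symm) '' ((chart m x).target ∩ (chart m x).symm ⁻¹' A) := by
    ext z
    constructor
    · rintro ⟨h1, h2⟩
      refine ⟨chart m x ((chart m y).symm z), ⟨(chart m x).map_source (hx h2), ?_⟩, ?_⟩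
      · rwa [mem_preimage, (chart m x).left_inv (hx h2)]
      · rw [Function.comp_apply, (chart m x).left_inv (hx h2), (chart m y).right_inv h1]
    · rintro ⟨w, ⟨h1, h2⟩, rfl⟩
      refine ⟨(chart m y).map_source (hy h2), ?_⟩
      rwa [mem_preimage, Function.comp_apply, (chart m y).left_inv (hy h2)]
  have hm := measurableSet_target_inter_preimage (m := m) x hA
  rw [him, lintegral_image_eq_lintegral_abs_det_fderiv_mul volume hm
    (f' := fderiv ℝ (chart m y ∘ (chart m x).symm))]
  · refine setLIntegral_congr_fun hm fun z hz => ?_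
    have h := density_transition g (hx hz.2) (hy hz.2)
    rw [(chart m x).right_inv hz.1] at h
    simp only [h, Function.comp_apply]
    exact ENNReal.ofReal_mul (abs_nonneg _)
  · intro z hz
    have h := contDiffAt_transition (hx hz.2) (hy hz.2)
    rw [(chart m x).right_inv hz.1] at h
    exact (h.differentiableAt (by simp)).hasFDerivAt.hasFDerivWithinAt
  · intro z hz w hw h
    have := (chart m y).injOn (hy hz.2) (hy hw.2) h
    exact (chart m x).symm.injOn hz.1 hw.1 this

variable [CompactSpace M]

/-- One inequality is built into the supremum. For the other, cut M into disjoint pieces of finitely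
many charts and glue the chart volumes into one measure ν. By the overlap lemma ν dominates every
chart volume, hence the supremum, and gives `A` its chart volume. -/
theorem riemannianVolume_apply (g : RiemMetric m M) {x : M} {A : Set M} (hA : MeasurableSet A)
    (hx : A ⊆ (chart m x).source) : riemannianVolume g A = chartVolume g x A := by
  refine le_antisymm ?_ (le_iSup (chartVolume g) x A)
  obtain ⟨s, -, hs⟩ := isCompact_univ.elim_nhds_subcover (fun y : M => (chart m y).source)
    fun y _ => (chart m y).open_source.mem_nhds (mem_chart_source _ y)
  have hne : s.Nonempty := by
    obtain ⟨y, hy⟩ := mem_iUnion.1 (hs (mem_univ x))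
    simp only [mem_iUnion] at hy
    exact ⟨y, hy.1⟩
  -- The sequence may repeat charts of the finite cover; `disjointed` makes the repeated pieces
  -- empty.
  obtain ⟨f, hf⟩ := s.countable_toSet.exists_eq_range hne
  set D : ℕ → Set M := disjointed fun k => (chart m (f k)).source with hD
  have hDm : ∀ k, MeasurableSet (D k) := fun k =>
    MeasurableSet.disjointed (fun k => measurableSet_source (f k)) k
  have hDs : ∀ k, D k ⊆ (chart m (f k)).source := fun k => disjointed_subset _ _
  have hDU : ⋃ k, D k = univ := by
    rw [hD, iUnion_disjointed]
    refine eq_univ_of_univ_subset (hs.trans ?_)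
    intro q hq
    simp only [mem_iUnion] at hq ⊢
    obtain ⟨y, hy, hq⟩ := hq
    have : y ∈ range f := hf ▸ hy
    obtain ⟨k, rfl⟩ := this
    exact ⟨k, hq⟩
  set ν : Measure M := Measure.sum fun k => (chartVolume g (f k)).restrict (D k) with hν
  have hle : riemannianVolume g ≤ ν := by
    refine iSup_le fun y => Measure.le_iff.2 fun B hB => ?_
    have hB' := hB.inter (measurableSet_source (m := m) y)
    rw [← chartVolume_inter_source g y hB]
    refine le_trans (le_of_eq ?_) (measure_mono (inter_subset_left (t := (chart m y).source)))
    rw [hν, Measure.sum_apply _ hB']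
    have : chartVolume g y (B ∩ (chart m y).source) =
        ∑' k, chartVolume g y (B ∩ (chart m y).source ∩ D k) := by
      rw [← measure_iUnion (fun i j hij => (disjoint_disjointed _ hij).mono inter_subset_right
        inter_subset_right) fun k => hB'.inter (hDm k), ← inter_iUnion, hDU, inter_univ]
    rw [this]
    refine tsum_congr fun k => ?_
    rw [Measure.restrict_apply hB']
    exact chartVolume_overlap g (hB'.inter (hDm k))
      (inter_subset_left.trans inter_subset_right) (inter_subset_right.trans (hDs k))
  refine (hle A).trans (le_of_eq ?_)
  rw [hν, Measure.sum_apply _ hA]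
  have : chartVolume g x A = ∑' k, chartVolume g x (A ∩ D k) := by
    rw [← measure_iUnion (fun i j hij => (disjoint_disjointed _ hij).mono inter_subset_right
      inter_subset_right) fun k => hA.inter (hDm k), ← inter_iUnion, hDU, inter_univ]
  rw [this]
  refine tsum_congr fun k => ?_
  rw [Measure.restrict_apply hA]
  exact (chartVolume_overlap g (hA.inter (hDm k)) (inter_subset_left.trans hx)
    (inter_subset_right.trans (hDs k))).symm

theorem riemannianVolume_restrict (g : RiemMetric m M) (x : M) :
    (riemannianVolume g).restrict (chart m x).source = chartVolume g x := by
  ext A hA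
  rw [Measure.restrict_apply hA, riemannianVolume_apply g (hA.inter (measurableSet_source x))
    inter_subset_right, chartVolume_inter_source g x hA]

/-- Near `p` the density is less than its value at `p` plus one, so the measure is locally finite;
compactness makes it finite. -/
instance isFiniteMeasure_riemannianVolume (g : RiemMetric m M) :
    IsFiniteMeasure (riemannianVolume g) := by
  have : IsLocallyFiniteMeasure (riemannianVolume g) := by
    refine ⟨fun p => ?_⟩
    have hp := mem_chart_source (Euc m) p
    have hz := (chart m p).map_source hp
    have hc := (continuousOn_density g p).continuousAt ((chart m p).open_target.mem_nhds hz)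
    have h1 : ∀ᶠ z in 𝓝 (chart m p p), density g p z < density g p (chart m p p) + 1 ∧
        z ∈ (chart m p).target :=
      (hc.eventually_lt_const (lt_add_one _)).and ((chart m p).open_target.mem_nhds hz)
    obtain ⟨r, hr, hb⟩ := Metric.eventually_nhds_iff_ball.1 h1
    have hopen : IsOpen ((chart m p).source ∩ chart m p ⁻¹' Metric.ball (chart m p p) r) :=
      (chart m p).isOpen_inter_preimage Metric.isOpen_ball
    refine ⟨_, hopen.mem_nhds ⟨hp, Metric.mem_ball_self hr⟩, ?_⟩
    rw [riemannianVolume_apply g hopen.measurableSet inter_subset_left,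
      chartVolume_apply g p hopen.measurableSet]
    calc _ ≤ ∫⁻ z in Metric.ball (chart m p p) r,
          ENNReal.ofReal (density g p (chart m p p) + 1) := by
          refine (lintegral_mono_set (t := Metric.ball (chart m p p) r) ?_).trans
            (setLIntegral_mono' Metric.isOpen_ball.measurableSet fun z hz =>
              ENNReal.ofReal_le_ofReal (hb z hz).1.le)
          rintro z ⟨h2, -, h3⟩
          rwa [mem_preimage, (chart m p).right_inv h2] at h3
      _ < ⊤ := by
          rw [setLIntegral_const]
          exact ENNReal.mul_lt_top ENNReal.ofReal_lt_top measure_ball_lt_top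
  infer_instance

theorem integral_riemannianVolume (g : RiemMetric m M) (x : M) {f : M → ℝ} (hf : Continuous f)
    (hs : ∀ q, q ∉ (chart m x).source → f q = 0) :
    ∫ q, f q ∂(riemannianVolume g) =
      ∫ z in (chart m x).target, density g x z * f ((chart m x).symm z) := by
  rw [← setIntegral_eq_integral_of_forall_compl_eq_zero hs, riemannianVolume_restrict, chartVolume,
    integral_withDensity_eq_integral_toReal_smul₀ (aemeasurable_gram g x)
      (Eventually.of_forall fun _ => ENNReal.ofReal_lt_top),
    integral_map (aemeasurable_symm x) (f := fun q => (ENNReal.ofReal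
      √(gram g q fun i => coordField (basisVec x i) q).det).toReal • f q)
      ((aemeasurable_gram g x).ennreal_toReal.aestronglyMeasurable.smul
        hf.measurable.aestronglyMeasurable)]
  refine setIntegral_congr_fun (measurableSet_target x) fun z hz => ?_
  rw [gram_coordField g ((chart m x).map_target hz), (chart m x).right_inv hz,
    ENNReal.toReal_ofReal (Real.sqrt_nonneg _), smul_eq_mul]
  rfl

end Volume

/-! ### The divergence theorem on a compact manifold. -/

section Divergence

theorem integral_trace_fderiv_eq_zero {m : ℕ} {W : Euc m → Euc m} (hW : ContDiff ℝ 1 W)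
    (hc : HasCompactSupport W) :
    ∫ z, ∑ i, fderiv ℝ W z (EuclideanSpace.single i (1 : ℝ)) i = 0 := by
  have hd : ∀ z, HasFDerivAt W (fderiv ℝ W z) z := fun z =>
    (hW.differentiable (by simp) z).hasFDerivAt
  have hi : ∀ (i : Fin m) z, HasFDerivAt (fun z => W z i)
      ((EuclideanSpace.proj i : Euc m →L[ℝ] ℝ) ∘L fderiv ℝ W z) z := fun i z =>
    (EuclideanSpace.proj i : Euc m →L[ℝ] ℝ).hasFDerivAt.comp z (hd z)
  have hcont : ∀ i : Fin m, Continuous fun z => W z i := fun i =>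
    (EuclideanSpace.proj i : Euc m →L[ℝ] ℝ).continuous.comp hW.continuous
  have hsupp : ∀ i : Fin m, HasCompactSupport fun z => W z i := fun i =>
    hc.comp_left (g := fun v : Euc m => v i) rfl
  have hint : ∀ i : Fin m, Integrable fun z => fderiv ℝ W z (EuclideanSpace.single i (1 : ℝ)) i := by
    intro i
    refine Continuous.integrable_of_hasCompactSupport ?_ ?_
    · exact (EuclideanSpace.proj i : Euc m →L[ℝ] ℝ).continuous.comp
        ((hW.continuous_fderiv (by simp)).clm_apply continuous_const)
    · exact (hc.fderiv ℝ).comp_left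
        (g := fun L : Euc m →L[ℝ] Euc m => L (EuclideanSpace.single i (1 : ℝ)) i) rfl
  rw [integral_finsetSum _ fun i _ => hint i]
  refine Finset.sum_eq_zero fun i _ => ?_
  -- Integration by parts against the constant function 1.
  have h := integral_mul_fderiv_eq_neg_fderiv_mul_of_integrable (μ := (volume : Measure (Euc m)))
    (f := fun _ => (1 : ℝ)) (g := fun z => W z i) (v := EuclideanSpace.single i (1 : ℝ))
    (by simp) (by simpa [(hi i _).fderiv] using hint i)
    (by simpa using (hcont i).integrable_of_hasCompactSupport (hsupp i))
    (fun _ _ => differentiableAt_const _) (fun z _ => (hi i z).differentiableAt)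
  simpa [(hi i _).fderiv] using h

variable {m : ℕ} {M : Type*} [TopologicalSpace M]
  [ChartedSpace (EuclideanSpace ℝ (Fin m)) M] [IsManifold (𝓡 m) ∞ M]

theorem contDiffOn_comp_chart_symm {f : M → ℝ} (hf : ContMDiff (𝓡 m) 𝓘(ℝ, ℝ) ∞ f) (x : M) :
    ContDiffOn ℝ ∞ (f ∘ (chart m x).symm) (chart m x).target := by
  intro z hz
  have hx := (chart m x).map_target hz
  have h := (contMDiffAt_iff_of_mem_source (I := 𝓡 m) (I' := 𝓘(ℝ, ℝ)) hx
    (mem_chart_source ℝ (f ((chart m x).symm z)))).1 (hf _)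
  have h2 := h.2
  simp only [mfld_simps, (chart m x).right_inv hz] at h2
  rw [contDiffWithinAt_univ] at h2
  exact h2.contDiffWithinAt

theorem continuous_mvfderiv_apply {ρ : M → ℝ} (hρ : ContMDiff (𝓡 m) 𝓘(ℝ, ℝ) ∞ ρ)
    {X : Π q : M, TangentSpace (𝓡 m) q}
    (hX : ∀ x : M, ContinuousOn (fieldCoord x X) (chart m x).target) :
    Continuous fun q => mvfderiv (𝓡 m) ρ q (X q) := by
  refine continuous_iff_continuousAt.2 fun x => ?_
  have hx := mem_chart_source (Euc m) x
  have hρx := contDiffOn_comp_chart_symm hρ x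
  have h1 : ContinuousOn (fun z => fderiv ℝ (ρ ∘ (chart m x).symm) z (fieldCoord x X z))
      (chart m x).target :=
    (hρx.continuousOn_fderiv_of_isOpen (chart m x).open_target (by simp)).clm_apply (hX x)
  have h2 := (h1.continuousAt ((chart m x).open_target.mem_nhds ((chart m x).map_source hx))).comp
    ((chart m x).continuousAt hx)
  refine h2.congr ?_
  filter_upwards [(chart m x).open_source.mem_nhds hx] with q hq
  rw [mvfderiv_eq_fderiv hq ((hρx.contDiffAt ((chart m x).open_target.mem_nhds
    ((chart m x).map_source hq))).differentiableAt (by simp)), Function.comp_apply,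
    fieldCoord_chart hq]

variable [MeasurableSpace M] [BorelSpace M] [CompactSpace M]

/-- By `htr`, `f` is div X in this chart, so the integrand is div(ρX). Times the density it is the
Euclidean divergence of ρ · density · X, which has compact support inside the chart. -/
theorem integral_mul_add_mvfderiv_eq_zero (g : RiemMetric m M) {x : M} {ρ f : M → ℝ}
    (hρ : ContMDiff (𝓡 m) 𝓘(ℝ, ℝ) ∞ ρ) (hs : tsupport ρ ⊆ (chart m x).source)
    (hf : Continuous f) {X : Π q : M, TangentSpace (𝓡 m) q}
    (hX : ∀ x : M, ContinuousOn (fieldCoord x X) (chart m x).target)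
    (hY : ContDiffOn ℝ 1 (fun z => density g x z • fieldCoord x X z) (chart m x).target)
    (htr : ∀ z ∈ (chart m x).target,
      ∑ i, fderiv ℝ (fun z => density g x z • fieldCoord x X z) z
        (EuclideanSpace.single i (1 : ℝ)) i = density g x z * f ((chart m x).symm z)) :
    ∫ q, (ρ q * f q + mvfderiv (𝓡 m) ρ q (X q)) ∂(riemannianVolume g) = 0 := by
  classical
  set U := (chart m x).target with hU
  set Y : Euc m → Euc m := fun z => density g x z • fieldCoord x X z with hYdef
  have hρx := contDiffOn_comp_chart_symm hρ x
  set K : Set (Euc m) := chart m x '' tsupport ρ with hK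
  have hKc : IsCompact K := (isClosed_tsupport ρ).isCompact.image_of_continuousOn
    ((chart m x).continuousOn.mono hs)
  have hKU : K ⊆ U := by
    rintro _ ⟨q, hq, rfl⟩
    exact (chart m x).map_source (hs hq)
  -- The inverse chart is uncontrolled off its target, hence the extension by zero; it is smooth
  -- where needed because the support of `ρ` lies in the chart.
  set r : Euc m → ℝ := U.indicator (ρ ∘ (chart m x).symm) with hr
  have hr0 : ∀ z, z ∉ K → r z = 0 := fun z hz => by
    by_cases hzU : z ∈ U
    · rw [hr, indicator_of_mem hzU, Function.comp_apply]
      refine image_eq_zero_of_notMem_tsupport fun h => hz ⟨_, h, (chart m x).right_inv hzU⟩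
    · exact indicator_of_notMem hzU _
  have hrU : ∀ z ∈ U, r =ᶠ[𝓝 z] ρ ∘ (chart m x).symm := fun z hz => by
    filter_upwards [(chart m x).open_target.mem_nhds hz] with w hw using indicator_of_mem hw _
  have hrK : ∀ z, z ∉ K → r =ᶠ[𝓝 z] fun _ => 0 := fun z hz => by
    filter_upwards [hKc.isClosed.isOpen_compl.mem_nhds hz] with w hw using hr0 w hw
  set W : Euc m → Euc m := fun z => r z • Y z with hW
  have hW0 : ∀ z, z ∉ K → W =ᶠ[𝓝 z] fun _ => 0 := fun z hz => by
    filter_upwards [hrK z hz] with w hw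
    rw [hW]
    simp [hw]
  have hrd : ∀ z ∈ U, ContDiffAt ℝ ∞ r z := fun z hz =>
    (hρx.contDiffAt ((chart m x).open_target.mem_nhds hz)).congr_of_eventuallyEq (hrU z hz)
  have hYd : ∀ z ∈ U, ContDiffAt ℝ 1 Y z := fun z hz =>
    hY.contDiffAt ((chart m x).open_target.mem_nhds hz)
  have hWc : ContDiff ℝ 1 W := contDiff_iff_contDiffAt.2 fun z => by
    by_cases hz : z ∈ U
    · exact ((hrd z hz).of_le (by simp)).smul (hYd z hz)
    · exact contDiffAt_const.congr_of_eventuallyEq (hW0 z fun h => hz (hKU h))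
  have hWs : HasCompactSupport W := HasCompactSupport.intro hKc fun z hz => (hW0 z hz).self_of_nhds
  have hout : ∀ z, z ∉ U → ∑ i, fderiv ℝ W z (EuclideanSpace.single i (1 : ℝ)) i = 0 := by
    intro z hz
    rw [(hW0 z fun h => hz (hKU h)).fderiv_eq]
    simp
  rw [integral_riemannianVolume g x (f := fun q => ρ q * f q + mvfderiv (𝓡 m) ρ q (X q))
      ((hρ.continuous.mul hf).add (continuous_mvfderiv_apply hρ hX))]
  · refine Eq.trans ?_ (integral_trace_fderiv_eq_zero hWc hWs)
    rw [← setIntegral_eq_integral_of_forall_compl_eq_zero hout]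
    refine setIntegral_congr_fun (measurableSet_target (m := m) x) fun z hz => ?_
    have hxz := (chart m x).map_target hz
    have hρd : DifferentiableAt ℝ (ρ ∘ (chart m x).symm) z :=
      (hρx.contDiffAt ((chart m x).open_target.mem_nhds hz)).differentiableAt (by simp)
    have h1 : HasFDerivAt W _ z := ((hrd z hz).differentiableAt (by simp)).hasFDerivAt.smul
      ((hYd z hz).differentiableAt (by simp)).hasFDerivAt
    have h2 : mvfderiv (𝓡 m) ρ ((chart m x).symm z) (X ((chart m x).symm z)) =
        fderiv ℝ r z (fieldCoord x X z) := by
      rw [mvfderiv_eq_fderiv hxz (by rwa [(chart m x).right_inv hz]), (chart m x).right_inv hz,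
        (hrU z hz).fderiv_eq]
      rfl
    have h3 : r z = ρ ((chart m x).symm z) := indicator_of_mem hz _
    have h4 : fderiv ℝ r z (Y z) = ∑ i, fderiv ℝ r z (EuclideanSpace.single i (1 : ℝ)) * Y z i := by
      have : Y z = ∑ i, Y z i • EuclideanSpace.single i (1 : ℝ) := by
        ext i
        simp [Finset.sum_apply, Pi.single_apply]
      conv_lhs => rw [this, map_sum]
      simp [mul_comm]
    have h5 : fderiv ℝ r z (Y z) = density g x z * fderiv ℝ r z (fieldCoord x X z) := by
      rw [hYdef, map_smul, smul_eq_mul]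
    beta_reduce
    rw [h2, h1.fderiv, mul_add, ← h5, h4, ← mul_assoc, mul_comm (density g x z), mul_assoc,
      ← htr z hz, ← h3, Finset.mul_sum, ← Finset.sum_add_distrib]
    refine Finset.sum_congr rfl fun i _ => ?_
    simp
  · intro q hq
    have hq' : q ∉ tsupport ρ := fun h => hq (hs h)
    have h0 : ρ =ᶠ[𝓝 q] fun _ => 0 := notMem_tsupport_iff_eventuallyEq.1 hq'
    have h1 : mvfderiv (𝓡 m) ρ q = 0 := by
      have h2 : mfderiv (𝓡 m) 𝓘(ℝ, ℝ) ρ q = mfderiv (𝓡 m) 𝓘(ℝ, ℝ) (fun _ : M => (0 : ℝ)) q :=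
        h0.mfderiv_eq
      rw [mfderiv_const] at h2
      exact h2
    rw [h0.self_of_nhds, h1, zero_mul, zero_add]
    rfl

/-- For a partition of unity Σρ = 1, so Σ dρ(X) = 0 and f = Σ (ρ f + dρ(X)), a finite sum of
functions with integral zero. -/
theorem integral_divergence_eq_zero [T2Space M] (g : RiemMetric m M) {f : M → ℝ}
    (hf : Continuous f) {X : Π q : M, TangentSpace (𝓡 m) q}
    (hX : ∀ x : M, ContinuousOn (fieldCoord x X) (chart m x).target)
    (hY : ∀ x, ContDiffOn ℝ 1 (fun z => density g x z • fieldCoord x X z) (chart m x).target)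
    (htr : ∀ x, ∀ z ∈ (chart m x).target,
      ∑ i, fderiv ℝ (fun z => density g x z • fieldCoord x X z) z
        (EuclideanSpace.single i (1 : ℝ)) i = density g x z * f ((chart m x).symm z)) :
    ∫ q, f q ∂(riemannianVolume g) = 0 := by
  obtain ⟨s, -, hs⟩ := isCompact_univ.elim_nhds_subcover (fun y : M => (chart m y).source)
    fun y _ => (chart m y).open_source.mem_nhds (mem_chart_source _ y)
  obtain ⟨ρ, hρ⟩ := SmoothPartitionOfUnity.exists_isSubordinate (𝓡 m) (isClosed_univ (X := M))
    (fun y : s => (chart m (y : M)).source) (fun y => (chart m (y : M)).open_source) (by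
      intro q hq
      have := hs hq
      simp only [mem_iUnion] at this ⊢
      obtain ⟨y, hy, hq⟩ := this
      exact ⟨⟨y, hy⟩, hq⟩)
  have hsum : ∀ q, ∑ y, ρ y q = 1 := fun q => by
    rw [← finsum_eq_sum_of_fintype]
    exact ρ.sum_eq_one (mem_univ q)
  have hdsum : ∀ q, ∑ y, mvfderiv (𝓡 m) (ρ y) q (X q) = 0 := fun q => by
    have hq := mem_chart_source (Euc m) q
    have hdq : ∀ y, DifferentiableAt ℝ (ρ y ∘ (chart m q).symm) (chart m q q) := fun y =>
      ((contDiffOn_comp_chart_symm (ρ y).contMDiff q).contDiffAt ((chart m q).open_target.mem_nhds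
        ((chart m q).map_source hq))).differentiableAt (by simp)
    have h1 : HasFDerivAt (fun z => ∑ y, (ρ y ∘ (chart m q).symm) z) _ (chart m q q) :=
      HasFDerivAt.fun_sum fun y _ => (hdq y).hasFDerivAt
    have h2 : (fun z => ∑ y, (ρ y ∘ (chart m q).symm) z) = fun _ => 1 := by
      ext z
      exact hsum _
    rw [h2] at h1
    have h3 := congrArg (fun L : Euc m →L[ℝ] ℝ => L (toCoord q q (X q)))
      (h1.unique (hasFDerivAt_const _ _))
    simp only [sum_apply, zero_apply] at h3
    rw [← h3]
    exact Finset.sum_congr rfl fun y _ => mvfderiv_eq_fderiv hq (hdq y) _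
  have hc : ∀ y : s, Continuous fun q => ρ y q * f q + mvfderiv (𝓡 m) (ρ y) q (X q) := fun y =>
    ((ρ y).contMDiff.continuous.mul hf).add (continuous_mvfderiv_apply (ρ y).contMDiff hX)
  have h1 : f = fun q => ∑ y, (ρ y q * f q + mvfderiv (𝓡 m) (ρ y) q (X q)) := by
    ext q
    rw [Finset.sum_add_distrib, hdsum, ← Finset.sum_mul, hsum, one_mul, add_zero]
  rw [h1, integral_finsetSum _ fun y _ => (hc y).integrable_of_hasCompactSupport
    (HasCompactSupport.of_compactSpace _)]
  exact Finset.sum_eq_zero fun y _ =>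
    integral_mul_add_mvfderiv_eq_zero g (ρ y).contMDiff (hρ y) hf hX (hY y) (htr y)

end Divergence

/-! ### Dual vectors of linear forms. -/

section Sharp

variable {m : ℕ} {M : Type*} [TopologicalSpace M]
  [ChartedSpace (EuclideanSpace ℝ (Fin m)) M] [IsManifold (𝓡 m) ∞ M]

theorem inner_sharp_of_linear (g : RiemMetric m M) (p : M) {α : TangentSpace (𝓡 m) p → ℝ}
    (hα : IsLinearMap ℝ α) (w : TangentSpace (𝓡 m) p) : g.inner p (sharp g p α) w = α w := by
  have : FiniteDimensional ℝ (TangentSpace (𝓡 m) p) :=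
    inferInstanceAs (FiniteDimensional ℝ (Euc m))
  have : T2Space (TangentSpace (𝓡 m) p) := inferInstanceAs (T2Space (Euc m))
  exact inner_sharp g p (LinearMap.toContinuousLinearMap (hα.mk' α)) w

end Sharp

/-! ### Invariants of tensor fields on a surface, in a chart frame. -/

section SurfaceTensors

variable {M : Type*} [TopologicalSpace M]
  [ChartedSpace (EuclideanSpace ℝ (Fin 2)) M] [IsManifold (𝓡 2) ∞ M]

variable {g : RiemMetric 2 M} {x p : M} {e₁ e₂ : Euc 2 → Euc 2}
  {T : Π q : M, TangentSpace (𝓡 2) q → TangentSpace (𝓡 2) q}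

/-- An orthonormal frame over the domain of the preferred chart at `x`, whose area form is the
Riemannian density. -/
structure IsChartFrame (g : RiemMetric 2 M) (x : M) (e₁ e₂ : Euc 2 → Euc 2) : Prop where
  frame : IsFrame (coordMetric g x) (chart 2 x).target e₁ e₂
  area_eq : ∀ z ∈ (chart 2 x).target, IsFrame.area (coordMetric g x) e₁ e₂ z
    (EuclideanSpace.single 0 (1 : ℝ)) (EuclideanSpace.single 1 (1 : ℝ)) = density g x z
  density_pos : ∀ z ∈ (chart 2 x).target, 0 < density g x z

theorem exists_isChartFrame (g : RiemMetric 2 M) (x : M) :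
    ∃ e₁ e₂ : Euc 2 → Euc 2, IsChartFrame g x e₁ e₂ := by
  obtain ⟨e₁, e₂, F, hF⟩ := exists_isFrame (chart 2 x).open_target
    (fun z hz => isMetricAt_coordMetric g hz) (b₁ := EuclideanSpace.single 0 (1 : ℝ))
    (b₂ := EuclideanSpace.single 1 (1 : ℝ))
    (fun h => by simpa using congrArg (fun v : Euc 2 => v 0) h)
    (fun r h => by simpa using congrArg (fun v : Euc 2 => v 1) h)
    (fun v => ⟨v 0, v 1, by ext i; fin_cases i <;> simp⟩)
  have hd : ∀ z ∈ (chart 2 x).target, IsFrame.area (coordMetric g x) e₁ e₂ z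
      (EuclideanSpace.single 0 (1 : ℝ)) (EuclideanSpace.single 1 (1 : ℝ)) = density g x z := by
    intro z hz
    rw [(hF z hz).1, density, Matrix.det_fin_two]
    rfl
  exact ⟨e₁, e₂, F, hd, fun z hz => hd z hz ▸ (hF z hz).2⟩

namespace IsChartFrame

theorem mem (hx : p ∈ (chart 2 x).source) : chart 2 x p ∈ (chart 2 x).target :=
  (chart 2 x).map_source hx

theorem trace_eq (F : IsChartFrame g x e₁ e₂) (hx : p ∈ (chart 2 x).source) {V : Type*}
    [AddCommGroup V] [Module ℝ V] {b : TangentSpace (𝓡 2) p → TangentSpace (𝓡 2) p → V}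
    (hb : IsBilin b) :
    trace g p b = b (ofCoord x p (e₁ (chart 2 x p))) (ofCoord x p (e₁ (chart 2 x p))) +
      b (ofCoord x p (e₂ (chart 2 x p))) (ofCoord x p (e₂ (chart 2 x p))) := by
  rw [trace_eq_sum g p hb ![ofCoord x p (e₁ (chart 2 x p)), ofCoord x p (e₂ (chart 2 x p))]]
  · simp [Fin.sum_univ_two]
  · have h1 := F.frame.norm₁ _ (mem hx)
    have h2 := F.frame.norm₂ _ (mem hx)
    have h3 := F.frame.orth _ (mem hx)
    have h4 := F.frame.orth' (mem hx)
    intro i j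
    rw [inner_eq_coordMetric g hx]
    fin_cases i <;> fin_cases j <;> simp [toCoord_ofCoord hx, h1, h2, h3, h4]

theorem isSymmTensorOn (g : RiemMetric 2 M) (x : M) (hT : IsSmoothTensor T)
    (hs : ∀ p v w, g.inner p (T p v) w = g.inner p (T p w) v) :
    IsSymmTensorOn (coordMetric g x) (chart 2 x).target (tensorCoord x T) := by
  refine ⟨hT.smooth x, fun z hz u v => ?_⟩
  have hx := (chart 2 x).map_target hz
  have h := hs _ (ofCoord x ((chart 2 x).symm z) u) (ofCoord x ((chart 2 x).symm z) v)
  rw [inner_eq_coordMetric g hx, inner_eq_coordMetric g hx, tensorCoord_toCoord hT.linear hx,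
    tensorCoord_toCoord hT.linear hx, toCoord_ofCoord hx, toCoord_ofCoord hx,
    (chart 2 x).right_inv hz] at h
  exact h

theorem isBilin_inner_comp (g : RiemMetric 2 M) (p : M)
    {A B : TangentSpace (𝓡 2) p → TangentSpace (𝓡 2) p} (hA : IsLinearMap ℝ A)
    (hB : IsLinearMap ℝ B) : IsBilin fun v w => g.inner p (A v) (B w) := by
  constructor <;> intros <;>
  simp only [hA.map_add, hB.map_add, hA.map_smul, hB.map_smul, map_add, map_smul, add_apply,
    smul_apply]

theorem normSqTensor_eq (F : IsChartFrame g x e₁ e₂) (hx : p ∈ (chart 2 x).source)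
    (hT : IsSmoothTensor T) (hs : ∀ p v w, g.inner p (T p v) w = g.inner p (T p w) v) :
    normSqTensor g T p =
      IsFrame.frameNormSq (coordMetric g x) (tensorCoord x T) e₁ e₂ (chart 2 x p) := by
  have hz := mem hx
  rw [normSqTensor, F.trace_eq hx (isBilin_inner_comp g p (hT.linear p) (hT.linear p))]
  simp only [inner_eq_coordMetric g hx, tensorCoord_toCoord hT.linear hx, toCoord_ofCoord hx]
  rw [F.frame.apply₁ hz, F.frame.apply₂ (isSymmTensorOn g x hT hs) hz]
  simp only [map_add, map_smul, add_apply, smul_apply, smul_eq_mul, F.frame.norm₁ _ hz,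
    F.frame.norm₂ _ hz, F.frame.orth _ hz, F.frame.orth' hz, IsFrame.frameNormSq]
  ring

theorem trace_tensor_eq (F : IsChartFrame g x e₁ e₂) (hx : p ∈ (chart 2 x).source)
    (hT : IsSmoothTensor T) :
    (trace g p fun v w => g.inner p (T p v) w) =
      comp (coordMetric g x) (tensorCoord x T) e₁ e₁ (chart 2 x p) +
      comp (coordMetric g x) (tensorCoord x T) e₂ e₂ (chart 2 x p) := by
  rw [F.trace_eq hx (b := fun v w => g.inner p (T p v) w)
    (isBilin_inner_comp g p (hT.linear p) (B := id) ⟨fun _ _ => rfl, fun _ _ => rfl⟩)]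
  simp only [inner_eq_coordMetric g hx, tensorCoord_toCoord hT.linear hx, toCoord_ofCoord hx]
  rfl

theorem normSqNablaTensor_eq (F : IsChartFrame g x e₁ e₂) (hx : p ∈ (chart 2 x).source)
    (hT : IsSmoothTensor T) (hs : ∀ p v w, g.inner p (T p v) w = g.inner p (T p w) v) :
    normSqNablaTensor g T p =
      IsFrame.frameNormSqNabla (coordMetric g x) (tensorCoord x T) e₁ e₂ (chart 2 x p) := by
  have hz := mem hx
  have hT' := isSymmTensorOn g x hT hs
  have hb := isBilin_nablaTensor g hT p
  have hl : ∀ u, IsLinearMap ℝ (nablaTensor g T p u) := fun u =>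
    ⟨hb.add_right u, fun r => hb.smul_right r u⟩
  have h1 : ∀ u u', (trace g p fun v v' => g.inner p (nablaTensor g T p u v)
      (nablaTensor g T p u' v')) = _ := fun u u' =>
    F.trace_eq hx (isBilin_inner_comp g p (hl u) (hl u'))
  unfold normSqNablaTensor
  simp only [h1]
  rw [F.trace_eq hx (by
    constructor <;> intros <;>
    simp only [hb.add_left, hb.smul_left, map_add, map_smul, add_apply, smul_apply, smul_add] <;>
    abel)]
  simp only [inner_eq_coordMetric g hx, toCoord_nablaTensor g hT hx, toCoord_ofCoord hx,
    F.frame.flatNabla₁ hT' hz, F.frame.flatNabla₂ hT' hz]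
  simp only [map_add, map_smul, add_apply, smul_apply, smul_eq_mul, F.frame.norm₁ _ hz,
    F.frame.norm₂ _ hz, F.frame.orth _ hz, F.frame.orth' hz, IsFrame.frameNormSqNabla]
  ring

theorem divTensor_eq_zero (F : IsChartFrame g x e₁ e₂) (hx : p ∈ (chart 2 x).source)
    (hT : IsSmoothTensor T) (hs : ∀ p v w, g.inner p (T p v) w = g.inner p (T p w) v)
    (hd : divTensor g T p = 0) :
    nab₁₁ (coordMetric g x) (tensorCoord x T) e₁ e₂ (chart 2 x p) (e₁ (chart 2 x p)) +
      nab₁₂ (coordMetric g x) (tensorCoord x T) e₁ e₂ (chart 2 x p) (e₂ (chart 2 x p)) = 0 ∧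
    nab₁₂ (coordMetric g x) (tensorCoord x T) e₁ e₂ (chart 2 x p) (e₁ (chart 2 x p)) +
      nab₂₂ (coordMetric g x) (tensorCoord x T) e₁ e₂ (chart 2 x p) (e₂ (chart 2 x p)) = 0 := by
  have hz := mem hx
  have hT' := isSymmTensorOn g x hT hs
  have h := congrArg (toCoord x p) hd
  rw [divTensor, F.trace_eq hx (b := fun u v => nablaTensor g T p u v) (isBilin_nablaTensor g hT p),
    map_add, map_zero] at h
  simp only [toCoord_nablaTensor g hT hx, toCoord_ofCoord hx,
    F.frame.flatNabla₁ hT' hz, F.frame.flatNabla₂ hT' hz] at h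
  have k1 := congrArg (fun v => coordMetric g x (chart 2 x p) v (e₁ (chart 2 x p))) h
  have k2 := congrArg (fun v => coordMetric g x (chart 2 x p) v (e₂ (chart 2 x p))) h
  simp only [map_add, map_smul, map_zero, add_apply, smul_apply, zero_apply, smul_eq_mul,
    F.frame.norm₁ _ hz, F.frame.norm₂ _ hz, F.frame.orth _ hz, F.frame.orth' hz] at k1 k2
  constructor <;> linarith

/-- By `inner_flatCurv` the defining quotient does not depend on the basis, so the coordinate basis
at `p` may be used with a frame from the chart at `x`. -/
theorem gaussCurvature_eq (F : IsChartFrame g x e₁ e₂) (hx : p ∈ (chart 2 x).source) :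
    gaussCurvature g p = -IsFrame.dConn (coordMetric g x) e₁ e₂ (chart 2 x p)
      (e₁ (chart 2 x p)) (e₂ (chart 2 x p)) := by
  have h := isUnit_iff_ne_zero.1 (isUnit_det_gram g p)
  have h2 : (gram g p (basisVec p)).det =
      coordMetric g x (chart 2 x p) (toCoord x p (basisVec p 0)) (toCoord x p (basisVec p 0)) *
      coordMetric g x (chart 2 x p) (toCoord x p (basisVec p 1)) (toCoord x p (basisVec p 1)) -
      coordMetric g x (chart 2 x p) (toCoord x p (basisVec p 0)) (toCoord x p (basisVec p 1)) *
      coordMetric g x (chart 2 x p) (toCoord x p (basisVec p 1)) (toCoord x p (basisVec p 0)) := by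
    rw [Matrix.det_fin_two]
    simp only [gram, Matrix.of_apply, inner_eq_coordMetric g hx]
  rw [gaussCurvature, div_eq_iff h, inner_eq_coordMetric g hx, toCoord_curvature g hx,
    F.frame.inner_flatCurv (mem hx), h2]

theorem normSq_grad_eq (F : IsChartFrame g x e₁ e₂) (hx : p ∈ (chart 2 x).source) {t : M → ℝ}
    (ht : DifferentiableAt ℝ (t ∘ (chart 2 x).symm) (chart 2 x p)) :
    g.inner p (grad g t p) (grad g t p) =
      fderiv ℝ (t ∘ (chart 2 x).symm) (chart 2 x p) (e₁ (chart 2 x p)) ^ 2 +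
      fderiv ℝ (t ∘ (chart 2 x).symm) (chart 2 x p) (e₂ (chart 2 x p)) ^ 2 := by
  have h : ∀ a, coordMetric g x (chart 2 x p) (toCoord x p (grad g t p)) a =
      fderiv ℝ (t ∘ (chart 2 x).symm) (chart 2 x p) a := by
    intro a
    have h1 := inner_sharp g p (mvfderiv (𝓡 2) t p) (ofCoord x p a)
    rw [mvfderiv_eq_fderiv hx ht, inner_eq_coordMetric g hx, toCoord_ofCoord hx] at h1
    exact h1
  rw [inner_eq_coordMetric g hx, F.frame.inner_eq (mem hx)]
  simp only [h]
  ring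

end IsChartFrame

/-- The vector field `∑ ⟨(∇_k T) ·, T e_k⟩`. -/
def fluxField (g : RiemMetric 2 M) (T : Π q : M, TangentSpace (𝓡 2) q → TangentSpace (𝓡 2) q)
    (p : M) : TangentSpace (𝓡 2) p :=
  sharp g p fun w => trace g p fun u u' => g.inner p (nablaTensor g T p u w) (T p u')

namespace IsChartFrame

/-- This says that η is the contraction of the area form with the globally defined X. The frame
itself is only local, and this is what lets its form η serve the divergence theorem on M. -/
theorem toCoord_fluxField (F : IsChartFrame g x e₁ e₂) (hx : p ∈ (chart 2 x).source)
    (hT : IsSmoothTensor T) (hs : ∀ p v w, g.inner p (T p v) w = g.inner p (T p w) v)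
    (hd : divTensor g T p = 0) :
    toCoord x p (fluxField g T p) =
      IsFrame.fluxForm (coordMetric g x) (tensorCoord x T) e₁ e₂ (chart 2 x p) (e₂ (chart 2 x p)) •
        e₁ (chart 2 x p) -
      IsFrame.fluxForm (coordMetric g x) (tensorCoord x T) e₁ e₂ (chart 2 x p) (e₁ (chart 2 x p)) •
        e₂ (chart 2 x p) := by
  have hz := mem hx
  have hT' := isSymmTensorOn g x hT hs
  have hb := isBilin_nablaTensor g hT p
  have hl : ∀ w, IsLinearMap ℝ fun u => nablaTensor g T p u w := fun w =>
    ⟨fun u v => hb.add_left u v w, fun r u => hb.smul_left r u w⟩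
  obtain ⟨hd₁, hd₂⟩ := F.divTensor_eq_zero hx hT hs hd
  obtain ⟨k₁, k₂⟩ := IsFrame.fluxForm_apply hd₁ hd₂
  have h1 : ∀ w, (trace g p fun u u' => g.inner p (nablaTensor g T p u w) (T p u')) = _ := fun w =>
    F.trace_eq hx (isBilin_inner_comp g p (hl w) (hT.linear p))
  have hα : IsLinearMap ℝ fun w => trace g p fun u u' =>
      g.inner p (nablaTensor g T p u w) (T p u') := by
    refine ⟨fun v w => ?_, fun r v => ?_⟩
    · rw [h1, h1, h1]
      simp only [hb.add_right, map_add, add_apply]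
      ring
    · rw [h1, h1]
      simp only [hb.smul_right, map_smul, smul_apply, smul_eq_mul]
      ring
  have h2 : ∀ a, coordMetric g x (chart 2 x p) (toCoord x p (fluxField g T p)) a =
      trace g p fun u u' => g.inner p (nablaTensor g T p u (ofCoord x p a)) (T p u') := by
    intro a
    have h3 := inner_sharp_of_linear g p hα (ofCoord x p a)
    rw [inner_eq_coordMetric g hx, toCoord_ofCoord hx] at h3
    exact h3
  rw [F.frame.span _ hz (toCoord x p (fluxField g T p)), h2, h2, h1, h1]
  simp only [inner_eq_coordMetric g hx, toCoord_nablaTensor g hT hx, toCoord_ofCoord hx,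
    tensorCoord_toCoord hT.linear hx, F.frame.flatNabla₁ hT' hz, F.frame.flatNabla₂ hT' hz,
    F.frame.apply₁ hz, F.frame.apply₂ hT' hz]
  simp only [map_add, map_smul, add_apply, smul_apply, smul_eq_mul, F.frame.norm₁ _ hz,
    F.frame.norm₂ _ hz, F.frame.orth _ hz, F.frame.orth' hz]
  rw [sub_eq_add_neg, ← neg_smul, k₁, k₂]
  congr 2 <;> ring

end IsChartFrame

end SurfaceTensors

/-! ### Passing from the frame to coordinate vectors. -/

section AreaForm

variable {E : Type*} [NormedAddCommGroup E] [NormedSpace ℝ E] [FiniteDimensional ℝ E]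
  {G : E → E →L[ℝ] E →L[ℝ] ℝ} {U : Set E} {e₁ e₂ : E → E} {z : E}

/-- With u = ∂₁ and v = ∂₂ it removes the frame vectors from density · X, leaving η(∂₂) ∂₁ - η(∂₁)
∂₂, whose directions are constant. -/
theorem IsFrame.area_smul (F : IsFrame G U e₁ e₂) (hz : z ∈ U) (θ : E →L[ℝ] ℝ) (u v : E) :
    IsFrame.area G e₁ e₂ z u v • (θ (e₂ z) • e₁ z - θ (e₁ z) • e₂ z) = θ v • u - θ u • v := by
  have hu := F.span z hz u
  have hv := F.span z hz v
  unfold IsFrame.area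
  generalize G z u (e₁ z) = a at *
  generalize G z u (e₂ z) = b at *
  generalize G z v (e₁ z) = c at *
  generalize G z v (e₂ z) = d at *
  rw [hu, hv, map_add, map_add, map_smul, map_smul, map_smul, map_smul]
  simp only [smul_eq_mul]
  module

end AreaForm

/-! ### The integrated Weitzenböck formula for divergence-free symmetric tensors. -/

section Weitzenboeck

variable {M : Type*} [TopologicalSpace M]
  [ChartedSpace (EuclideanSpace ℝ (Fin 2)) M] [IsManifold (𝓡 2) ∞ M]

variable {g : RiemMetric 2 M} {T : Π q : M, TangentSpace (𝓡 2) q → TangentSpace (𝓡 2) q}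
  {t : M → ℝ}

theorem continuous_of_chart {f : M → ℝ} (h : ∀ x : M, ∃ k : Euc 2 → ℝ,
    ContinuousOn k (chart 2 x).target ∧ ∀ z ∈ (chart 2 x).target, f ((chart 2 x).symm z) = k z) :
    Continuous f := by
  refine continuous_iff_continuousAt.2 fun x => ?_
  have hx := mem_chart_source (Euc 2) x
  obtain ⟨k, hk, hfk⟩ := h x
  refine ((hk.continuousAt ((chart 2 x).open_target.mem_nhds ((chart 2 x).map_source hx))).comp
    ((chart 2 x).continuousAt hx)).congr ?_
  filter_upwards [(chart 2 x).open_source.mem_nhds hx] with q hq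
  have := hfk _ ((chart 2 x).map_source hq)
  rw [(chart 2 x).left_inv hq] at this
  exact this.symm

theorem continuous_normSq_grad (g : RiemMetric 2 M)
    (ht : ∀ x : M, ContDiffOn ℝ ∞ (t ∘ (chart 2 x).symm) (chart 2 x).target) :
    Continuous fun p => g.inner p (grad g t p) (grad g t p) := by
  refine continuous_of_chart fun x => ?_
  obtain ⟨e₁, e₂, F⟩ := exists_isChartFrame g x
  have hd := (ht x).continuousOn_fderiv_of_isOpen (chart 2 x).open_target (by simp)
  refine ⟨_, ((hd.clm_apply F.frame.smooth₁.continuousOn).pow 2).add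
    ((hd.clm_apply F.frame.smooth₂.continuousOn).pow 2), fun z hz => ?_⟩
  have hz' := (chart 2 x).right_inv hz
  rw [F.normSq_grad_eq ((chart 2 x).map_target hz), hz']
  · rfl
  · rw [hz']
    exact ((ht x).contDiffAt ((chart 2 x).open_target.mem_nhds hz)).differentiableAt (by simp)

theorem trace_comp_symm {x : M} {e₁ e₂ : Euc 2 → Euc 2} (F : IsChartFrame g x e₁ e₂)
    (hT : IsSmoothTensor T) (ht : ∀ p, t p = trace g p fun v w => g.inner p (T p v) w) {z : Euc 2}
    (hz : z ∈ (chart 2 x).target) :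
    (t ∘ (chart 2 x).symm) z = comp (coordMetric g x) (tensorCoord x T) e₁ e₁ z +
      comp (coordMetric g x) (tensorCoord x T) e₂ e₂ z := by
  rw [Function.comp_apply, ht, F.trace_tensor_eq ((chart 2 x).map_target hz) hT,
    (chart 2 x).right_inv hz]

theorem contDiffOn_trace (hT : IsSmoothTensor T)
    (ht : ∀ p, t p = trace g p fun v w => g.inner p (T p v) w) (x : M) :
    ContDiffOn ℝ ∞ (t ∘ (chart 2 x).symm) (chart 2 x).target := by
  obtain ⟨e₁, e₂, F⟩ := exists_isChartFrame g x
  refine ContDiffOn.congr (fun z hz => ContDiffAt.contDiffWithinAt ?_)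
    fun z hz => trace_comp_symm F hT ht hz
  exact (F.frame.contDiffAt_comp (hT.smooth x) hz F.frame.smooth₁ F.frame.smooth₁).add
    (F.frame.contDiffAt_comp (hT.smooth x) hz F.frame.smooth₂ F.frame.smooth₂)

variable (hT : IsSmoothTensor T) (hs : ∀ p v w, g.inner p (T p v) w = g.inner p (T p w) v)
  (hd : ∀ p, divTensor g T p = 0) (ht : ∀ p, t p = trace g p fun v w => g.inner p (T p v) w)

include hT hs hd ht

theorem fderiv_fluxForm_chart {x : M} {e₁ e₂ : Euc 2 → Euc 2} (F : IsChartFrame g x e₁ e₂)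
    {z : Euc 2} (hz : z ∈ (chart 2 x).target) (u v : Euc 2) :
    fderiv ℝ (IsFrame.fluxForm (coordMetric g x) (tensorCoord x T) e₁ e₂) z u v -
      fderiv ℝ (IsFrame.fluxForm (coordMetric g x) (tensorCoord x T) e₁ e₂) z v u =
    (normSqNablaTensor g T ((chart 2 x).symm z) + 2 * gaussCurvature g ((chart 2 x).symm z) *
      (normSqTensor g T ((chart 2 x).symm z) - t ((chart 2 x).symm z) ^ 2 / 2) -
      g.inner _ (grad g t ((chart 2 x).symm z)) (grad g t ((chart 2 x).symm z))) *
    IsFrame.area (coordMetric g x) e₁ e₂ z u v := by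
  have hx := (chart 2 x).map_target hz
  have hz' := (chart 2 x).right_inv hz
  have hnhds := (chart 2 x).open_target.mem_nhds hz
  obtain ⟨hd₁, hd₂⟩ := F.divTensor_eq_zero hx hT hs (hd _)
  rw [hz'] at hd₁ hd₂
  rw [F.frame.fderiv_fluxForm (IsChartFrame.isSymmTensorOn g x hT hs) hz hd₁ hd₂,
    F.normSqNablaTensor_eq hx hT hs, F.gaussCurvature_eq hx, F.normSqTensor_eq hx hT hs,
    F.normSq_grad_eq hx (by
      rw [hz']
      exact ((contDiffOn_trace hT ht x).contDiffAt hnhds).differentiableAt (by simp)), hz']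
  have h1 : t ((chart 2 x).symm z) = _ := trace_comp_symm F hT ht hz
  have h2 : t ∘ (chart 2 x).symm =ᶠ[𝓝 z] fun z =>
      comp (coordMetric g x) (tensorCoord x T) e₁ e₁ z +
      comp (coordMetric g x) (tensorCoord x T) e₂ e₂ z := by
    filter_upwards [hnhds] with w hw using trace_comp_symm F hT ht hw
  have h3 := h2.fderiv_eq (𝕜 := ℝ)
  rw [fderiv_fun_add
    ((F.frame.contDiffAt_comp (hT.smooth x) hz F.frame.smooth₁ F.frame.smooth₁).differentiableAt
      (by simp))
    ((F.frame.contDiffAt_comp (hT.smooth x) hz F.frame.smooth₂ F.frame.smooth₂).differentiableAt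
      (by simp))] at h3
  rw [h1, h3]
  rfl

theorem density_smul_fluxField {x : M} {e₁ e₂ : Euc 2 → Euc 2} (F : IsChartFrame g x e₁ e₂)
    {z : Euc 2} (hz : z ∈ (chart 2 x).target) :
    density g x z • fieldCoord x (fluxField g T) z =
      IsFrame.fluxForm (coordMetric g x) (tensorCoord x T) e₁ e₂ z
        (EuclideanSpace.single 1 (1 : ℝ)) • EuclideanSpace.single 0 (1 : ℝ) -
      IsFrame.fluxForm (coordMetric g x) (tensorCoord x T) e₁ e₂ z
        (EuclideanSpace.single 0 (1 : ℝ)) • EuclideanSpace.single 1 (1 : ℝ) := by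
  rw [fieldCoord, F.toCoord_fluxField ((chart 2 x).map_target hz) hT hs (hd _),
    (chart 2 x).right_inv hz, ← F.area_eq z hz, F.frame.area_smul hz]

/-- The summands need no separate treatment: in a chart the whole expression is dη(∂₁, ∂₂) divided
by the density, with η smooth and the density positive. -/
theorem continuous_weitzenboeck :
    Continuous fun p => normSqNablaTensor g T p + 2 * gaussCurvature g p *
      (normSqTensor g T p - t p ^ 2 / 2) - g.inner p (grad g t p) (grad g t p) := by
  refine continuous_of_chart fun x => ?_
  obtain ⟨e₁, e₂, F⟩ := exists_isChartFrame g x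
  have hη : ContDiffOn ℝ ∞ (IsFrame.fluxForm (coordMetric g x) (tensorCoord x T) e₁ e₂)
      (chart 2 x).target := fun z hz =>
    (F.frame.contDiffAt_fluxForm (IsChartFrame.isSymmTensorOn g x hT hs) hz).contDiffWithinAt
  have hη' := hη.continuousOn_fderiv_of_isOpen (chart 2 x).open_target (by simp)
  refine ⟨fun z => (fderiv ℝ (IsFrame.fluxForm (coordMetric g x) (tensorCoord x T) e₁ e₂) z
      (EuclideanSpace.single 0 (1 : ℝ)) (EuclideanSpace.single 1 (1 : ℝ)) -
      fderiv ℝ (IsFrame.fluxForm (coordMetric g x) (tensorCoord x T) e₁ e₂) z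
      (EuclideanSpace.single 1 (1 : ℝ)) (EuclideanSpace.single 0 (1 : ℝ))) / density g x z,
    ContinuousOn.div (((hη'.clm_apply continuousOn_const).clm_apply continuousOn_const).sub
      ((hη'.clm_apply continuousOn_const).clm_apply continuousOn_const))
      (continuousOn_density g x) fun z hz => (F.density_pos z hz).ne', fun z hz => ?_⟩
  rw [eq_div_iff (F.density_pos z hz).ne', fderiv_fluxForm_chart hT hs hd ht F hz, F.area_eq z hz]

theorem integral_weitzenboeck [T2Space M] [CompactSpace M] [MeasurableSpace M] [BorelSpace M] :
    ∫ p, (normSqNablaTensor g T p + 2 * gaussCurvature g p *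
      (normSqTensor g T p - t p ^ 2 / 2) - g.inner p (grad g t p) (grad g t p))
      ∂(riemannianVolume g) = 0 := by
  have hη : ∀ {x e₁ e₂}, IsChartFrame g x e₁ e₂ →
      ContDiffOn ℝ ∞ (IsFrame.fluxForm (coordMetric g x) (tensorCoord x T) e₁ e₂)
      (chart 2 x).target := fun F z hz =>
    (F.frame.contDiffAt_fluxForm (IsChartFrame.isSymmTensorOn g _ hT hs) hz).contDiffWithinAt
  refine integral_divergence_eq_zero g (X := fluxField g T) (continuous_weitzenboeck hT hs hd ht)
    (fun x => ?_) (fun x => ?_) fun x z hz => ?_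
  · obtain ⟨e₁, e₂, F⟩ := exists_isChartFrame g x
    have h1 := (hη F).continuousOn
    have h2 := F.frame.smooth₁.continuousOn
    have h3 := F.frame.smooth₂.continuousOn
    refine ContinuousOn.congr (((h1.clm_apply h3).smul h2).sub ((h1.clm_apply h2).smul h3))
      fun z hz => ?_
    rw [fieldCoord, F.toCoord_fluxField ((chart 2 x).map_target hz) hT hs (hd _),
      (chart 2 x).right_inv hz]
    rfl
  · obtain ⟨e₁, e₂, F⟩ := exists_isChartFrame g x
    have h1 := (hη F).of_le (show (1 : WithTop ℕ∞) ≤ ∞ by simp)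
    exact (((h1.clm_apply contDiffOn_const).smul contDiffOn_const).sub
      ((h1.clm_apply contDiffOn_const).smul contDiffOn_const)).congr fun z hz =>
        density_smul_fluxField hT hs hd ht F hz
  · obtain ⟨e₁, e₂, F⟩ := exists_isChartFrame g x
    have hnhds := (chart 2 x).open_target.mem_nhds hz
    have h1 := (((hη F).contDiffAt hnhds).differentiableAt (by simp)).hasFDerivAt
    have h2 : (fun z => density g x z • fieldCoord x (fluxField g T) z) =ᶠ[𝓝 z] fun w =>
        IsFrame.fluxForm (coordMetric g x) (tensorCoord x T) e₁ e₂ w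
          (EuclideanSpace.single 1 (1 : ℝ)) • EuclideanSpace.single 0 (1 : ℝ) -
        IsFrame.fluxForm (coordMetric g x) (tensorCoord x T) e₁ e₂ w
          (EuclideanSpace.single 0 (1 : ℝ)) • EuclideanSpace.single 1 (1 : ℝ) := by
      filter_upwards [hnhds] with w hw using density_smul_fluxField hT hs hd ht F hw
    have h3 := ((h1.clm_apply (hasFDerivAt_const (EuclideanSpace.single 1 (1 : ℝ)) z)).smul_const
      (EuclideanSpace.single (0 : Fin 2) (1 : ℝ))).sub
      ((h1.clm_apply (hasFDerivAt_const (EuclideanSpace.single 0 (1 : ℝ)) z)).smul_const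
      (EuclideanSpace.single (1 : Fin 2) (1 : ℝ)))
    -- The Euclidean divergence of η(∂₂) ∂₁ - η(∂₁) ∂₂ is dη(∂₁, ∂₂).
    rw [(h3.congr_of_eventuallyEq h2).fderiv, Fin.sum_univ_two, mul_comm, ← F.area_eq z hz,
      ← fderiv_fluxForm_chart hT hs hd ht F hz]
    simp
    ring

end Weitzenboeck

/-! ### Isometric immersions between vector spaces with metrics. -/

section FlatImmersions

variable {E F : Type*} [NormedAddCommGroup E] [NormedSpace ℝ E] [FiniteDimensional ℝ E]
  [NormedAddCommGroup F] [NormedSpace ℝ F] [FiniteDimensional ℝ F]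

/-- The second fundamental form of a map between vector spaces with metrics `G` and `H`. -/
def flatSecond (G : E → E →L[ℝ] E →L[ℝ] ℝ) (H : F → F →L[ℝ] F →L[ℝ] ℝ) (f : E → F) (z a b : E) : F :=
  fderiv ℝ (fderiv ℝ f) z a b + christ H (f z) (fderiv ℝ f z a) (fderiv ℝ f z b) -
    fderiv ℝ f z (christ G z a b)

/-- A smooth isometric immersion near a point. -/
structure IsIsometryAt (G : E → E →L[ℝ] E →L[ℝ] ℝ) (H : F → F →L[ℝ] F →L[ℝ] ℝ) (f : E → F)
    (z : E) : Prop where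
  source : IsMetricAt G z
  target : IsMetricAt H (f z)
  smooth : ContDiffAt ℝ ∞ f z
  iso : ∀ᶠ w in 𝓝 z, ∀ a b, G w a b = H (f w) (fderiv ℝ f w a) (fderiv ℝ f w b)

namespace IsIsometryAt

variable {G : E → E →L[ℝ] E →L[ℝ] ℝ} {H : F → F →L[ℝ] F →L[ℝ] ℝ} {f : E → F} {z : E}

theorem flatSecond_symm (I : IsIsometryAt G H f z) (a b : E) :
    flatSecond G H f z a b = flatSecond G H f z b a := by
  have h := (I.smooth.isSymmSndFDerivAt (by
    simp only [minSmoothness_of_isRCLikeNormedField]; exact two_le_infty)).eq a b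
  unfold flatSecond
  rw [h, I.target.christ_symm, I.source.christ_symm]

/-- The Gauss formula: `christ_pullback` says that the tangential part of the first two terms of
`flatSecond` is the third. -/
theorem flatSecond_normal (I : IsIsometryAt G H f z) (a b c : E) :
    H (f z) (flatSecond G H f z a b) (fderiv ℝ f z c) = 0 := by
  unfold flatSecond
  rw [map_sub, sub_apply, christ_pullback I.source I.target I.smooth I.iso,
    ← I.iso.self_of_nhds, sub_self]

theorem contDiffAt_fderiv (I : IsIsometryAt G H f z) : ContDiffAt ℝ ∞ (fderiv ℝ f) z :=
  I.smooth.fderiv_right (by simp)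

theorem contDiffAt_flatSecond (I : IsIsometryAt G H f z) {X Y : E → E} (hX : ContDiffAt ℝ ∞ X z)
    (hY : ContDiffAt ℝ ∞ Y z) : ContDiffAt ℝ ∞ (fun w => flatSecond G H f w (X w) (Y w)) z := by
  have h2 : ContDiffAt ℝ ∞ (fderiv ℝ (fderiv ℝ f)) z := I.contDiffAt_fderiv.fderiv_right (by simp)
  have hH : ContDiffAt ℝ ∞ (fun w => christ H (f w)) z :=
    (contDiffAt_christ I.target.isInner I.target.smooth).comp z I.smooth
  have hG := contDiffAt_christ I.source.isInner I.source.smooth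
  exact (((h2.clm_apply hX).clm_apply hY).add ((hH.clm_apply (I.contDiffAt_fderiv.clm_apply
    hX)).clm_apply (I.contDiffAt_fderiv.clm_apply hY))).sub
    (I.contDiffAt_fderiv.clm_apply ((hG.clm_apply hX).clm_apply hY))

/-- The tangential part of the derivative of a normal field. -/
theorem weingarten (I : IsIsometryAt G H f z) {ν : E → F} (hν : DifferentiableAt ℝ ν z)
    (hn : ∀ᶠ w in 𝓝 z, ∀ b, H (f w) (ν w) (fderiv ℝ f w b) = 0) (a b : E) :
    H (f z) (fderiv ℝ f z b) (fderiv ℝ ν z a + christ H (f z) (fderiv ℝ f z a) (ν z)) =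
      -H (f z) (flatSecond G H f z a b) (ν z) := by
  have hf : HasFDerivAt f (fderiv ℝ f z) z := (I.smooth.differentiableAt (by simp)).hasFDerivAt
  have hf2 : HasFDerivAt (fderiv ℝ f) (fderiv ℝ (fderiv ℝ f) z) z :=
    (I.contDiffAt_fderiv.differentiableAt (by simp)).hasFDerivAt
  have h1 := ((I.target.differentiableAt.hasFDerivAt.comp z hf).clm_apply hν.hasFDerivAt).clm_apply
    (hf2.clm_apply (hasFDerivAt_const b z))
  have h2 := h1.unique ((hasFDerivAt_const (0 : ℝ) z).congr_of_eventuallyEq (by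
    filter_upwards [hn] with w hw using hw b))
  have h3 := congrArg (fun L : E →L[ℝ] ℝ => L a) h2
  simp at h3
  have hs := I.target.isInner.symm
  -- Normality of ν removes the tangential term of the second fundamental form.
  have h4 := hn.self_of_nhds (christ G z a b)
  rw [I.target.compat] at h3
  unfold flatSecond
  rw [hs (fderiv ℝ f z b), hs _ (ν z)]
  simp only [map_add, map_sub, add_apply] at h3 h4 ⊢
  linarith

end IsIsometryAt

end FlatImmersions

/-! ### The second fundamental form in arbitrary charts. -/

section Immersions

variable {m n : ℕ} {M N : Type*}
  [TopologicalSpace M] [ChartedSpace (EuclideanSpace ℝ (Fin m)) M] [IsManifold (𝓡 m) ∞ M]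
  [TopologicalSpace N] [ChartedSpace (EuclideanSpace ℝ (Fin n)) N] [IsManifold (𝓡 n) ∞ N]
  {g : RiemMetric m M} {h : RiemMetric n N} {φ : M → N} {x p : M} {y : N}

theorem inCharts_chart (φ : M → N) (hx : p ∈ (chart m x).source) (y : N) :
    inCharts φ x y (chart m x p) = chart n y (φ p) := by
  simp [inCharts, (chart m x).left_inv hx]

theorem isIsometryAt_inCharts (hφ : IsRiemannianImmersion g h φ) (hx : p ∈ (chart m x).source)
    (hy : φ p ∈ (chart n y).source) :
    IsIsometryAt (coordMetric g x) (coordMetric h y) (inCharts φ x y) (chart m x p) where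
  source := isMetricAt_coordMetric g ((chart m x).map_source hx)
  target := by
    rw [inCharts_chart φ hx y]
    exact isMetricAt_coordMetric h ((chart n y).map_source hy)
  smooth := contDiffAt_inCharts hφ.1 hx hy
  iso := by
    filter_upwards [eventually_mem_source hx hx,
      eventually_map_mem_source hφ.1.continuous hx hy] with z ⟨_, h1, _, h3⟩ h4 a b
    rw [coordMetric_apply, ← hφ.2, inner_eq_coordMetric h h4, toCoord_mfderiv hφ.1 h1 h4,
      toCoord_mfderiv hφ.1 h1 h4, toCoord_ofCoord h1, toCoord_ofCoord h1, h3]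
    rfl

/-- The derivative of the field extending `w` enters through ∇(dφ(W)) and through dφ(∇W), and
cancels. -/
theorem toCoord_secondFundamentalForm (hφ : IsRiemannianImmersion g h φ)
    (hx : p ∈ (chart m x).source) (hy : φ p ∈ (chart n y).source) (v w : TangentSpace (𝓡 m) p) :
    toCoord y (φ p) (secondFundamentalForm g h φ p v w) =
      flatSecond (coordMetric g x) (coordMetric h y) (inCharts φ x y) (chart m x p)
        (toCoord x p v) (toCoord x p w) := by
  have I := isIsometryAt_inCharts hφ hx hy
  have hself : coordField w p = w := FiberBundle.extend_apply_self _ w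
  have hW : HasFDerivAt (fieldCoord x (coordField w)) _ (chart m x p) :=
    ((contDiffAt_coordField hx w).differentiableAt (by simp)).hasFDerivAt
  have hf := (I.contDiffAt_fderiv.differentiableAt (by simp)).hasFDerivAt
  have hev : alongCoord φ x y (fun q => mfderiv (𝓡 m) (𝓡 n) φ q (coordField w q)) =ᶠ[𝓝 (chart m x p)]
      fun z => fderiv ℝ (inCharts φ x y) z (fieldCoord x (coordField w) z) := by
    filter_upwards [eventually_mem_source hx hx,
      eventually_map_mem_source hφ.1.continuous hx hy] with z ⟨_, h1, _, h3⟩ h4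
    rw [alongCoord, toCoord_mfderiv hφ.1 h1 h4, h3]
    rfl
  have hd := (hf.clm_apply hW).congr_of_eventuallyEq hev
  unfold secondFundamentalForm flatSecond
  rw [map_sub, toCoord_nablaAlong h hφ.1 hx hy hd.differentiableAt, hd.fderiv,
    toCoord_mfderiv hφ.1 hx hy, toCoord_mfderiv hφ.1 hx hy,
    toCoord_leviCivita g hx hW.differentiableAt, fieldCoord_chart hx, hself,
    inCharts_chart φ hx y, map_add]
  simp only [add_apply, ContinuousLinearMap.comp_apply, ContinuousLinearMap.flip_apply]
  abel

theorem isBilin_secondFundamentalForm (hφ : IsRiemannianImmersion g h φ) (p : M) :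
    IsBilin (secondFundamentalForm g h φ p) := by
  have hp := mem_chart_source (Euc m) p
  have hy := mem_chart_source (Euc n) (φ p)
  constructor <;> intros <;> refine toCoord_injective hy ?_ <;>
  simp only [toCoord_secondFundamentalForm hφ hp hy, map_add, map_smul, flatSecond, add_apply,
    smul_apply, smul_add, smul_sub] <;> abel

theorem secondFundamentalForm_symm (hφ : IsRiemannianImmersion g h φ) (p : M)
    (v w : TangentSpace (𝓡 m) p) :
    secondFundamentalForm g h φ p v w = secondFundamentalForm g h φ p w v := by
  have hp := mem_chart_source (Euc m) p
  have hy := mem_chart_source (Euc n) (φ p)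
  refine toCoord_injective hy ?_
  rw [toCoord_secondFundamentalForm hφ hp hy, toCoord_secondFundamentalForm hφ hp hy,
    (isIsometryAt_inCharts hφ hp hy).flatSecond_symm]

end Immersions

/-! ### Tension field, shape operator and stress-bienergy tensor. -/

section ImmersedSurfaces

variable {n : ℕ} {M N : Type*}
  [TopologicalSpace M] [ChartedSpace (EuclideanSpace ℝ (Fin 2)) M] [IsManifold (𝓡 2) ∞ M]
  [TopologicalSpace N] [ChartedSpace (EuclideanSpace ℝ (Fin n)) N] [IsManifold (𝓡 n) ∞ N]
  {g : RiemMetric 2 M} {h : RiemMetric n N} {φ : M → N} {x p : M} {y : N} {e₁ e₂ : Euc 2 → Euc 2}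

/-- The tension field in charts. -/
def flatTension (g : RiemMetric 2 M) (h : RiemMetric n N) (φ : M → N) (x : M) (y : N)
    (e₁ e₂ : Euc 2 → Euc 2) (z : Euc 2) : Euc n :=
  flatSecond (coordMetric g x) (coordMetric h y) (inCharts φ x y) z (e₁ z) (e₁ z) +
    flatSecond (coordMetric g x) (coordMetric h y) (inCharts φ x y) z (e₂ z) (e₂ z)

theorem toCoord_tension (F : IsChartFrame g x e₁ e₂) (hφ : IsRiemannianImmersion g h φ)
    (hx : p ∈ (chart 2 x).source) (hy : φ p ∈ (chart n y).source) :
    toCoord y (φ p) (tension g h φ p) = flatTension g h φ x y e₁ e₂ (chart 2 x p) := by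
  rw [tension, F.trace_eq hx (b := fun v w => secondFundamentalForm g h φ p v w)
    (isBilin_secondFundamentalForm hφ p), map_add, toCoord_secondFundamentalForm hφ hx hy,
    toCoord_secondFundamentalForm hφ hx hy, toCoord_ofCoord hx, toCoord_ofCoord hx]
  rfl

theorem contDiffAt_flatTension (F : IsChartFrame g x e₁ e₂) (hφ : IsRiemannianImmersion g h φ)
    (hx : p ∈ (chart 2 x).source) (hy : φ p ∈ (chart n y).source) :
    ContDiffAt ℝ ∞ (flatTension g h φ x y e₁ e₂) (chart 2 x p) := by
  have I := isIsometryAt_inCharts hφ hx hy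
  have hz := F.frame.mem_nhds ((chart 2 x).map_source hx)
  have h1 := F.frame.smooth₁.contDiffAt hz
  have h2 := F.frame.smooth₂.contDiffAt hz
  exact (I.contDiffAt_flatSecond h1 h1).add (I.contDiffAt_flatSecond h2 h2)

/-- The tension field is a sum of values of B, hence normal, so the Weingarten equation applies to
it. -/
theorem inner_mfderiv_nablaAlong_tension (hφ : IsRiemannianImmersion g h φ) (p : M)
    (v w : TangentSpace (𝓡 2) p) :
    h.inner (φ p) (mfderiv (𝓡 2) (𝓡 n) φ p v) (nablaAlong h φ (tension g h φ) p w) =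
      -h.inner (φ p) (secondFundamentalForm g h φ p v w) (tension g h φ p) := by
  have hx := mem_chart_source (Euc 2) p
  have hy := mem_chart_source (Euc n) (φ p)
  obtain ⟨e₁, e₂, F⟩ := exists_isChartFrame g p
  have hs := contDiffAt_flatTension F hφ hx hy
  have hev : alongCoord φ p (φ p) (tension g h φ) =ᶠ[𝓝 (chart 2 p p)]
      flatTension g h φ p (φ p) e₁ e₂ := by
    filter_upwards [eventually_mem_source hx hx,
      eventually_map_mem_source hφ.1.continuous hx hy] with z ⟨_, h1, _, h3⟩ h4
    rw [alongCoord, toCoord_tension F hφ h1 h4, h3]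
  have hd := (hs.differentiableAt (by simp)).congr_of_eventuallyEq hev
  have hn : ∀ᶠ z in 𝓝 (chart 2 p p), ∀ b, coordMetric h (φ p) (inCharts φ p (φ p) z)
      (flatTension g h φ p (φ p) e₁ e₂ z) (fderiv ℝ (inCharts φ p (φ p)) z b) = 0 := by
    filter_upwards [eventually_mem_source hx hx,
      eventually_map_mem_source hφ.1.continuous hx hy] with z ⟨_, h1, _, h3⟩ h4 b
    have I := isIsometryAt_inCharts hφ h1 h4
    rw [h3] at I
    rw [flatTension, map_add, add_apply, I.flatSecond_normal, I.flatSecond_normal, add_zero]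
  have I := isIsometryAt_inCharts hφ hx hy
  rw [inner_eq_coordMetric h hy, inner_eq_coordMetric h hy, toCoord_mfderiv hφ.1 hx hy,
    toCoord_nablaAlong h hφ.1 hx hy hd, hev.fderiv_eq, toCoord_tension F hφ hx hy,
    toCoord_secondFundamentalForm hφ hx hy, ← inCharts_chart φ hx (φ p), I.flatSecond_symm,
    I.weingarten (hs.differentiableAt (by simp)) hn]

/-- The shape operator in the direction of the tension field. -/
def tensionShape (g : RiemMetric 2 M) (h : RiemMetric n N) (φ : M → N) (p : M)
    (v : TangentSpace (𝓡 2) p) : TangentSpace (𝓡 2) p :=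
  sharp g p fun w => h.inner (φ p) (secondFundamentalForm g h φ p v w) (tension g h φ p)

theorem inner_tensionShape (hφ : IsRiemannianImmersion g h φ) (p : M)
    (v w : TangentSpace (𝓡 2) p) : g.inner p (tensionShape g h φ p v) w =
      h.inner (φ p) (secondFundamentalForm g h φ p v w) (tension g h φ p) := by
  have hb := isBilin_secondFundamentalForm hφ p
  refine inner_sharp_of_linear g p ⟨fun a b => ?_, fun r a => ?_⟩ w
  · rw [hb.add_right, map_add, add_apply]
  · rw [hb.smul_right, map_smul, smul_apply]

theorem isLinearMap_tensionShape (hφ : IsRiemannianImmersion g h φ) (p : M) :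
    IsLinearMap ℝ (tensionShape g h φ p) := by
  have hb := isBilin_secondFundamentalForm hφ p
  refine ⟨fun v w => inner_ext g fun u => ?_, fun r v => inner_ext g fun u => ?_⟩
  · rw [map_add, add_apply, inner_tensionShape hφ, inner_tensionShape hφ, inner_tensionShape hφ,
      hb.add_left, map_add, add_apply]
  · rw [map_smul, smul_apply, inner_tensionShape hφ, inner_tensionShape hφ, hb.smul_left, map_smul,
      smul_apply]

theorem tensionShape_symm (hφ : IsRiemannianImmersion g h φ) (p : M) (v w : TangentSpace (𝓡 2) p) :
    g.inner p (tensionShape g h φ p v) w = g.inner p (tensionShape g h φ p w) v := by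
  rw [inner_tensionShape hφ, inner_tensionShape hφ, secondFundamentalForm_symm hφ]

/-- In a frame the components are the functions ⟨B(a, e_k), τ⟩. Smoothness is local, so the chart of
N may be chosen anew around each image point. -/
theorem isSmoothTensor_tensionShape (hφ : IsRiemannianImmersion g h φ) :
    IsSmoothTensor (tensionShape g h φ) := by
  refine ⟨isLinearMap_tensionShape hφ, fun x => ?_⟩
  rw [contDiffOn_clm_apply]
  intro a z hz
  obtain ⟨e₁, e₂, F⟩ := exists_isChartFrame g x
  set p := (chart 2 x).symm z with hp
  have hx : p ∈ (chart 2 x).source := (chart 2 x).map_target hz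
  have hzp : chart 2 x p = z := (chart 2 x).right_inv hz
  have hy := mem_chart_source (Euc n) (φ p)
  have I := isIsometryAt_inCharts hφ hx hy
  have hτ := contDiffAt_flatTension F hφ hx hy
  have h1 := F.frame.smooth₁.contDiffAt (F.frame.mem_nhds hz)
  have h2 := F.frame.smooth₂.contDiffAt (F.frame.mem_nhds hz)
  have hH := I.target.smooth.comp _ I.smooth
  rw [hzp] at I hτ hH
  have key : ∀ {e : Euc 2 → Euc 2}, ContDiffAt ℝ ∞ e z → ContDiffAt ℝ ∞ (fun w =>
      coordMetric h (φ p) (inCharts φ x (φ p) w)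
        (flatSecond (coordMetric g x) (coordMetric h (φ p)) (inCharts φ x (φ p)) w a (e w))
        (flatTension g h φ x (φ p) e₁ e₂ w)) z := fun he =>
    (hH.clm_apply (I.contDiffAt_flatSecond contDiffAt_const he)).clm_apply hτ
  refine ContDiffAt.contDiffWithinAt
    ((((key h1).smul h1).add ((key h2).smul h2)).congr_of_eventuallyEq ?_)
  have e1 := eventually_mem_source hx hx
  have e2 := eventually_map_mem_source hφ.1.continuous hx hy
  rw [hzp] at e1 e2
  filter_upwards [e1, e2] with w ⟨k0, k1, _, k3⟩ k4
  have k5 : ∀ b, coordMetric g x w (toCoord x ((chart 2 x).symm w) (tensionShape g h φ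
      ((chart 2 x).symm w) (ofCoord x ((chart 2 x).symm w) a))) b =
      coordMetric h (φ p) (inCharts φ x (φ p) w)
        (flatSecond (coordMetric g x) (coordMetric h (φ p)) (inCharts φ x (φ p)) w a b)
        (flatTension g h φ x (φ p) e₁ e₂ w) := by
    intro b
    have k6 := inner_tensionShape (g := g) hφ _ (ofCoord x ((chart 2 x).symm w) a)
      (ofCoord x ((chart 2 x).symm w) b)
    rw [inner_eq_coordMetric g k1, inner_eq_coordMetric h k4, toCoord_tension F hφ k1 k4,
      toCoord_secondFundamentalForm hφ k1 k4, toCoord_ofCoord k1, toCoord_ofCoord k1,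
      ← inCharts_chart φ k1 (φ p), k3] at k6
    exact k6
  rw [tensorCoord_apply (isLinearMap_tensionShape hφ), F.frame.span w k0 (toCoord x _ _), k5, k5]
  rfl

theorem trace_tensionShape (hφ : IsRiemannianImmersion g h φ) (p : M) :
    normSqTension g h φ p = trace g p fun v w => g.inner p (tensionShape g h φ p v) w := by
  simp only [inner_tensionShape hφ]
  have key : ∀ ν, h.inner (φ p) (tension g h φ p) ν =
      trace g p fun v w => h.inner (φ p) (secondFundamentalForm g h φ p v w) ν := by
    intro ν
    simp only [tension, trace, map_sum, map_smul, sum_apply, smul_apply]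
  exact key _

theorem shapeOperatorH_eq (hφ : IsRiemannianImmersion g h φ) (p : M) (v : TangentSpace (𝓡 2) p) :
    shapeOperatorH g h φ p v = (1 / 2 : ℝ) • tensionShape g h φ p v := by
  have hb := isBilin_secondFundamentalForm hφ p
  have hm : meanCurvature g h φ p = (1 / 2 : ℝ) • tension g h φ p := by
    unfold meanCurvature tension
    norm_num
  refine inner_ext g fun u => ?_
  rw [map_smul, smul_apply, inner_tensionShape hφ, shapeOperatorH, inner_sharp_of_linear g p, hm,
    map_smul]
  refine ⟨fun a b => ?_, fun r a => ?_⟩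
  · rw [hb.add_right, map_add, add_apply]
  · rw [hb.smul_right, map_smul, smul_apply]

/-- By Weingarten each of the last two terms of S₂ contributes A_τ, and ⟨dφ, ∇τ⟩ = -trace A_τ =
-|τ|², so the identity gets the coefficient ½|τ|² - |τ|². -/
theorem stressBienergy_eq (hφ : IsRiemannianImmersion g h φ) (p : M) (v : TangentSpace (𝓡 2) p) :
    stressBienergy g h φ p v = (2 : ℝ) • tensionShape g h φ p v +
      (-(1 / 2 : ℝ) * normSqTension g h φ p) • v := by
  have ht : (trace g p fun u u' => h.inner (φ p) (mfderiv (𝓡 2) (𝓡 n) φ p u)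
      (nablaAlong h φ (tension g h φ) p u')) = -normSqTension g h φ p := by
    rw [trace_tensionShape hφ]
    simp only [inner_mfderiv_nablaAlong_tension hφ, inner_tensionShape hφ, trace, smul_neg,
      Finset.sum_neg_distrib]
  have hv : ∀ w, (1 / 2 : ℝ) * normSqTension g h φ p * g.inner p v w
      + (trace g p fun u u' => h.inner (φ p) (mfderiv (𝓡 2) (𝓡 n) φ p u)
          (nablaAlong h φ (tension g h φ) p u')) * g.inner p v w
      - h.inner (φ p) (mfderiv (𝓡 2) (𝓡 n) φ p v) (nablaAlong h φ (tension g h φ) p w)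
      - h.inner (φ p) (mfderiv (𝓡 2) (𝓡 n) φ p w) (nablaAlong h φ (tension g h φ) p v) =
      g.inner p ((2 : ℝ) • tensionShape g h φ p v +
        (-(1 / 2 : ℝ) * normSqTension g h φ p) • v) w := by
    intro w
    rw [ht, inner_mfderiv_nablaAlong_tension hφ, inner_mfderiv_nablaAlong_tension hφ,
      secondFundamentalForm_symm hφ p w v, ← inner_tensionShape hφ, map_add, map_smul, map_smul,
      add_apply, smul_apply, smul_apply, smul_eq_mul, smul_eq_mul]
    ring
  refine inner_ext g fun u => ?_
  unfold stressBienergy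
  simp only [hv]
  exact inner_sharp_of_linear g p ⟨fun a b => map_add _ a b, fun r a => map_smul _ r a⟩ u

end ImmersedSurfaces

/-! ### Adding a multiple of the identity to a tensor field. -/

section AffineCombinations

variable {M : Type*} [TopologicalSpace M]
  [ChartedSpace (EuclideanSpace ℝ (Fin 2)) M] [IsManifold (𝓡 2) ∞ M]
  {g : RiemMetric 2 M} {T T' : Π q : M, TangentSpace (𝓡 2) q → TangentSpace (𝓡 2) q}
  {a c : ℝ} {s t : M → ℝ} {x : M} {e₁ e₂ : Euc 2 → Euc 2} {z : Euc 2}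

theorem isLinearMap_affine (hT : IsSmoothTensor T) (h : ∀ p v, T' p v = a • T p v + s p • v)
    (q : M) : IsLinearMap ℝ (T' q) := by
  constructor <;> intros <;> simp only [h, (hT.linear q).map_add, (hT.linear q).map_smul] <;> module

theorem tensorCoord_affine (hT : IsSmoothTensor T) (h : ∀ p v, T' p v = a • T p v + s p • v)
    (hz : z ∈ (chart 2 x).target) :
    tensorCoord x T' z = a • tensorCoord x T z +
      (s ∘ (chart 2 x).symm) z • ContinuousLinearMap.id ℝ (Euc 2) := by
  ext1 v
  rw [tensorCoord_apply (isLinearMap_affine hT h), h, map_add, map_smul, map_smul,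
    toCoord_ofCoord ((chart 2 x).map_target hz), add_apply, smul_apply,
    tensorCoord_apply hT.linear]
  rfl

theorem isSmoothTensor_affine (hT : IsSmoothTensor T) (h : ∀ p v, T' p v = a • T p v + s p • v)
    (hs : ∀ x : M, ContDiffOn ℝ ∞ (s ∘ (chart 2 x).symm) (chart 2 x).target) :
    IsSmoothTensor T' :=
  ⟨isLinearMap_affine hT h, fun x => (((hT.smooth x).const_smul a).add
    ((hs x).smul contDiffOn_const)).congr fun _ hz => tensorCoord_affine hT h hz⟩

theorem symm_affine (hs : ∀ p v w, g.inner p (T p v) w = g.inner p (T p w) v)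
    (h : ∀ p v, T' p v = a • T p v + s p • v) (p : M) (v w : TangentSpace (𝓡 2) p) :
    g.inner p (T' p v) w = g.inner p (T' p w) v := by
  rw [h, h, map_add, map_add, map_smul, map_smul, map_smul, map_smul, add_apply, add_apply,
    smul_apply, smul_apply, smul_apply, smul_apply, hs p v w, g.symm p v w]

theorem comp_affine (hT : IsSmoothTensor T) (h : ∀ p v, T' p v = a • T p v + s p • v)
    (hz : z ∈ (chart 2 x).target) (e f : Euc 2 → Euc 2) :
    comp (coordMetric g x) (tensorCoord x T') e f z =
      a * comp (coordMetric g x) (tensorCoord x T) e f z +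
        (s ∘ (chart 2 x).symm) z * coordMetric g x z (e z) (f z) := by
  unfold comp
  rw [tensorCoord_affine hT h hz]
  simp only [add_apply, smul_apply, map_add, map_smul, smul_eq_mul]
  rfl

theorem trace_affine (hT : IsSmoothTensor T) (h : ∀ p v, T' p v = a • T p v + s p • v)
    (hs : ∀ x : M, ContDiffOn ℝ ∞ (s ∘ (chart 2 x).symm) (chart 2 x).target) (p : M) :
    (trace g p fun v w => g.inner p (T' p v) w) =
      a * (trace g p fun v w => g.inner p (T p v) w) + 2 * s p := by
  have hp := mem_chart_source (Euc 2) p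
  have hz := (chart 2 p).map_source hp
  obtain ⟨e₁, e₂, F⟩ := exists_isChartFrame g p
  rw [F.trace_tensor_eq hp hT, F.trace_tensor_eq hp (isSmoothTensor_affine hT h hs),
    comp_affine hT h hz, comp_affine hT h hz, F.frame.norm₁ _ hz, F.frame.norm₂ _ hz,
    Function.comp_apply, (chart 2 p).left_inv hp]
  ring

theorem normSq_grad_const_mul (g : RiemMetric 2 M) (c : ℝ)
    (ht : ∀ x : M, ContDiffOn ℝ ∞ (t ∘ (chart 2 x).symm) (chart 2 x).target) (p : M) :
    g.inner p (grad g (fun q => c * t q) p) (grad g (fun q => c * t q) p) =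
      c ^ 2 * g.inner p (grad g t p) (grad g t p) := by
  have hp := mem_chart_source (Euc 2) p
  have hz := (chart 2 p).map_source hp
  obtain ⟨e₁, e₂, F⟩ := exists_isChartFrame g p
  have hd := ((ht p).contDiffAt ((chart 2 p).open_target.mem_nhds hz)).differentiableAt (by simp)
  have hd' : HasFDerivAt ((fun q => c * t q) ∘ (chart 2 p).symm) _ (chart 2 p p) :=
    hd.hasFDerivAt.const_mul c
  rw [F.normSq_grad_eq hp hd, F.normSq_grad_eq hp hd'.differentiableAt, hd'.fderiv]
  simp only [smul_apply, smul_eq_mul]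
  ring

variable (hT : IsSmoothTensor T) (hs : ∀ p v w, g.inner p (T p v) w = g.inner p (T p w) v)
  (ht : ∀ p, t p = trace g p fun v w => g.inner p (T p v) w)
  (h : ∀ p v, T' p v = a • T p v + (c * t p) • v)

include hT hs ht h

theorem isSmoothTensor_affine_trace : IsSmoothTensor T' :=
  isSmoothTensor_affine hT h fun x => contDiffOn_const.mul (contDiffOn_trace hT ht x)

/-- The cross term is 2ac t · trace T = 2ac t², and |Id|² = 2. -/
theorem normSqTensor_affine (p : M) :
    normSqTensor g T' p = a ^ 2 * normSqTensor g T p + (2 * a * c + 2 * c ^ 2) * t p ^ 2 := by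
  have hp := mem_chart_source (Euc 2) p
  have hz := (chart 2 p).map_source hp
  obtain ⟨e₁, e₂, F⟩ := exists_isChartFrame g p
  have h1 := trace_comp_symm F hT ht hz
  rw [Function.comp_apply, (chart 2 p).left_inv hp] at h1
  rw [F.normSqTensor_eq hp hT hs,
    F.normSqTensor_eq hp (isSmoothTensor_affine_trace hT hs ht h) (symm_affine hs h),
    IsFrame.frameNormSq, comp_affine hT h hz, comp_affine hT h hz, comp_affine hT h hz,
    F.frame.norm₁ _ hz, F.frame.norm₂ _ hz, F.frame.orth _ hz, Function.comp_apply,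
    (chart 2 p).left_inv hp, h1, IsFrame.frameNormSq]
  ring

/-- Since ∇Id = 0, the same expansion holds with dt in place of t: the trace of ∇T is dt. -/
theorem normSqNablaTensor_affine (p : M) :
    normSqNablaTensor g T' p = a ^ 2 * normSqNablaTensor g T p +
      (2 * a * c + 2 * c ^ 2) * g.inner p (grad g t p) (grad g t p) := by
  have hp := mem_chart_source (Euc 2) p
  have hz := (chart 2 p).map_source hp
  obtain ⟨e₁, e₂, F⟩ := exists_isChartFrame g p
  have hnhds := (chart 2 p).open_target.mem_nhds hz
  have hd := ((contDiffOn_trace hT ht p).contDiffAt hnhds).differentiableAt (by simp)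
  have d₁ := ((F.frame.contDiffAt_comp (hT.smooth p) hz F.frame.smooth₁
    F.frame.smooth₁).differentiableAt (by simp)).hasFDerivAt
  have d₂ := ((F.frame.contDiffAt_comp (hT.smooth p) hz F.frame.smooth₁
    F.frame.smooth₂).differentiableAt (by simp)).hasFDerivAt
  have d₃ := ((F.frame.contDiffAt_comp (hT.smooth p) hz F.frame.smooth₂
    F.frame.smooth₂).differentiableAt (by simp)).hasFDerivAt
  have dt := hd.hasFDerivAt
  have ht' : fderiv ℝ (t ∘ (chart 2 p).symm) (chart 2 p p) = _ :=
    ((d₁.add d₃).congr_of_eventuallyEq (by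
      filter_upwards [hnhds] with w hw using trace_comp_symm F hT ht hw)).fderiv
  have e₁₁ : fderiv ℝ (comp (coordMetric g p) (tensorCoord p T') e₁ e₁) (chart 2 p p) = _ :=
    (((d₁.const_mul a).add (dt.const_mul c)).congr_of_eventuallyEq (by
      filter_upwards [hnhds] with w hw
      rw [comp_affine hT h hw, F.frame.norm₁ _ hw, mul_one]
      rfl)).fderiv
  have e₁₂ : fderiv ℝ (comp (coordMetric g p) (tensorCoord p T') e₁ e₂) (chart 2 p p) = _ :=
    ((d₂.const_mul a).congr_of_eventuallyEq (by
      filter_upwards [hnhds] with w hw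
      rw [comp_affine hT h hw, F.frame.orth _ hw, mul_zero, add_zero])).fderiv
  have e₂₂ : fderiv ℝ (comp (coordMetric g p) (tensorCoord p T') e₂ e₂) (chart 2 p p) = _ :=
    (((d₃.const_mul a).add (dt.const_mul c)).congr_of_eventuallyEq (by
      filter_upwards [hnhds] with w hw
      rw [comp_affine hT h hw, F.frame.norm₂ _ hw, mul_one]
      rfl)).fderiv
  rw [F.normSqNablaTensor_eq hp hT hs,
    F.normSqNablaTensor_eq hp (isSmoothTensor_affine_trace hT hs ht h) (symm_affine hs h),
    F.normSq_grad_eq hp hd]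
  unfold IsFrame.frameNormSqNabla nab₁₁ nab₁₂ nab₂₂
  rw [e₁₁, e₁₂, e₂₂, ht', comp_affine hT h hz, comp_affine hT h hz, comp_affine hT h hz,
    F.frame.norm₁ _ hz, F.frame.norm₂ _ hz, F.frame.orth _ hz]
  simp only [add_apply, sub_apply, smul_apply, smul_eq_mul]
  ring

end AffineCombinations

/-! ### From the stress-bienergy tensor to the shape operator. -/

section ImmersedSurfaces

variable {n : ℕ} {M N : Type*}
  [TopologicalSpace M] [ChartedSpace (EuclideanSpace ℝ (Fin 2)) M] [IsManifold (𝓡 2) ∞ M]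
  [TopologicalSpace N] [ChartedSpace (EuclideanSpace ℝ (Fin n)) N] [IsManifold (𝓡 n) ∞ N]
  {g : RiemMetric 2 M} {h : RiemMetric n N} {φ : M → N}

theorem contDiffOn_normSqTension (hφ : IsRiemannianImmersion g h φ) (x : M) :
    ContDiffOn ℝ ∞ (normSqTension g h φ ∘ (chart 2 x).symm) (chart 2 x).target :=
  contDiffOn_trace (isSmoothTensor_tensionShape hφ) (trace_tensionShape hφ) x

theorem isSmoothTensor_stressBienergy (hφ : IsRiemannianImmersion g h φ) :
    IsSmoothTensor (stressBienergy g h φ) :=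
  isSmoothTensor_affine (isSmoothTensor_tensionShape hφ) (stressBienergy_eq hφ) fun x =>
    contDiffOn_const.mul (contDiffOn_normSqTension hφ x)

theorem stressBienergy_symm (hφ : IsRiemannianImmersion g h φ) (p : M)
    (v w : TangentSpace (𝓡 2) p) :
    g.inner p (stressBienergy g h φ p v) w = g.inner p (stressBienergy g h φ p w) v :=
  symm_affine (tensionShape_symm hφ) (stressBienergy_eq hφ) p v w

/-- The part 2 A_τ contributes 2|τ|², and the identity, of trace 2, contributes -|τ|². -/
theorem trace_stressBienergy (hφ : IsRiemannianImmersion g h φ) (p : M) :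
    normSqTension g h φ p = trace g p fun v w => g.inner p (stressBienergy g h φ p v) w := by
  rw [trace_affine (isSmoothTensor_tensionShape hφ) (stressBienergy_eq hφ) fun x =>
    contDiffOn_const.mul (contDiffOn_normSqTension hφ x), ← trace_tensionShape hφ]
  ring

theorem shapeOperatorH_eq_stressBienergy (hφ : IsRiemannianImmersion g h φ) (p : M)
    (v : TangentSpace (𝓡 2) p) :
    shapeOperatorH g h φ p v = (1 / 4 : ℝ) • stressBienergy g h φ p v +
      ((1 / 8 : ℝ) * normSqTension g h φ p) • v := by
  rw [shapeOperatorH_eq hφ, stressBienergy_eq hφ]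
  module

theorem normSqMeanCurvature_eq (g : RiemMetric 2 M) (h : RiemMetric n N) (φ : M → N) :
    normSqMeanCurvature g h φ = fun p => (1 / 4 : ℝ) * normSqTension g h φ p := by
  ext p
  have hm : meanCurvature g h φ p = (1 / 2 : ℝ) • tension g h φ p := by
    unfold meanCurvature tension
    norm_num
  rw [normSqMeanCurvature, hm, map_smul, map_smul, smul_apply, smul_eq_mul, smul_eq_mul,
    ← normSqTension]
  ring

/-- For a = 1/4 and c = 1/8 the correction 2ac + 2c² is 3/32. In the curvature term 2|H|⁴ = t²/8,
and 3/32 - 1/8 = -1/32 is the coefficient required by (1/16)(|S₂|² - t²/2). -/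
theorem shapeOperatorH_integrand (hφ : IsRiemannianImmersion g h φ) (p : M) :
    normSqNablaTensor g (shapeOperatorH g h φ) p + 2 * gaussCurvature g p *
        (normSqTensor g (shapeOperatorH g h φ) p - 2 * normSqMeanCurvature g h φ p ^ 2) =
      (1 / 16 : ℝ) * (normSqNablaTensor g (stressBienergy g h φ) p + 2 * gaussCurvature g p *
        (normSqTensor g (stressBienergy g h φ) p - normSqTension g h φ p ^ 2 / 2)) +
      (3 / 32 : ℝ) * g.inner p (grad g (normSqTension g h φ) p)
        (grad g (normSqTension g h φ) p) := by
  have hS := isSmoothTensor_stressBienergy hφ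
  rw [normSqNablaTensor_affine hS (stressBienergy_symm hφ) (trace_stressBienergy hφ)
      (shapeOperatorH_eq_stressBienergy hφ),
    normSqTensor_affine hS (stressBienergy_symm hφ) (trace_stressBienergy hφ)
      (shapeOperatorH_eq_stressBienergy hφ), normSqMeanCurvature_eq]
  ring

theorem normSq_grad_normSqMeanCurvature (hφ : IsRiemannianImmersion g h φ) (p : M) :
    g.inner p (grad g (normSqMeanCurvature g h φ) p) (grad g (normSqMeanCurvature g h φ) p) =
      (1 / 16 : ℝ) * g.inner p (grad g (normSqTension g h φ) p)
        (grad g (normSqTension g h φ) p) := by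
  rw [normSqMeanCurvature_eq, normSq_grad_const_mul g _ (contDiffOn_normSqTension hφ)]
  norm_num

end ImmersedSurfaces

end BiconservativeSurface

end

end

/-! ### The two integral formulas. -/

theorem mainTheorem8 {n : ℕ} {M N : Type*}
    [TopologicalSpace M] [T2Space M] [CompactSpace M]
    [ChartedSpace (EuclideanSpace ℝ (Fin 2)) M] [IsManifold (𝓡 2) ∞ M]
    [MeasurableSpace M] [BorelSpace M]
    [TopologicalSpace N] [ChartedSpace (EuclideanSpace ℝ (Fin n)) N] [IsManifold (𝓡 n) ∞ N]
    (g : RiemMetric 2 M) (h : RiemMetric n N) (φ : M → N)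
    (hφ : IsRiemannianImmersion g h φ)
    (hbic : IsBiconservative g h φ) :
    (Integrable (fun p =>
        normSqNablaTensor g (stressBienergy g h φ) p
          + 2 * gaussCurvature g p *
            (normSqTensor g (stressBienergy g h φ) p
              - (normSqTension g h φ p) ^ 2 / 2))
        (riemannianVolume g) ∧
      Integrable (fun p =>
        g.inner p
          (grad g (normSqTension g h φ) p)
          (grad g (normSqTension g h φ) p))
        (riemannianVolume g) ∧
      ∫ p, (normSqNablaTensor g (stressBienergy g h φ) p
          + 2 * gaussCurvature g p *
            (normSqTensor g (stressBienergy g h φ) p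
              - (normSqTension g h φ p) ^ 2 / 2))
          ∂(riemannianVolume g)
        = ∫ p, g.inner p
          (grad g (normSqTension g h φ) p)
          (grad g (normSqTension g h φ) p)
          ∂(riemannianVolume g)) ∧
    (Integrable (fun p =>
        normSqNablaTensor g (shapeOperatorH g h φ) p
          + 2 * gaussCurvature g p *
            (normSqTensor g (shapeOperatorH g h φ) p
              - 2 * (normSqMeanCurvature g h φ p) ^ 2))
        (riemannianVolume g) ∧
      Integrable (fun p =>
        g.inner p
          (grad g (normSqMeanCurvature g h φ) p)
          (grad g (normSqMeanCurvature g h φ) p))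
        (riemannianVolume g) ∧
      ∫ p, (normSqNablaTensor g (shapeOperatorH g h φ) p
          + 2 * gaussCurvature g p *
            (normSqTensor g (shapeOperatorH g h φ) p
              - 2 * (normSqMeanCurvature g h φ p) ^ 2))
          ∂(riemannianVolume g)
        = (5 / 2 : ℝ) * ∫ p, g.inner p
          (grad g (normSqMeanCurvature g h φ) p)
          (grad g (normSqMeanCurvature g h φ) p)
          ∂(riemannianVolume g)) := by
  have hS := isSmoothTensor_stressBienergy hφ
  have hgrad := continuous_normSq_grad g (contDiffOn_normSqTension hφ)
  have hf := continuous_weitzenboeck hS (stressBienergy_symm hφ) hbic (trace_stressBienergy hφ)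
  have hint := integral_weitzenboeck hS (stressBienergy_symm hφ) hbic (trace_stressBienergy hφ)
  -- Adding the continuous function |grad t|² back shows that the first integrand is itself
  -- continuous, hence integrable on the compact surface.
  have hF := hf.add hgrad
  simp only [Pi.add_def, sub_add_cancel] at hF
  have hgradi := hgrad.integrable_of_hasCompactSupport (μ := riemannianVolume g)
    (HasCompactSupport.of_compactSpace _)
  have hFi := hF.integrable_of_hasCompactSupport (μ := riemannianVolume g)
    (HasCompactSupport.of_compactSpace _)
  rw [integral_sub hFi hgradi, sub_eq_zero] at hint
  refine ⟨⟨hFi, hgradi, hint⟩, ?_⟩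
  simp only [shapeOperatorH_integrand hφ, normSq_grad_normSqMeanCurvature hφ]
  refine ⟨(hFi.const_mul _).add (hgradi.const_mul _), hgradi.const_mul _, ?_⟩
  -- After the first formula is inserted, the claim is 1/16 + 3/32 = 5/2 · 1/16.
  rw [integral_add (hFi.const_mul _) (hgradi.const_mul _), integral_const_mul, integral_const_mul,
    integral_const_mul, hint]
  ring
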